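/- **Model.** The wall is the $x$-axis of the plane. A swimmer of thickness $r>0$ in a fluid of viscosity $\mu>0$ consists of three straight links $i\in\{-1,0,1\}$ of lengths $L_{-1}=L_1=L>0$ and $L_0=\lambda L$, $\lambda>0$. Its configuration is $q=(x,y,\theta,\alpha^{(-1)},\alpha^{(1)})\in\mathbb R^5$: the midpoint $\mathbf x=(x,y)$ of the central link, the angle $\theta$ of the central link with the wall, and the angles $\alpha^{(\pm1)}$ of the outer links relative to the central one. With $\alpha^{(0)}=0$, let $\mathbf e^{(i)}=(\cos(\theta+\alpha^{(i)}),\sin(\theta+\alpha^{(i)}))$, let $\mathbf n^{(i)}$ be $\mathbf e^{(i)}$ rotated by $\pi/2$, and let $\sigma_\pm^{(i)}=\operatorname{sign}(i\pm\tfrac12)$. The point of link $i$ at distance $s\in[0,L_i]$ from its hinge is $\mathbf x^{(i)}(s)=\mathbf x+\sigma_-^{(i)}\frac{L_0}2\mathbf e^{(0)}+\sigma_+^{(i)}s\,\mathbf e^{(i)}$. The hydrodynamic force density at this point is $$\mathbf f^{(i)}(s)=\big(G^{(i)}+sK^{(i)}\big)\big(\mathbf I-\tfrac12\,\mathbf e^{(i)}\otimes\mathbf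 e^{(i)}\big)\dot{\mathbf x}^{(i)}(s),$$ where $G^{(i)}+sK^{(i)}$ is the first-order expansion, in the distance from the wall and about the value $y$, of the wall-corrected drag coefficient $4\pi\mu/\log(2d/r)$ ($d$ being the distance of $\mathbf x^{(i)}(s)$ from the wall). That is, with $\ell=\log(2y/r)$, $$G^{(i)}=\frac{2\pi\mu}{\ell}\Big(2-\frac{\sigma_-^{(i)}L_0\sin\theta}{y\,\ell}\Big),\qquad K^{(i)}=-\frac{4\pi\mu\,\sigma_+^{(i)}\sin(\theta+\alpha^{(i)})}{y\,\ell^2}.$$ The total force and the total torque about $\mathbf x$ (integrals over $s\in[0,L_i]$, summed over $i$) are linear in the velocities. With $\mathbf M=\mathbf M(q)$ the $3\times3$ matrix of the coefficients of $(\dot x,\dot y,\dot\theta)$ and $\mathbf g^{(\pm1)}=\mathbf g^{(\pm1)}(q)\in\mathbb R^3$ those of $\dot\alpha^{(\pm1)}$, they are equal to $\mathbf M(\dot x,\dot y,\dot\theta)^\top+\mathbf g^{(-1)}\dot\alpha^{(-1)}+\mathbf g^{(1)}\dot\alpha^{(1)}$. Where $2y>r$ and $\det\mathbf M\ne0$,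 requiring force and torque to vanish and taking $\dot\alpha^{(\pm1)}=u^{(\pm1)}$ as controls gives the driftless control system $$\dot q=u^{(-1)}\mathbf h^{(-1)}(q)+u^{(1)}\mathbf h^{(1)}(q),\qquad \mathbf h^{(-1)}=\begin{pmatrix}-\mathbf M^{-1}\mathbf g^{(-1)}\\1\\0\end{pmatrix},\quad \mathbf h^{(1)}=\begin{pmatrix}-\mathbf M^{-1}\mathbf g^{(1)}\\0\\1\end{pmatrix}.$$ Call the system *locally controllable at* $q_0$ if for every neighbourhood $U$ of $q_0$, every $T>0$ and every $\rho>0$ there is a neighbourhood $V$ of $q_0$ such that any two $p,p'\in V$ are joined by a trajectory $q:[0,T]\to U$ of the system, contained in $\{2y>r,\ \det\mathbf M\neq0\}$, with $q(0)=p$, $q(T)=p'$ and measurable controls bounded by $\rho$ in absolute value. **Theorem.** Let $\mu,r,L,\lambda>0$, $x\in\mathbb R$ and $2y>r$ (in particular, any $y\gg r$). Then the system is locally controllable at every configuration in a neighbourhood of the aligned configuration parallel to the wall $(x,y,0,0,0)$, and in particular at $(x,y,0,0,0)$ itself. -/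

import Mathlib

open Set Filter MeasureTheory
open scoped Topology Matrix

noncomputable section

namespace Purcell

/-- Configurations `(x, y, θ, α⁽⁻¹⁾, α⁽¹⁾)`: position of the midpoint of the central link (the wall is
the line `y = 0`), orientation of the central link with respect to the wall, and the relative angles
of the two outer links. The links are indexed by `i ∈ {-1, 0, 1}`, the central one being `0`. -/
abbrev Config : Type := Fin 5 → ℝ

/-- The relative angle of link `i`, with the convention `α⁽⁰⁾ = 0`. -/
def relAngle (q : Config) (i : ℤ) : ℝ :=
  if i = -1 then q 3 else if i = 1 then q 4 else 0

/-- `σ₊⁽ⁱ⁾ = sign (i + 1/2)`. -/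
def sigmaPlus (i : ℤ) : ℝ := ((2 * i + 1).sign : ℤ)

/-- `σ₋⁽ⁱ⁾ = sign (i - 1/2)`. -/
def sigmaMinus (i : ℤ) : ℝ := ((2 * i - 1).sign : ℤ)

/-- The unit direction vector of link `i`. -/
def tangent (q : Config) (i : ℤ) : Fin 2 → ℝ :=
  ![Real.cos (q 2 + relAngle q i), Real.sin (q 2 + relAngle q i)]

/-- The unit normal vector of link `i`: the direction vector rotated by `π / 2`. -/
def normal (q : Config) (i : ℤ) : Fin 2 → ℝ :=
  ![-Real.sin (q 2 + relAngle q i), Real.cos (q 2 + relAngle q i)]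

/-- The matrix `I - (1/2) e⁽ⁱ⁾ ⊗ e⁽ⁱ⁾` of the anisotropic drag on link `i` (the drag coefficient along
the link is half of the normal one). -/
def dragMatrix (q : Config) (i : ℤ) : Matrix (Fin 2) (Fin 2) ℝ :=
  1 - (1 / 2 : ℝ) • Matrix.vecMulVec (tangent q i) (tangent q i)

/-- `ℓ = log (2 y / r)`. -/
def logDist (r : ℝ) (q : Config) : ℝ := Real.log (2 * q 1 / r)

/-- Constant term of the linearized normal drag coefficient `G⁽ⁱ⁾ + s K⁽ⁱ⁾` at the point of link `i` at
distance `s` from its hinge. It is the first-order expansion of `4 π μ / log (2 d / r)` at `d = y`, where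
`d` is the distance of that point from the wall. -/
def dragG (μ r : ℝ) (len : ℤ → ℝ) (q : Config) (i : ℤ) : ℝ :=
  2 * Real.pi * μ / logDist r q *
    (2 - sigmaMinus i * len 0 * Real.sin (q 2) / (q 1 * logDist r q))

/-- Linear term of the linearized normal drag coefficient `G⁽ⁱ⁾ + s K⁽ⁱ⁾`. -/
def dragK (μ r : ℝ) (q : Config) (i : ℤ) : ℝ :=
  -(4 * Real.pi * μ * sigmaPlus i * Real.sin (q 2 + relAngle q i) / (q 1 * logDist r q ^ 2))

/-- The moment `∫₀^{Lᵢ} (G⁽ⁱ⁾ + s K⁽ⁱ⁾) sᵏ ds` of the linearized normal drag coefficient of link `i`. -/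
def dragMoment (μ r : ℝ) (len : ℤ → ℝ) (q : Config) (k : ℕ) (i : ℤ) : ℝ :=
  dragG μ r len q i * (len i ^ (k + 1) / (k + 1)) + dragK μ r q i * (len i ^ (k + 2) / (k + 2))

/-- The force-translation resistance matrix `A`. -/
def resistA (μ r : ℝ) (len : ℤ → ℝ) (q : Config) : Matrix (Fin 2) (Fin 2) ℝ :=
  ∑ i ∈ ({-1, 0, 1} : Finset ℤ), dragMoment μ r len q 0 i • dragMatrix q i

/-- The force-rotation (and torque-translation) resistance vector `γ`. -/
def resistGamma (μ r : ℝ) (len : ℤ → ℝ) (q : Config) : Fin 2 → ℝ :=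
  ∑ i ∈ ({-1, 0, 1} : Finset ℤ),
    ((dragMoment μ r len q 1 i * sigmaPlus i) • normal q i +
      (len 0 / 2 * sigmaMinus i * dragMoment μ r len q 0 i) • (dragMatrix q i *ᵥ normal q 0))

/-- The torque-rotation resistance coefficient `δ`. -/
def resistDelta (μ r : ℝ) (len : ℤ → ℝ) (q : Config) : ℝ :=
  ∑ i ∈ ({-1, 0, 1} : Finset ℤ),
    (len 0 ^ 2 / 4 * dragMoment μ r len q 0 i * (normal q 0 ⬝ᵥ (dragMatrix q i *ᵥ normal q 0)) +
      len 0 / 2 * (sigmaMinus i * sigmaPlus i) * dragMoment μ r len q 1 i *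
        (2 * (normal q 0 ⬝ᵥ normal q i)) +
      dragMoment μ r len q 2 i)

/-- The column of `B` that belongs to the outer link `i ∈ {-1, 1}`: the force that is due to a unit rate
of change of `α⁽ⁱ⁾`. -/
def shapeForce (μ r : ℝ) (len : ℤ → ℝ) (q : Config) (i : ℤ) : Fin 2 → ℝ :=
  (sigmaPlus i * dragMoment μ r len q 1 i) • normal q i

/-- The entry of `b` that belongs to the outer link `i ∈ {-1, 1}`: the torque that is due to a unit rate
of change of `α⁽ⁱ⁾`. -/
def shapeTorque (μ r : ℝ) (len : ℤ → ℝ) (q : Config) (i : ℤ) : ℝ :=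
  len 0 / 2 * dragMoment μ r len q 1 i * (normal q 0 ⬝ᵥ normal q i) + dragMoment μ r len q 2 i

/-- The grand resistance matrix `M`. -/
def grandResistance (μ r : ℝ) (len : ℤ → ℝ) (q : Config) : Matrix (Fin 3) (Fin 3) ℝ :=
  !![resistA μ r len q 0 0, resistA μ r len q 0 1, resistGamma μ r len q 0;
     resistA μ r len q 1 0, resistA μ r len q 1 1, resistGamma μ r len q 1;
     resistGamma μ r len q 0, resistGamma μ r len q 1, resistDelta μ r len q]

/-- The generalized force `g⁽ⁱ⁾` of the outer link `i ∈ {-1, 1}`. -/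
def shapeLoad (μ r : ℝ) (len : ℤ → ℝ) (q : Config) (i : ℤ) : Fin 3 → ℝ :=
  ![shapeForce μ r len q i 0, shapeForce μ r len q i 1, shapeTorque μ r len q i]

/-- The velocity `(ẋ, ẏ, θ̇) = -M⁻¹ g⁽ⁱ⁾` for which the total hydrodynamic force and torque vanish when
only `α⁽ⁱ⁾` changes, at unit rate. -/
def bodyVelocity (μ r : ℝ) (len : ℤ → ℝ) (q : Config) (i : ℤ) : Fin 3 → ℝ :=
  -((grandResistance μ r len q)⁻¹ *ᵥ shapeLoad μ r len q i)

/-- The control vector field `h⁽⁻¹⁾`. -/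
def fieldLeft (μ r : ℝ) (len : ℤ → ℝ) (q : Config) : Config :=
  ![bodyVelocity μ r len q (-1) 0, bodyVelocity μ r len q (-1) 1, bodyVelocity μ r len q (-1) 2, 1, 0]

/-- The control vector field `h⁽¹⁾`. -/
def fieldRight (μ r : ℝ) (len : ℤ → ℝ) (q : Config) : Config :=
  ![bodyVelocity μ r len q 1 0, bodyVelocity μ r len q 1 1, bodyVelocity μ r len q 1 2, 0, 1]

/-- The configurations at which the model makes sense: the drag coefficients are finite and positive at
the height of the central midpoint (`ℓ > 0`), and the grand resistance matrix is invertible. -/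
def IsAdmissible (μ r : ℝ) (len : ℤ → ℝ) (q : Config) : Prop :=
  r < 2 * q 1 ∧ (grandResistance μ r len q).det ≠ 0

/-- `q` solves `q̇ = u h⁽⁻¹⁾(q) + v h⁽¹⁾(q)` on `[0, T]` in the sense of Carathéodory, inside the set of
admissible configurations. -/
structure IsTrajectory (μ r : ℝ) (len : ℤ → ℝ) (T : ℝ) (u v : ℝ → ℝ) (q : ℝ → Config) : Prop where
  continuousOn : ContinuousOn q (Icc 0 T)
  admissible : ∀ t ∈ Icc 0 T, IsAdmissible μ r len (q t)
  motion : ∀ t ∈ Icc 0 T,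
    q t = q 0 + ∫ s in (0 : ℝ)..t, (u s • fieldLeft μ r len (q s) + v s • fieldRight μ r len (q s))

/-- (Small-time) local controllability at `q₀`: for every neighbourhood `U` of `q₀`, every time `T > 0` and
every bound `ρ > 0` on the controls, any two configurations close enough to `q₀` are joined, in time `T`, by
a trajectory that stays in `U` and has measurable controls bounded by `ρ`. -/
def LocallyControllableAt (μ r : ℝ) (len : ℤ → ℝ) (q₀ : Config) : Prop :=
  ∀ U ∈ 𝓝 q₀, ∀ T > 0, ∀ ρ > 0, ∃ V ∈ 𝓝 q₀, ∀ p ∈ V, ∀ p' ∈ V,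
    ∃ (u v : ℝ → ℝ) (q : ℝ → Config),
      Measurable u ∧ Measurable v ∧ (∀ t, |u t| ≤ ρ ∧ |v t| ≤ ρ) ∧
      IsTrajectory μ r len T u v q ∧ (∀ t ∈ Icc 0 T, q t ∈ U) ∧ q 0 = p ∧ q T = p'

/-- Link lengths `L₋₁ = L₁ = L` and `L₀ = lam * L`. -/
def linkLengths (L lam : ℝ) (i : ℤ) : ℝ := if i = 0 then lam * L else L

end Purcell

end

/-! Write S and V for the control fields with control values (1, 1) and (-1, 1). By the
Chow–Rashevskii theorem it is enough that iterated brackets of S and V span the five-dimensional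
tangent space near the aligned configuration, and spanning is an open condition, so it is checked at
that configuration only (`det_brackets_ne_zero`). The five fields are S, V, [S,V], [S,[S,[S,V]]] and
[V,[S,[S,V]]]. The first two span the shape directions and the brackets have no shape component.
There, [S,V] is a nonzero translation along the wall, [S,[S,[S,V]]] has no component normal to the
wall but does rotate the swimmer, and [V,[S,[S,V]]] has a component normal to the wall: the matrix
is triangular.

Many of the vanishing components reflect the mirror symmetry in a line normal to the wall, which
sends S to -S and V to V. The third-order brackets would not do: the normal component of [S,[S,V]]
and the angular component of [V,[S,V]] are differences of a free-space term and a wall term of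
opposite sign, and the latter vanishes at particular heights. The fourth-order components used
instead come from the wall alone and have a fixed sign for all lengths and heights, because a = N/(y
log(2y/r)), with N the total length, is positive, decreasing and convex in y.

The inverse of M is never expanded. The force balance is kept as a polynomial identity between
functions, and is differentiated along words in S and V, then evaluated (`SwimmerAlgebra`, the
lemmas `values_*`). At the aligned configuration the resistance is that of a straight rod, hence
diagonal, so every differentiated equation determines its one new unknown.
`smoothDerivation_lieBracket` turns brackets of fields into commutators of derivations, and
`swimmerAlgebra` links the algebra to the model.

Chow–Rashevskii (`exists_nhds_steerable`) follows from a maximal-rank argument. Among the smooth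
families of configurations reached by finitely many flow pieces, take one of maximal rank at its
base parameter. Prolonging it by a flow cannot raise the rank, so its tangent space contains the
control fields and, by differentiating their pull-backs along the flow, all iterated brackets. Hence
the family is a submersion, and running controls backwards brings the reached open set back to the
starting point. The smooth flows come from the implicit function theorem in the space of continuous
curves. -/

/-! ### Trajectories of a driftless system: reversal and concatenation. -/

section Steering

variable {E : Type*} [NormedAddCommGroup E] [NormedSpace ℝ E]

/-- `p'` can be reached from `p` in time `τ` along the control system `q̇ = u f(q) + v g(q)`, inside `U`
and with measurable controls bounded by `ρ`. -/
def Steerable (f g : E → E) (U : Set E) (ρ τ : ℝ) (p p' : E) : Prop :=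
  ∃ (u v : ℝ → ℝ) (q : ℝ → E), Measurable u ∧ Measurable v ∧ (∀ t, |u t| ≤ ρ ∧ |v t| ≤ ρ) ∧
    ContinuousOn q (Icc 0 τ) ∧
    (∀ t ∈ Icc 0 τ, q t = q 0 + ∫ s in (0 : ℝ)..t, (u s • f (q s) + v s • g (q s))) ∧
    (∀ t ∈ Icc 0 τ, q t ∈ U) ∧ q 0 = p ∧ q τ = p'

theorem intervalIntegrable_smul_of_bounded {u : ℝ → ℝ} {h : ℝ → E} {ρ a b : ℝ} (hu : Measurable u)
    (hb : ∀ t, |u t| ≤ ρ) (hab : a ≤ b) (hh : ContinuousOn h (Icc a b)) :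
    IntervalIntegrable (fun s => u s • h s) volume a b := by
  have h1 : IntervalIntegrable h volume a b := hh.intervalIntegrable_of_Icc hab
  rw [intervalIntegrable_iff_integrableOn_Ioc_of_le hab] at h1 ⊢
  exact h1.bdd_smul ρ hu.aestronglyMeasurable (Eventually.of_forall hb)

theorem intervalIntegrable_control {f g : E → E} {U : Set E} {u v : ℝ → ℝ} {q : ℝ → E} {ρ τ a b : ℝ}
    (hf : ContinuousOn f U) (hg : ContinuousOn g U) (hu : Measurable u) (hv : Measurable v)
    (hb : ∀ t, |u t| ≤ ρ ∧ |v t| ≤ ρ) (hq : ContinuousOn q (Icc 0 τ)) (hU : ∀ t ∈ Icc 0 τ, q t ∈ U)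
    (ha : 0 ≤ a) (hab : a ≤ b) (hbτ : b ≤ τ) :
    IntervalIntegrable (fun s => u s • f (q s) + v s • g (q s)) volume a b := by
  have hs : Icc a b ⊆ Icc 0 τ := Icc_subset_Icc ha hbτ
  have hq' := hq.mono hs
  have hm : MapsTo q (Icc a b) U := fun t ht => hU t (hs ht)
  exact (intervalIntegrable_smul_of_bounded hu (fun t => (hb t).1) hab (hf.comp hq' hm)).add
    (intervalIntegrable_smul_of_bounded hv (fun t => (hb t).2) hab (hg.comp hq' hm))

namespace Steerable

variable {f g : E → E} {U : Set E} {ρ τ τ₁ τ₂ : ℝ} {p p' p'' : E}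

theorem refl (hρ : 0 ≤ ρ) (τ : ℝ) (hp : p ∈ U) : Steerable f g U ρ τ p p :=
  ⟨fun _ => 0, fun _ => 0, fun _ => p, measurable_const, measurable_const, fun _ => by simpa using hρ,
    continuousOn_const, fun _ _ => by simp, fun _ _ => hp, rfl, rfl⟩

/-- Time reversal with negated controls; it works because the system has no drift. -/
theorem symm (hf : ContinuousOn f U) (hg : ContinuousOn g U) (hτ : 0 ≤ τ)
    (h : Steerable f g U ρ τ p p') : Steerable f g U ρ τ p' p := by
  obtain ⟨u, v, q, hu, hv, hb, hq, hm, hqU, h0, h1⟩ := h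
  have hmem : ∀ t ∈ Icc (0 : ℝ) τ, τ - t ∈ Icc (0 : ℝ) τ := fun t ht =>
    ⟨by linarith [ht.2], by linarith [ht.1]⟩
  refine ⟨fun t => -u (τ - t), fun t => -v (τ - t), fun t => q (τ - t),
    (hu.comp (measurable_const.sub measurable_id)).neg,
    (hv.comp (measurable_const.sub measurable_id)).neg, fun t => by simpa using hb (τ - t),
    hq.comp (continuousOn_const.sub continuousOn_id) hmem, fun t ht => ?_,
    fun t ht => hqU _ (hmem t ht), by simpa using h1, by simpa using h0⟩
  have hI := fun a b => intervalIntegrable_control (a := a) (b := b) hf hg hu hv hb hq hqU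
  have e1 := hm (τ - t) (hmem t ht)
  have e2 := hm τ ⟨hτ, le_rfl⟩
  have e3 := intervalIntegral.integral_add_adjacent_intervals
    (hI 0 (τ - t) le_rfl (hmem t ht).1 (hmem t ht).2) (hI (τ - t) τ (hmem t ht).1 (hmem t ht).2 le_rfl)
  have e4 := intervalIntegral.integral_comp_sub_left (a := 0) (b := t)
    (fun s => u s • f (q s) + v s • g (q s)) τ
  simp only [sub_zero] at e4 ⊢
  simp only [neg_smul, ← neg_add, intervalIntegral.integral_neg]
  rw [e4, e1, e2, ← e3]
  abel

theorem trans (hf : ContinuousOn f U) (hg : ContinuousOn g U) (h₁ : 0 ≤ τ₁) (h₂ : 0 ≤ τ₂)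
    (h : Steerable f g U ρ τ₁ p p') (h' : Steerable f g U ρ τ₂ p' p'') :
    Steerable f g U ρ (τ₁ + τ₂) p p'' := by
  obtain ⟨u, v, q, hu, hv, hb, hq, hm, hqU, h0, h1⟩ := h
  obtain ⟨u', v', q', hu', hv', hb', hq', hm', hqU', h0', h1'⟩ := h'
  have hmem : ∀ t ∈ Icc (0 : ℝ) (τ₁ + τ₂), ¬ t ≤ τ₁ → t - τ₁ ∈ Icc (0 : ℝ) τ₂ := fun t ht h =>
    ⟨by linarith, by linarith [ht.2]⟩
  have hms : MeasurableSet {t : ℝ | t ≤ τ₁} := measurableSet_Iic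
  have hI := fun a b => intervalIntegrable_control (a := a) (b := b) hf hg hu hv hb hq hqU
  have hI' := fun a b => intervalIntegrable_control (a := a) (b := b) hf hg hu' hv' hb' hq' hqU'
  set U₁ : ℝ → ℝ := fun t => if t ≤ τ₁ then u t else u' (t - τ₁) with hU₁
  set V₁ : ℝ → ℝ := fun t => if t ≤ τ₁ then v t else v' (t - τ₁) with hV₁
  set Q : ℝ → E := fun t => if t ≤ τ₁ then q t else q' (t - τ₁) with hQ
  have hF1 : ∀ t ≤ τ₁, 0 ≤ t → ∫ s in (0 : ℝ)..t, (U₁ s • f (Q s) + V₁ s • g (Q s)) =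
      ∫ s in (0 : ℝ)..t, (u s • f (q s) + v s • g (q s)) := fun t ht ht0 => by
    refine intervalIntegral.integral_congr fun s hs => ?_
    rw [uIcc_of_le ht0] at hs
    have : s ≤ τ₁ := hs.2.trans ht
    simp [hU₁, hV₁, hQ, this]
  have hEq : ∀ t, ∀ s ∈ Ioc τ₁ t, U₁ s • f (Q s) + V₁ s • g (Q s) =
      (fun s => u' s • f (q' s) + v' s • g (q' s)) (s - τ₁) := fun t s hs => by
    have : ¬ s ≤ τ₁ := not_le.mpr hs.1
    simp [hU₁, hV₁, hQ, this]
  refine ⟨U₁, V₁, Q, Measurable.ite hms hu (hu'.comp (measurable_id.sub_const _)),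
    Measurable.ite hms hv (hv'.comp (measurable_id.sub_const _)), fun t => ?_, ?_, fun t ht => ?_,
    fun t ht => ?_, by simp [hQ, h₁, h0], ?_⟩
  · by_cases h : t ≤ τ₁ <;> simp only [hU₁, hV₁, h, if_true, if_false]
    exacts [hb t, hb' _]
  · refine ContinuousOn.if' (s := Icc 0 (τ₁ + τ₂)) (p := fun t => t ≤ τ₁) ?_ ?_ ?_ ?_
    · rintro a ⟨ha, hfr⟩
      have : a = τ₁ := by simpa using frontier_le_subset_eq continuous_id continuous_const hfr
      subst this
      have : q' (a - a) = q a := by rw [sub_self, h0', h1]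
      simp only [le_refl, if_true]
      exact (hq a ⟨h₁, le_rfl⟩).mono fun x hx => ⟨hx.1.1, hx.2⟩
    · rintro a ⟨ha, hfr⟩
      have : a = τ₁ := by simpa using frontier_le_subset_eq continuous_id continuous_const hfr
      subst this
      have e : q' (a - a) = q a := by rw [sub_self, h0', h1]
      simp only [le_refl, if_true]
      rw [← e]
      have := (hq' 0 ⟨le_rfl, h₂⟩)
      refine Tendsto.comp (g := q') (f := fun x => x - a) (y := 𝓝[Icc 0 τ₂] (a - a)) (by simpa [ContinuousWithinAt] using this) ?_
      refine tendsto_nhdsWithin_iff.mpr ⟨?_, ?_⟩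
      · exact ((continuous_id.sub continuous_const).tendsto a).mono_left nhdsWithin_le_nhds
      · filter_upwards [self_mem_nhdsWithin] with x hx using hmem x hx.1 hx.2
    · exact hq.mono fun x hx => ⟨hx.1.1, hx.2⟩
    · exact hq'.comp (continuousOn_id.sub continuousOn_const) fun x hx => hmem x hx.1 hx.2
  · have hQ0 : Q 0 = q 0 := by simp [hQ, h₁]
    by_cases h : t ≤ τ₁
    · rw [hF1 t h ht.1, hQ0]
      simpa [hQ, h] using hm t ⟨ht.1, h⟩
    · have hlt := not_le.mp h
      have i1 : IntervalIntegrable (fun s => U₁ s • f (Q s) + V₁ s • g (Q s)) volume 0 τ₁ := by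
        refine (hI 0 τ₁ le_rfl h₁ le_rfl).congr fun s hs => ?_
        rw [uIoc_of_le h₁] at hs
        simp [hU₁, hV₁, hQ, hs.2]
      have i2 : IntervalIntegrable (fun s => U₁ s • f (Q s) + V₁ s • g (Q s)) volume τ₁ t := by
        have := (hI' 0 (t - τ₁) le_rfl (hmem t ht h).1 (hmem t ht h).2).comp_sub_right τ₁
        simp only [zero_add, sub_add_cancel] at this
        refine this.congr fun s hs => ?_
        rw [uIoc_of_le hlt.le] at hs
        exact (hEq t s hs).symm
      have e : ∫ s in τ₁..t, (U₁ s • f (Q s) + V₁ s • g (Q s)) =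
          ∫ s in τ₁..t, (fun s => u' s • f (q' s) + v' s • g (q' s)) (s - τ₁) :=
        intervalIntegral.integral_congr_ae (Eventually.of_forall fun s hs => by
          rw [uIoc_of_le hlt.le] at hs
          exact hEq t s hs)
      rw [← intervalIntegral.integral_add_adjacent_intervals i1 i2, hF1 τ₁ le_rfl h₁, e,
        intervalIntegral.integral_comp_sub_right (fun s => u' s • f (q' s) + v' s • g (q' s)),
        hQ0, ← add_assoc, ← hm τ₁ ⟨h₁, le_rfl⟩, h1, sub_self]
      have := hm' (t - τ₁) (hmem t ht h)
      rw [h0'] at this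
      simpa [hQ, h] using this
  · by_cases h : t ≤ τ₁
    · simpa [hQ, h] using hqU t ⟨ht.1, h⟩
    · simpa [hQ, h] using hqU' _ (hmem t ht h)
  -- If the second piece has zero duration, the final time falls in the first branch of the
  -- definition of `Q`.
  · by_cases h : τ₁ + τ₂ ≤ τ₁
    · have : τ₂ = 0 := by linarith
      subst this
      simp [hQ, h1, ← h1', h0']
    · simpa [hQ, h] using h1'

end Steerable

end Steering

/-! ### Smoothness of the composition operator on spaces of continuous functions. -/

section Nemytskii

universe w

variable {K : Type*} [TopologicalSpace K] [CompactSpace K]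
  {E F : Type w} [NormedAddCommGroup E] [NormedSpace ℝ E] [NormedAddCommGroup F] [NormedSpace ℝ F]

/-- Pointwise application of operator-valued to vector-valued continuous functions. -/
noncomputable def ContinuousMap.clmApplyCLM :
    C(K, E →L[ℝ] F) →L[ℝ] C(K, E) →L[ℝ] C(K, F) :=
  LinearMap.mkContinuous₂
    (LinearMap.mk₂ ℝ (fun (A : C(K, E →L[ℝ] F)) (h : C(K, E)) =>
        (⟨fun s => A s (h s), by fun_prop⟩ : C(K, F)))
      (fun _ _ _ => by ext; simp) (fun _ _ _ => by ext; simp)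
      (fun _ _ _ => by ext; simp) (fun _ _ _ => by ext; simp)) 1
    fun A h => by
      rw [one_mul, ContinuousMap.norm_le _ (by positivity)]
      exact fun s => ((A s).le_opNorm _).trans
        (mul_le_mul (A.norm_coe_le_norm s) (h.norm_coe_le_norm s) (norm_nonneg _) (by positivity))

@[simp]
theorem ContinuousMap.clmApplyCLM_apply (A : C(K, E →L[ℝ] F)) (h : C(K, E)) (s : K) :
    ContinuousMap.clmApplyCLM A h s = A s (h s) := rfl

/-- The mean value inequality at each point s, made uniform in s by the continuity of β ↦ f' ∘ β in
the sup norm. -/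
theorem ContinuousMap.hasFDerivAt_comp (f : C(E, F)) (f' : C(E, E →L[ℝ] F))
    (hf : ∀ x, HasFDerivAt f (f' x) x) (α : C(K, E)) :
    HasFDerivAt (fun α : C(K, E) => f.comp α) (ContinuousMap.clmApplyCLM (f'.comp α)) α := by
  rw [hasFDerivAt_iff_isLittleO_nhds_zero, Asymptotics.isLittleO_iff]
  intro c hc
  have hcont : Continuous fun β : C(K, E) => f'.comp β := ContinuousMap.continuous_postcomp f'
  obtain ⟨δ, hδ, h⟩ := (@Metric.continuousAt_iff C(K, E) C(K, E →L[ℝ] F) _ _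
    (fun β => f'.comp β) α).mp hcont.continuousAt c hc
  filter_upwards [Metric.ball_mem_nhds (0 : C(K, E)) hδ] with η hη
  rw [mem_ball_zero_iff] at hη
  rw [ContinuousMap.norm_le _ (by positivity)]
  intro s
  have hball : ∀ y ∈ Metric.ball (α s) δ, ‖f' y - f' (α s)‖ ≤ c := fun y hy => by
    -- A point y near α s is the value at s of a curve uniformly near α, namely α shifted by the
    -- constant y - α s. This turns sup-norm continuity into a bound on a ball around α s, with a
    -- radius independent of s.
    have hd : dist (α + ContinuousMap.const K (y - α s)) α < δ := by
      rw [dist_eq_norm, add_sub_cancel_left]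
      refine lt_of_le_of_lt ((ContinuousMap.norm_le _ (norm_nonneg (y - α s))).mpr fun _ => le_rfl) ?_
      rwa [← dist_eq_norm]
    have h2 := (ContinuousMap.dist_apply_le_dist s).trans (h hd).le
    simpa [dist_eq_norm] using h2
  have hs : ‖η s‖ < δ := (η.norm_coe_le_norm s).trans_lt hη
  have := (convex_ball (α s) δ).norm_image_sub_le_of_norm_hasFDerivWithin_le' (𝕜 := ℝ) (f := f)
    (f' := f') (φ := f' (α s)) (fun y _ => (hf y).hasFDerivWithinAt) hball
    (Metric.mem_ball_self hδ) (y := α s + η s) (by simpa [dist_eq_norm] using hs)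
  simp only [add_sub_cancel_left] at this
  exact this.trans (mul_le_mul_of_nonneg_left (η.norm_coe_le_norm s) hc.le)

/-- The derivative is the composition operator of f' followed by a bounded linear map, so induction
on n applies with F replaced by the operators from E to F. Putting E and F in one universe keeps the
induction possible. -/
theorem ContinuousMap.contDiff_comp (n : ℕ) (f : C(E, F)) (hf : ContDiff ℝ n f) :
    ContDiff ℝ n fun α : C(K, E) => f.comp α := by
  induction n generalizing F with
  | zero => exact contDiff_zero.mpr (ContinuousMap.continuous_postcomp f)
  | succ n ih =>
    rw [Nat.cast_succ] at hf ⊢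
    have hd := (contDiff_succ_iff_fderiv.mp hf).1
    have hf' := (contDiff_succ_iff_fderiv.mp hf).2.2
    let f' : C(E, E →L[ℝ] F) := ⟨fderiv ℝ f, hf'.continuous⟩
    refine contDiff_succ_iff_hasFDerivAt.mpr ⟨fun α => ContinuousMap.clmApplyCLM (f'.comp α), ?_,
      ContinuousMap.hasFDerivAt_comp f f' fun x => (hd x).hasFDerivAt⟩
    exact ContinuousMap.clmApplyCLM.contDiff.comp (ih f' hf')

end Nemytskii

/-! ### Smooth local flows from the implicit function theorem. -/

section Flow

variable {E : Type*} [NormedAddCommGroup E] [NormedSpace ℝ E]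

/-- The primitive `s ↦ ∫₀ˢ h` of a continuous function on the unit interval. -/
noncomputable def ContinuousMap.primitiveCLM : C(Icc (0 : ℝ) 1, E) →L[ℝ] C(Icc (0 : ℝ) 1, E) :=
  LinearMap.mkContinuous
    { toFun := fun h => ⟨fun s => ∫ t in (0 : ℝ)..s, IccExtend zero_le_one h t,
        (intervalIntegral.continuous_primitive
          (fun a b => (h.continuous.Icc_extend' (h := zero_le_one)).intervalIntegrable a b) 0).comp
            continuous_subtype_val⟩
      map_add' := fun h k => by
        ext s
        exact intervalIntegral.integral_add
          ((h.continuous.Icc_extend' (h := zero_le_one)).intervalIntegrable _ _)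
          ((k.continuous.Icc_extend' (h := zero_le_one)).intervalIntegrable _ _)
      map_smul' := fun c h => by
        ext s
        exact intervalIntegral.integral_smul c _ } 1
    fun h => by
      rw [one_mul, ContinuousMap.norm_le _ (norm_nonneg _)]
      intro s
      have := intervalIntegral.norm_integral_le_of_norm_le_const (a := 0) (b := (s : ℝ)) (C := ‖h‖)
        (f := IccExtend zero_le_one h) fun t _ => h.norm_coe_le_norm _
      refine this.trans ?_
      rw [sub_zero, abs_of_nonneg s.2.1]
      exact mul_le_of_le_one_right (norm_nonneg _) s.2.2

theorem ContinuousMap.primitiveCLM_apply (h : C(Icc (0 : ℝ) 1, E)) (s : Icc (0 : ℝ) 1) :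
    ContinuousMap.primitiveCLM h s = ∫ t in (0 : ℝ)..s, IccExtend zero_le_one h t := rfl

/-- The integral curves of `t • f` on the unit interval depend smoothly on `t` and on the starting
point. -/
theorem exists_contDiffAt_integralCurve [CompleteSpace E] {f : E → E} {n : ℕ} (hn : n ≠ 0)
    (hf : ContDiff ℝ n f) (x₀ : E) :
    ∃ α : ℝ × E → C(Icc (0 : ℝ) 1, E), ContDiffAt ℝ n α (0, x₀) ∧
      α (0, x₀) = ContinuousMap.const _ x₀ ∧
      ∀ᶠ z in 𝓝 ((0 : ℝ), x₀), α z = ContinuousMap.const _ z.2 +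
        z.1 • ContinuousMap.primitiveCLM ((⟨f, hf.continuous⟩ : C(E, E)).comp (α z)) := by
  -- The zeros of Φ are the integral curves of t • f starting at x. Since time is a parameter and
  -- the interval is fixed, all curves live in one Banach space.
  let Φ : (ℝ × E) × C(Icc (0 : ℝ) 1, E) → C(Icc (0 : ℝ) 1, E) := fun z =>
    z.2 - ContinuousLinearMap.const (R := ℝ) _ z.1.2 -
      z.1.1 • ContinuousMap.primitiveCLM ((⟨f, hf.continuous⟩ : C(E, E)).comp z.2)
  have hN := ContinuousMap.contDiff_comp (K := Icc (0 : ℝ) 1) n ⟨f, hf.continuous⟩ hf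
  have hΦ : ContDiff ℝ n Φ := by
    refine (contDiff_snd.sub ((ContinuousLinearMap.contDiff _).comp
      (contDiff_snd.comp contDiff_fst))).sub ((contDiff_fst.comp contDiff_fst).smul ?_)
    exact (ContinuousLinearMap.contDiff _).comp (hN.comp contDiff_snd)
  let u : (ℝ × E) × C(Icc (0 : ℝ) 1, E) := ((0, x₀), ContinuousMap.const _ x₀)
  have hn' : (n : WithTop ℕ∞) ≠ 0 := by exact_mod_cast hn
  have hΦu : ContDiffAt ℝ n Φ u := hΦ.contDiffAt
  -- At t = 0 the integral term disappears, so the partial derivative in the curve is the identity.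
  have hid : fderiv ℝ Φ u ∘L .inr ℝ (ℝ × E) C(Icc (0 : ℝ) 1, E) = ContinuousLinearMap.id ℝ _ := by
    have h1 : HasFDerivAt (fun β => Φ ((0, x₀), β)) (fderiv ℝ Φ u ∘L .inr ℝ (ℝ × E) _)
        (ContinuousMap.const _ x₀) :=
      ((hΦu.differentiableAt hn').hasFDerivAt).comp (ContinuousMap.const _ x₀)
        (hasFDerivAt_prodMk_right (0, x₀) _)
    have h2 : HasFDerivAt (fun β => Φ ((0, x₀), β)) (ContinuousLinearMap.id ℝ _)
        (ContinuousMap.const _ x₀) := by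
      simpa [Φ] using (hasFDerivAt_id (𝕜 := ℝ) (ContinuousMap.const (Icc (0 : ℝ) 1) x₀)).sub_const
        (ContinuousLinearMap.const (R := ℝ) (Icc (0 : ℝ) 1) x₀)
    exact h1.unique h2
  have hinv : (fderiv ℝ Φ u ∘L .inr ℝ (ℝ × E) C(Icc (0 : ℝ) 1, E)).IsInvertible := by
    rw [hid]
    exact ⟨ContinuousLinearEquiv.refl ℝ _, rfl⟩
  refine ⟨hΦu.implicitFunction hn' hinv, hΦu.contDiffAt_implicitFunction hn' hinv,
    hΦu.implicitFunction_apply_self hn' hinv, ?_⟩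
  filter_upwards [hΦu.eventually_apply_implicitFunction hn' hinv] with z hz
  have h0 : Φ u = 0 := by
    ext s
    simp [Φ, u]
  rw [h0] at hz
  simp only [Φ, sub_eq_zero] at hz
  exact sub_eq_iff_eq_add'.mp hz

/-- Cut-off by a bump function: the composition operator requires a field that is smooth on the
whole space. -/
theorem exists_contDiff_eventuallyEq [FiniteDimensional ℝ E] {f : E → E} {x₀ : E} {Ω : Set E}
    {n : ℕ∞} (hΩ : IsOpen Ω) (hx : x₀ ∈ Ω) (hf : ContDiffOn ℝ n f Ω) :
    ∃ f' : E → E, ContDiff ℝ n f' ∧ f' =ᶠ[𝓝 x₀] f := by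
  obtain ⟨r, hr, hrΩ⟩ := Metric.isOpen_iff.mp hΩ x₀ hx
  let b : ContDiffBump x₀ := ⟨r / 3, r / 2, by positivity, by linarith⟩
  refine ⟨fun x => b x • f x, contDiff_iff_contDiffAt.mpr fun x => ?_, ?_⟩
  · by_cases hxr : x ∈ Metric.ball x₀ r
    · exact b.contDiff.contDiffAt.smul (hf.contDiffAt (hΩ.mem_nhds (hrΩ hxr)))
    · have : (fun x => b x • f x) =ᶠ[𝓝 x] fun _ => 0 := by
        have hx' : x ∈ (Metric.closedBall x₀ (r / 2))ᶜ := fun h =>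
          hxr (Metric.closedBall_subset_ball (by linarith) h)
        filter_upwards [Metric.isClosed_closedBall.isOpen_compl.mem_nhds hx'] with y hy
        have : b y = 0 := b.zero_of_le_dist (by
          simpa [b] using (not_le.mp (by simpa [Metric.mem_closedBall] using hy)).le)
        simp [this]
      exact contDiffAt_const.congr_of_eventuallyEq this
  · filter_upwards [b.eventuallyEq_one] with y hy
    simp [hy]

/-- A smooth vector field has a local flow `φ`, smooth jointly in time and in the starting point. -/
theorem exists_localFlow [FiniteDimensional ℝ E] {f : E → E} {x₀ : E} {Ω : Set E}
    {n : ℕ} (hn : n ≠ 0) (hΩ : IsOpen Ω) (hx : x₀ ∈ Ω) (hf : ContDiffOn ℝ n f Ω) :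
    ∃ φ : ℝ × E → E, ContDiffAt ℝ n φ (0, x₀) ∧ (∀ᶠ x in 𝓝 x₀, φ (0, x) = x) ∧
      (∀ᶠ x in 𝓝 x₀, HasDerivAt (fun t => φ (t, x)) (f x) 0) ∧
      ∀ U ∈ 𝓝 x₀, ∀ᶠ z in 𝓝 ((0 : ℝ), x₀), ∃ q : ℝ → E, Continuous q ∧
        (∀ s ∈ Icc (0 : ℝ) 1, q s ∈ U) ∧ q 0 = z.2 ∧ q 1 = φ z ∧
        ∀ s ∈ Icc (0 : ℝ) 1, q s = q 0 + z.1 • ∫ t in (0 : ℝ)..s, f (q t) := by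
  have := FiniteDimensional.complete ℝ E
  obtain ⟨f', hf', hff'⟩ := exists_contDiff_eventuallyEq (n := (n : ℕ∞)) hΩ hx hf
  obtain ⟨α, hα, hα0, hαe⟩ := exists_contDiffAt_integralCurve hn hf' x₀
  have hn' : (n : WithTop ℕ∞) ≠ 0 := by exact_mod_cast hn
  have h0 : (0 : ℝ) ∈ Icc (0 : ℝ) 1 := by simp
  have h1 : (1 : ℝ) ∈ Icc (0 : ℝ) 1 := by simp
  have hslice : Tendsto (fun x : E => ((0 : ℝ), x)) (𝓝 x₀) (𝓝 (0, x₀)) :=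
    (Continuous.prodMk_right (0 : ℝ)).tendsto x₀
  refine ⟨fun z => ContinuousMap.evalCLM ℝ (⟨1, h1⟩ : Icc (0 : ℝ) 1) (α z),
    (ContinuousLinearMap.contDiff _).contDiffAt.comp _ hα, ?_, ?_, fun U hU => ?_⟩
  · filter_upwards [hslice.eventually hαe] with x hx
    rw [hx]
    simp
  · filter_upwards [hslice.eventually hαe, hslice.eventually hαe.eventually_nhds,
      hslice.eventually (hα.eventually (by simp)), hff'] with x hx hx' hxα hxf
    have hline : Tendsto (fun t : ℝ => (t, x)) (𝓝 0) (𝓝 (0, x)) :=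
      (Continuous.prodMk_left x).tendsto 0
    -- The flow is x + t • J t. Continuity of J at 0 with J 0 = f x already gives its time
    -- derivative there.
    let J : ℝ → E := fun t => ContinuousMap.primitiveCLM
      ((⟨f', hf'.continuous⟩ : C(E, E)).comp (α (t, x))) ⟨1, h1⟩
    have hJ : ContinuousAt J 0 := by
      have c1 : ContinuousAt (fun t : ℝ => α (t, x)) 0 :=
        ContinuousAt.comp (f := fun t : ℝ => (t, x)) hxα.continuousAt hline
      have c2 : Continuous fun β : C(Icc (0 : ℝ) 1, E) => ContinuousMap.evalCLM ℝ (⟨1, h1⟩ : Icc (0 : ℝ) 1)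
          (ContinuousMap.primitiveCLM ((⟨f', hf'.continuous⟩ : C(E, E)).comp β)) :=
        (ContinuousLinearMap.continuous _).comp ((ContinuousLinearMap.continuous _).comp
          (ContinuousMap.continuous_postcomp _))
      exact ContinuousAt.comp (f := fun t : ℝ => α (t, x)) c2.continuousAt c1
    have hJ0 : J 0 = f x := by
      have : α (0, x) = ContinuousMap.const _ x := by rw [hx]; simp
      simp only [J, this, ContinuousMap.primitiveCLM_apply]
      rw [← hxf]
      have e : ∀ t, IccExtend zero_le_one ((⟨f', hf'.continuous⟩ : C(E, E)).comp
          (ContinuousMap.const (Icc (0 : ℝ) 1) x)) t = f' x := fun t => rfl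
      refine (intervalIntegral.integral_congr fun t _ => e t).trans ?_
      simp
    have hd : HasDerivAt (fun t : ℝ => x + t • J t) (f x) 0 := by
      rw [← hJ0]
      refine HasDerivAt.const_add x ?_
      rw [hasDerivAt_iff_tendsto_slope]
      refine (hJ.tendsto.mono_left nhdsWithin_le_nhds).congr' ?_
      filter_upwards [self_mem_nhdsWithin] with t ht
      have ht : t ≠ 0 := ht
      simp [slope_def_module, smul_smul, ht]
    refine hd.congr_of_eventuallyEq ?_
    filter_upwards [hline.eventually hx'] with t ht
    simp only [ContinuousMap.evalCLM_apply]
    conv_lhs => rw [ht]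
    simp [J]
  · obtain ⟨r, hr, hrU⟩ := Metric.mem_nhds_iff.mp (inter_mem hU hff')
    have hnear : ∀ᶠ z in 𝓝 ((0 : ℝ), x₀), dist (α z) (ContinuousMap.const _ x₀) < r := by
      have := hα.continuousAt
      rw [ContinuousAt, hα0] at this
      exact this.eventually (Metric.ball_mem_nhds _ hr)
    filter_upwards [hαe, hnear] with z hz hzr
    -- The whole curve stays where the cut-off field equals f, so it is an integral curve of f
    -- itself.
    have hmem : ∀ s, α z s ∈ U ∩ {x | f' x = f x} := fun s => hrU (by
      rw [Metric.mem_ball]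
      exact (ContinuousMap.dist_apply_le_dist (f := α z) (g := ContinuousMap.const _ x₀) s).trans_lt hzr)
    have hext : ∀ s, ∀ hs : s ∈ Icc (0 : ℝ) 1, IccExtend zero_le_one (α z) s = α z ⟨s, hs⟩ :=
      fun s hs => IccExtend_of_mem _ _ hs
    have hq0 : α z ⟨0, h0⟩ = z.2 := by
      rw [hz]
      simp [ContinuousMap.primitiveCLM_apply]
    refine ⟨IccExtend zero_le_one (α z), (α z).continuous.Icc_extend', fun s hs => (hmem _).1,
      by rw [hext 0 h0, hq0], by rw [hext 1 h1]; rfl, fun s hs => ?_⟩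
    rw [hext s hs, hext 0 h0, hq0]
    have := congrArg (fun β : C(Icc (0 : ℝ) 1, E) => β ⟨s, hs⟩) hz
    simp only [ContinuousMap.add_apply, ContinuousMap.const_apply, ContinuousMap.smul_apply,
      ContinuousMap.primitiveCLM_apply] at this
    rw [this]
    congr 2
    refine intervalIntegral.integral_congr fun t _ => ?_
    exact (hmem (projIcc 0 1 zero_le_one t)).2

end Flow

/-! ### Reachable families and pull-backs along flows. -/

section Chow

variable {E : Type*} [NormedAddCommGroup E] [NormedSpace ℝ E]

theorem Steerable.swap {f g : E → E} {U : Set E} {ρ τ : ℝ} {p p' : E}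
    (h : Steerable f g U ρ τ p p') : Steerable g f U ρ τ p p' := by
  obtain ⟨u, v, q, hu, hv, hb, hq, hm, hqU, h0, h1⟩ := h
  refine ⟨v, u, q, hv, hu, fun t => (hb t).symm, hq, fun t ht => ?_, hqU, h0, h1⟩
  simp_rw [add_comm (v _ • _)]
  exact hm t ht

/-- An integral curve of `t • f` on the unit interval is a trajectory with constant controls. -/
theorem Steerable.of_integralCurve {f g : E → E} {U : Set E} {ρ τ t : ℝ} {q : ℝ → E} (hτ : 0 < τ)
    (hρ : 0 ≤ ρ) (ht : |t / τ| ≤ ρ) (hq : Continuous q) (hU : ∀ s ∈ Icc (0 : ℝ) 1, q s ∈ U)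
    (hm : ∀ s ∈ Icc (0 : ℝ) 1, q s = q 0 + t • ∫ x in (0 : ℝ)..s, f (q x)) :
    Steerable f g U ρ τ (q 0) (q 1) := by
  have hmem : ∀ s ∈ Icc 0 τ, s / τ ∈ Icc (0 : ℝ) 1 := fun s hs =>
    ⟨div_nonneg hs.1 hτ.le, (div_le_one hτ).mpr hs.2⟩
  refine ⟨fun _ => t / τ, fun _ => 0, fun s => q (s / τ), measurable_const, measurable_const,
    fun _ => ⟨ht, by simpa using hρ⟩, (hq.comp (continuous_id.div_const τ)).continuousOn,
    fun s hs => ?_, fun s hs => hU _ (hmem s hs), by simp, by simp [hτ.ne']⟩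
  have := intervalIntegral.integral_comp_div (a := 0) (b := s) (fun x => f (q x)) hτ.ne'
  simp only [zero_smul, add_zero, intervalIntegral.integral_smul, zero_div] at this ⊢
  rw [this, smul_smul, div_mul_cancel₀ _ hτ.ne']
  exact hm _ (hmem s hs)

/-- A family of configurations `F (q, t)`, smooth near `(q₀, 0)`, that can be reached from `q` inside
`U` in a common time less than `T`. -/
def IsReachableFamily (f g : E → E) (U : Set E) (ρ T : ℝ) (q₀ : E) {P : Type} [NormedAddCommGroup P]
    [NormedSpace ℝ P] (F : E × P → E) : Prop :=
  ContDiffAt ℝ 1 F (q₀, 0) ∧ ∃ τ, 0 ≤ τ ∧ τ < T ∧ ∀ᶠ z in 𝓝 (q₀, (0 : P)), Steerable f g U ρ τ z.1 (F z)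

/-- The directions in which the family `F` moves the configuration that is reached from `q₀`. -/
noncomputable def familyDirections (q₀ : E) {P : Type} [NormedAddCommGroup P] [NormedSpace ℝ P] (F : E × P → E) :
    Submodule ℝ E :=
  LinearMap.range (fderiv ℝ (fun t : P => F (q₀, t)) 0 : P →ₗ[ℝ] E)

section Extension

variable {f g h : E → E} {U : Set E} {ρ T : ℝ} {q₀ : E} {P : Type} [NormedAddCommGroup P]
  [NormedSpace ℝ P] {F : E × P → E} {φ : ℝ × E → E}

theorem IsReachableFamily.mem (hF : IsReachableFamily f g U ρ T q₀ F) : F (q₀, 0) ∈ U := by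
  obtain ⟨-, τ, hτ, -, he⟩ := hF
  obtain ⟨u, v, q, -, -, -, -, -, hqU, -, h1⟩ := he.self_of_nhds
  rw [← h1]
  exact hqU τ ⟨hτ, le_rfl⟩

/-- A reachable family can be prolonged by the flow of one of the control fields. -/
theorem IsReachableFamily.prolong (hf : ContinuousOn f U) (hg : ContinuousOn g U)
    (hρ : 0 < ρ) (hF : IsReachableFamily f g U ρ T q₀ F) (hh : h = f ∨ h = g)
    (hφ : ContDiffAt ℝ 1 φ (0, F (q₀, 0)))
    (hflow : ∀ᶠ z in 𝓝 ((0 : ℝ), F (q₀, 0)), ∃ q : ℝ → E, Continuous q ∧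
        (∀ s ∈ Icc (0 : ℝ) 1, q s ∈ U) ∧ q 0 = z.2 ∧ q 1 = φ z ∧
        ∀ s ∈ Icc (0 : ℝ) 1, q s = q 0 + z.1 • ∫ t in (0 : ℝ)..s, h (q t)) :
    ∀ᶠ r in 𝓝 (0 : ℝ), IsReachableFamily f g U ρ T q₀
      (fun z : E × (P × ℝ) => φ (z.2.2 + r, F (z.1, z.2.1))) := by
  obtain ⟨hc, τ, hτ, hτT, he⟩ := hF
  let G : E × (P × ℝ) → E := fun z => φ (z.2.2, F (z.1, z.2.1))
  let b : E × (P × ℝ) := (q₀, (0, 0))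
  have hpr : ContDiff ℝ 1 fun z : E × (P × ℝ) => (z.1, z.2.1) := by fun_prop
  have hcF : ContDiffAt ℝ 1 (fun z : E × (P × ℝ) => F (z.1, z.2.1)) b :=
    ContDiffAt.comp (g := F) b (by simpa [b] using hc) hpr.contDiffAt
  have hin : ContDiffAt ℝ 1 (fun z : E × (P × ℝ) => (z.2.2, F (z.1, z.2.1))) b :=
    ContDiffAt.prodMk (by fun_prop) hcF
  have hG : ContDiffAt ℝ 1 G b := ContDiffAt.comp (g := φ) b (by simpa [b] using hφ) hin
  -- The new piece gets half of the remaining time. Flow time t is realized by the constant control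
  -- t / τ', which is admissible once t is small.
  obtain ⟨τ', hτ', hττ⟩ : ∃ τ', 0 < τ' ∧ τ + τ' < T := ⟨(T - τ) / 2, by linarith, by linarith⟩
  have hsteer : ∀ᶠ z in 𝓝 b, Steerable f g U ρ (τ + τ') z.1 (G z) := by
    have h1 : Tendsto (fun z : E × (P × ℝ) => (z.1, z.2.1)) (𝓝 b) (𝓝 (q₀, 0)) :=
      hpr.continuous.tendsto b
    have h2 : Tendsto (fun z : E × (P × ℝ) => (z.2.2, F (z.1, z.2.1))) (𝓝 b) (𝓝 (0, F (q₀, 0))) :=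
      hin.continuousAt
    have h3 : ∀ᶠ z : E × (P × ℝ) in 𝓝 b, |z.2.2 / τ'| ≤ ρ := by
      have : ContinuousAt (fun z : E × (P × ℝ) => |z.2.2 / τ'|) b := by fun_prop
      have h0 : |b.2.2 / τ'| < ρ := by simpa [b] using hρ
      exact (this.eventually (gt_mem_nhds h0)).mono fun z hz => hz.le
    filter_upwards [h1.eventually he, h2.eventually hflow, h3] with z hz1 hz2 hz3
    obtain ⟨q, hq, hqU, hq0, hq1, hqm⟩ := hz2
    refine Steerable.trans hf hg hτ hτ'.le hz1 ?_
    rcases hh with rfl | rfl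
    · have := Steerable.of_integralCurve (g := g) hτ' hρ.le hz3 hq hqU hqm
      rwa [hq0, hq1] at this
    · have := Steerable.of_integralCurve (g := f) hτ' hρ.le hz3 hq hqU hqm
      rw [hq0, hq1] at this
      exact this.swap
  have hline : Tendsto (fun r : ℝ => (q₀, ((0 : P), r))) (𝓝 0) (𝓝 b) :=
    (by fun_prop : Continuous fun r : ℝ => (q₀, ((0 : P), r))).tendsto 0
  filter_upwards [hline.eventually (hG.eventually (by simp)), hline.eventually hsteer.eventually_nhds]
    with r hr1 hr2
  -- Recentring: the base parameter of the new family corresponds to flow time r, so its base point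
  -- is the image of the old one under the flow.
  have hshift : ContDiff ℝ 1 fun z : E × (P × ℝ) => (z.1, (z.2.1, z.2.2 + r)) := by fun_prop
  refine ⟨ContDiffAt.comp (g := G) (f := fun z : E × (P × ℝ) => (z.1, (z.2.1, z.2.2 + r))) _
    (by simpa using hr1) hshift.contDiffAt, τ + τ', by linarith, hττ, ?_⟩
  have ht : Tendsto (fun z : E × (P × ℝ) => (z.1, (z.2.1, z.2.2 + r))) (𝓝 (q₀, 0)) (𝓝 (q₀, (0, r))) := by
    have := hshift.continuous.tendsto (q₀, 0)
    simpa using this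
  exact ht.eventually hr2

theorem hasFDerivAt_family (hF : ContDiffAt ℝ 1 F (q₀, 0)) :
    HasFDerivAt (fun t : P => F (q₀, t)) (fderiv ℝ (fun t : P => F (q₀, t)) 0) 0 := by
  have : ContDiffAt ℝ 1 (fun t : P => F (q₀, t)) 0 :=
    ContDiffAt.comp (g := F) (0 : P) hF (by fun_prop)
  exact (this.differentiableAt (by simp)).hasFDerivAt

/-- Chain rule: the old directions are transported by the spatial derivative of the flow, and the
time derivative of the flow is the only new direction. -/
theorem familyDirections_prolong (hF : ContDiffAt ℝ 1 F (q₀, 0)) {r : ℝ}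
    (hφ : DifferentiableAt ℝ φ (r, F (q₀, 0))) :
    familyDirections q₀ (fun z : E × (P × ℝ) => φ (z.2.2 + r, F (z.1, z.2.1))) =
      (familyDirections q₀ F).map ((fderiv ℝ φ (r, F (q₀, 0)) ∘L .inr ℝ ℝ E : E →L[ℝ] E) : E →ₗ[ℝ] E) ⊔
        Submodule.span ℝ {fderiv ℝ φ (r, F (q₀, 0)) (1, 0)} := by
  set L := fderiv ℝ φ (r, F (q₀, 0)) with hL
  set D := fderiv ℝ (fun t : P => F (q₀, t)) 0 with hD
  have h1 : HasFDerivAt (fun p : P × ℝ => (p.2 + r, F (q₀, p.1)))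
      ((ContinuousLinearMap.snd ℝ P ℝ).prod (D ∘L .fst ℝ P ℝ)) 0 := by
    refine HasFDerivAt.prodMk (hasFDerivAt_snd.add_const r) ?_
    exact HasFDerivAt.comp (g := fun t : P => F (q₀, t)) (0 : P × ℝ) (hasFDerivAt_family hF) hasFDerivAt_fst
  have h2 : HasFDerivAt (fun p : P × ℝ => φ (p.2 + r, F (q₀, p.1)))
      (L ∘L ((ContinuousLinearMap.snd ℝ P ℝ).prod (D ∘L .fst ℝ P ℝ))) 0 :=
    HasFDerivAt.comp (g := φ) (0 : P × ℝ) (by simpa using hφ.hasFDerivAt) h1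
  have h3 : fderiv ℝ (fun p : P × ℝ => φ (p.2 + r, F (q₀, p.1))) 0 =
      L ∘L ((ContinuousLinearMap.snd ℝ P ℝ).prod (D ∘L .fst ℝ P ℝ)) := h2.fderiv
  have hsplit : ∀ (a : P) (s : ℝ), L (s, D a) = L (0, D a) + s • L (1, 0) := fun a s => by
    rw [← map_smul, ← map_add]
    simp
  unfold familyDirections
  simp only [h3]
  ext x
  simp only [LinearMap.mem_range, Submodule.mem_sup, Submodule.mem_map, Submodule.mem_span_singleton]
  constructor
  · rintro ⟨⟨a, s⟩, rfl⟩
    exact ⟨L (0, D a), ⟨D a, ⟨a, rfl⟩, rfl⟩, _, ⟨s, rfl⟩, (hsplit a s).symm⟩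
  · rintro ⟨y, ⟨_, ⟨a, rfl⟩, rfl⟩, _, ⟨s, rfl⟩, rfl⟩
    exact ⟨(a, s), hsplit a s⟩

end Extension

/-- The pull-back of `Z` by the flow of `h` has derivative `[h, Z]` at time `0`. -/
theorem hasDerivAt_pullback_flow [CompleteSpace E] {h Z : E → E} {φ : ℝ × E → E} {x₀ : E}
    (hφ : ContDiffAt ℝ 2 φ (0, x₀)) (hφ0 : ∀ᶠ x in 𝓝 x₀, φ (0, x) = x)
    (hφt : ∀ᶠ x in 𝓝 x₀, HasDerivAt (fun t => φ (t, x)) (h x) 0)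
    (hh : DifferentiableAt ℝ h x₀) (hZ : DifferentiableAt ℝ Z x₀) :
    HasDerivAt (fun r => Ring.inverse (fderiv ℝ φ (r, x₀) ∘L .inr ℝ ℝ E) (Z (φ (r, x₀))))
      (VectorField.lieBracket ℝ h Z x₀) 0 ∧ fderiv ℝ φ (0, x₀) ∘L .inr ℝ ℝ E = 1 := by
  have hd : ContDiffAt ℝ 1 (fderiv ℝ φ) (0, x₀) := hφ.fderiv_right (m := 1) (by norm_num)
  have hB := (hd.differentiableAt (by simp)).hasFDerivAt
  set B := fderiv ℝ (fderiv ℝ φ) (0, x₀) with hBdef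
  have hsymm : IsSymmSndFDerivAt ℝ φ (0, x₀) := hφ.isSymmSndFDerivAt (by simp)
  have hdiff : ∀ᶠ x in 𝓝 x₀, DifferentiableAt ℝ φ (0, x) :=
    ((Continuous.prodMk_right (0 : ℝ)).tendsto x₀).eventually
      ((hφ.eventually (by simp)).mono fun z hz => hz.differentiableAt (by simp))
  have hpt : ∀ᶠ x in 𝓝 x₀, fderiv ℝ φ (0, x) (1, 0) = h x := by
    filter_upwards [hφt, hdiff] with x hx hx'
    have h1 : HasDerivAt (fun t : ℝ => (t, x)) ((1 : ℝ), (0 : E)) 0 :=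
      (hasDerivAt_id (0 : ℝ)).prodMk (hasDerivAt_const 0 x)
    exact (hx'.hasFDerivAt.comp_hasDerivAt (f := fun t : ℝ => (t, x)) 0 h1).unique hx
  -- Symmetry of the second derivative: the time derivative of the spatial derivative of φ is the
  -- spatial derivative of its velocity h.
  have hmix : ∀ v, B (1, 0) (0, v) = fderiv ℝ h x₀ v := fun v => by
    have h1 : HasFDerivAt (fun x : E => fderiv ℝ φ (0, x)) (B ∘L .inr ℝ ℝ E) x₀ :=
      HasFDerivAt.comp (g := fderiv ℝ φ) x₀ hB (hasFDerivAt_prodMk_right (0 : ℝ) x₀)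
    have h2 : HasFDerivAt (fun x : E => fderiv ℝ φ (0, x) (1, 0))
        ((B ∘L .inr ℝ ℝ E).flip (1, 0)) x₀ := by
      simpa using h1.clm_apply (hasFDerivAt_const ((1 : ℝ), (0 : E)) x₀)
    have h3 := (h2.congr_of_eventuallyEq (hpt.mono fun x hx => hx.symm)).unique hh.hasFDerivAt
    rw [← h3]
    exact hsymm _ _
  set C : ℝ → E →L[ℝ] E := fun r => fderiv ℝ φ (r, x₀) ∘L .inr ℝ ℝ E with hCdef
  have hline : HasDerivAt (fun r : ℝ => (r, x₀)) ((1 : ℝ), (0 : E)) 0 :=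
    (hasDerivAt_id (0 : ℝ)).prodMk (hasDerivAt_const 0 x₀)
  have hC0 : C 0 = 1 := by
    have h1 : HasFDerivAt (fun x : E => φ (0, x)) (C 0) x₀ :=
      HasFDerivAt.comp (g := φ) x₀ hdiff.self_of_nhds.hasFDerivAt (hasFDerivAt_prodMk_right (0 : ℝ) x₀)
    exact (h1.congr_of_eventuallyEq (hφ0.mono fun x hx => hx.symm)).unique (hasFDerivAt_id x₀)
  have hC : HasDerivAt C (fderiv ℝ h x₀) 0 := by
    have h1 : HasDerivAt (fun r : ℝ => fderiv ℝ φ (r, x₀)) (B (1, 0)) 0 :=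
      hB.comp_hasDerivAt (f := fun r : ℝ => (r, x₀)) 0 hline
    have h2 := h1.clm_comp (hasDerivAt_const (0 : ℝ) (ContinuousLinearMap.inr ℝ ℝ E))
    convert! h2 using 1
    ext v
    simp [hmix]
  -- Inversion has derivative -id at the identity. Together with the derivative of Z along the flow
  -- this gives DZ(h) - Dh(Z), the bracket.
  have hinv : HasDerivAt (fun r => Ring.inverse (C r)) (-fderiv ℝ h x₀) 0 := by
    have h1 := hasFDerivAt_ringInverse (𝕜 := ℝ) (1 : (E →L[ℝ] E)ˣ)
    have h2 : HasFDerivAt Ring.inverse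
        (-ContinuousLinearMap.mulLeftRight ℝ (E →L[ℝ] E) ↑(1 : (E →L[ℝ] E)ˣ)⁻¹ ↑(1 : (E →L[ℝ] E)ˣ)⁻¹) (C 0) := by
      rw [hC0]
      exact h1
    have h3 := h2.comp_hasDerivAt (0 : ℝ) hC
    rw [show (-ContinuousLinearMap.mulLeftRight ℝ (E →L[ℝ] E) ↑(1 : (E →L[ℝ] E)ˣ)⁻¹ ↑(1 : (E →L[ℝ] E)ˣ)⁻¹)
      (fderiv ℝ h x₀) = -fderiv ℝ h x₀ by simp] at h3
    exact h3
  refine ⟨?_, hC0⟩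
  have hZφ : HasDerivAt (fun r => Z (φ (r, x₀))) (fderiv ℝ Z x₀ (h x₀)) 0 := by
    refine HasFDerivAt.comp_hasDerivAt (f := fun r => φ (r, x₀)) (0 : ℝ) ?_ hφt.self_of_nhds
    rw [hφ0.self_of_nhds]
    exact hZ.hasFDerivAt
  have := hinv.clm_apply hZφ
  convert! this using 1
  rw [hC0, Ring.inverse_one, hφ0.self_of_nhds, VectorField.lieBracket_eq]
  simp [sub_eq_neg_add]

end Chow

/-! ### The Chow–Rashevskii theorem. -/

section ChowTheorem

variable {E : Type*} [NormedAddCommGroup E] [NormedSpace ℝ E]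

/-- The iterated Lie brackets of the vector fields `f` and `g`. -/
inductive IsIteratedBracket (f g : E → E) : (E → E) → Prop
  | left : IsIteratedBracket f g f
  | right : IsIteratedBracket f g g
  | bracket_left {Z : E → E} : IsIteratedBracket f g Z →
      IsIteratedBracket f g (VectorField.lieBracket ℝ f Z)
  | bracket_right {Z : E → E} : IsIteratedBracket f g Z →
      IsIteratedBracket f g (VectorField.lieBracket ℝ g Z)

theorem ContDiffOn.lieBracket_of_isOpen {V W : E → E} {Ω : Set E} (hΩ : IsOpen Ω)
    (hV : ContDiffOn ℝ (⊤ : ℕ∞) V Ω) (hW : ContDiffOn ℝ (⊤ : ℕ∞) W Ω) :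
    ContDiffOn ℝ (⊤ : ℕ∞) (VectorField.lieBracket ℝ V W) Ω := by
  have h := fun {X : E → E} (hX : ContDiffOn ℝ (⊤ : ℕ∞) X Ω) =>
    hX.fderiv_of_isOpen (m := (⊤ : ℕ∞)) hΩ (by simp)
  exact ((h hW).clm_apply hV).sub ((h hV).clm_apply hW)

theorem IsIteratedBracket.contDiffOn {f g Z : E → E} {Ω : Set E} (hΩ : IsOpen Ω)
    (hf : ContDiffOn ℝ (⊤ : ℕ∞) f Ω) (hg : ContDiffOn ℝ (⊤ : ℕ∞) g Ω) (hZ : IsIteratedBracket f g Z) :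
    ContDiffOn ℝ (⊤ : ℕ∞) Z Ω := by
  induction hZ with
  | left => exact hf
  | right => exact hg
  | bracket_left _ ih => exact hf.lieBracket_of_isOpen hΩ ih
  | bracket_right _ ih => exact hg.lieBracket_of_isOpen hΩ ih

variable [FiniteDimensional ℝ E]

/-- A reachable family whose number of directions is maximal moves along every iterated bracket of the
control fields. -/
theorem IsReachableFamily.bracket_mem_directions {f g : E → E} {U : Set E} {ρ T : ℝ} {q₀ : E} {m : ℕ}
    (hU : IsOpen U) (hf : ContDiffOn ℝ (⊤ : ℕ∞) f U) (hg : ContDiffOn ℝ (⊤ : ℕ∞) g U) (hρ : 0 < ρ)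
    (hm : ∀ (P : Type) (_ : NormedAddCommGroup P) (_ : NormedSpace ℝ P) (_ : CompleteSpace P)
      (F : E × P → E),
      IsReachableFamily f g U ρ T q₀ F → Module.finrank ℝ (familyDirections q₀ F) ≤ m)
    {Z : E → E} (hZ : IsIteratedBracket f g Z) :
    ∀ (P : Type) (_ : NormedAddCommGroup P) (_ : NormedSpace ℝ P) (_ : CompleteSpace P)
      (F : E × P → E),
      IsReachableFamily f g U ρ T q₀ F → Module.finrank ℝ (familyDirections q₀ F) = m →
        Z (F (q₀, 0)) ∈ familyDirections q₀ F := by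
  have := FiniteDimensional.complete ℝ E
  have hfield : ∀ h : E → E, (h = f ∨ h = g) → ContDiffOn ℝ (⊤ : ℕ∞) h U := by
    rintro h (rfl | rfl) <;> assumption
  have hbase : ∀ h : E → E, (h = f ∨ h = g) →
      ∀ (P : Type) (_ : NormedAddCommGroup P) (_ : NormedSpace ℝ P) (_ : CompleteSpace P)
      (F : E × P → E),
      IsReachableFamily f g U ρ T q₀ F → Module.finrank ℝ (familyDirections q₀ F) = m →
        h (F (q₀, 0)) ∈ familyDirections q₀ F := by
    intro h hh P _ _ _ F hF hFm
    obtain ⟨φ, hφ, hφ0, hφt, hflow⟩ := exists_localFlow (n := 2) two_ne_zero hU hF.mem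
      ((hfield h hh).of_le (WithTop.coe_le_coe.mpr (le_top : ((2 : ℕ) : ℕ∞) ≤ ⊤)))
    have hd : DifferentiableAt ℝ φ (0, F (q₀, 0)) := hφ.differentiableAt (by norm_num)
    -- Prolongation centred at flow time 0, where the flow has spatial derivative 1: the old
    -- directions survive, so maximality of the rank forces the new direction h to lie among them.
    have hG := (hF.prolong hf.continuousOn hg.continuousOn hρ hh (hφ.of_le (by norm_num))
      (hflow U (hU.mem_nhds hF.mem))).self_of_nhds
    have hle := hm _ _ _ inferInstance _ hG
    have hdir := familyDirections_prolong hF.1 hd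
    rw [(hasDerivAt_pullback_flow hφ hφ0 hφt (((hfield h hh).contDiffAt (hU.mem_nhds hF.mem)).differentiableAt
      (by simp)) (Z := fun _ => 0) (differentiableAt_const _)).2] at hdir
    have hmap : (familyDirections q₀ F).map ((1 : E →L[ℝ] E) : E →ₗ[ℝ] E) = familyDirections q₀ F :=
      Submodule.map_id _
    rw [hmap] at hdir
    have hsub : familyDirections q₀ F ≤ familyDirections q₀ (fun z : E × (P × ℝ) => φ (z.2.2 + 0, F (z.1, z.2.1))) := by
      rw [hdir]
      exact le_sup_left
    have heq := Submodule.eq_of_le_of_finrank_le hsub (hle.trans hFm.ge)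
    have h1 : fderiv ℝ φ (0, F (q₀, 0)) (1, 0) = h (F (q₀, 0)) := by
      have h1 : HasDerivAt (fun t : ℝ => (t, F (q₀, 0))) ((1 : ℝ), (0 : E)) 0 :=
        (hasDerivAt_id (0 : ℝ)).prodMk (hasDerivAt_const 0 _)
      exact (hd.hasFDerivAt.comp_hasDerivAt (f := fun t : ℝ => (t, F (q₀, 0))) 0 h1).unique
        hφt.self_of_nhds
    rw [heq, hdir, ← h1]
    exact Submodule.mem_sup_right (Submodule.mem_span_singleton_self _)
  -- The hypothesis on Z is needed for all maximal families, since it is applied to the prolonged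
  -- ones and not to F.
  have hstep : ∀ h : E → E, (h = f ∨ h = g) → ∀ Z : E → E, IsIteratedBracket f g Z →
      (∀ (P : Type) (_ : NormedAddCommGroup P) (_ : NormedSpace ℝ P) (_ : CompleteSpace P)
      (F : E × P → E),
        IsReachableFamily f g U ρ T q₀ F → Module.finrank ℝ (familyDirections q₀ F) = m →
          Z (F (q₀, 0)) ∈ familyDirections q₀ F) →
      ∀ (P : Type) (_ : NormedAddCommGroup P) (_ : NormedSpace ℝ P) (_ : CompleteSpace P)
      (F : E × P → E),
      IsReachableFamily f g U ρ T q₀ F → Module.finrank ℝ (familyDirections q₀ F) = m →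
        VectorField.lieBracket ℝ h Z (F (q₀, 0)) ∈ familyDirections q₀ F := by
    intro h hh Z hZ ih P _ _ _ F hF hFm
    have hx := hU.mem_nhds hF.mem
    obtain ⟨φ, hφ, hφ0, hφt, hflow⟩ := exists_localFlow (n := 2) two_ne_zero hU hF.mem
      ((hfield h hh).of_le (WithTop.coe_le_coe.mpr (le_top : ((2 : ℕ) : ℕ∞) ≤ ⊤)))
    obtain ⟨hder, hone⟩ := hasDerivAt_pullback_flow hφ hφ0 hφt
      (((hfield h hh).contDiffAt hx).differentiableAt (by simp))
      (((hZ.contDiffOn hU hf hg).contDiffAt hx).differentiableAt (by simp))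
    have hline : Tendsto (fun r : ℝ => (r, F (q₀, 0))) (𝓝 0) (𝓝 (0, F (q₀, 0))) :=
      (Continuous.prodMk_left (F (q₀, 0))).tendsto 0
    have hunit : ∀ᶠ r in 𝓝 (0 : ℝ), IsUnit (fderiv ℝ φ (r, F (q₀, 0)) ∘L .inr ℝ ℝ E) := by
      have hc : ContinuousAt (fun r : ℝ => fderiv ℝ φ (r, F (q₀, 0)) ∘L .inr ℝ ℝ E) 0 := by
        have h1 : ContinuousAt (fun r : ℝ => fderiv ℝ φ (r, F (q₀, 0))) 0 :=
          ContinuousAt.comp (f := fun r : ℝ => (r, F (q₀, 0)))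
            (hφ.fderiv_right (m := 1) (by norm_num)).continuousAt hline
        exact h1.clm_comp continuousAt_const
      refine hc.eventually (Units.isOpen.mem_nhds ?_)
      simp only [hone]
      exact isUnit_one
    have hmem : ∀ᶠ r in 𝓝 (0 : ℝ), Ring.inverse (fderiv ℝ φ (r, F (q₀, 0)) ∘L .inr ℝ ℝ E)
        (Z (φ (r, F (q₀, 0)))) ∈ familyDirections q₀ F := by
      filter_upwards [hF.prolong hf.continuousOn hg.continuousOn hρ hh (hφ.of_le (by norm_num))
        (hflow U hx), hunit, hline.eventually (hφ.eventually (by simp))] with r hG hr hφr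
      have hd : DifferentiableAt ℝ φ (r, F (q₀, 0)) := hφr.differentiableAt (by norm_num)
      have hdir := familyDirections_prolong hF.1 hd
      have hle := hm _ _ _ inferInstance _ hG
      set A : E →L[ℝ] E := fderiv ℝ φ (r, F (q₀, 0)) ∘L .inr ℝ ℝ E
      have hAinv : ∀ x, Ring.inverse A (A x) = x := fun x => by
        change (Ring.inverse A * A) x = x
        rw [Ring.inverse_mul_cancel _ hr]
        rfl
      have hinj : Function.Injective (A : E →ₗ[ℝ] E) := fun x y hxy => by
        rw [← hAinv x, ← hAinv y]
        exact congrArg _ hxy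
      have hrank : Module.finrank ℝ ((familyDirections q₀ F).map (A : E →ₗ[ℝ] E)) = m := by
        rw [← hFm]
        exact (Submodule.equivMapOfInjective _ hinj _).finrank_eq.symm
      have hsub : (familyDirections q₀ F).map (A : E →ₗ[ℝ] E) ≤
          familyDirections q₀ (fun z : E × (P × ℝ) => φ (z.2.2 + r, F (z.1, z.2.1))) := by
        rw [hdir]
        exact le_sup_left
      -- The transported directions already have the maximal rank m, so they are all the directions
      -- of the prolonged family. Thus Z at the displaced point is transported from a direction of
      -- F, and its pull-back is a direction of F.
      have heq := Submodule.eq_of_le_of_finrank_le hsub (hle.trans hrank.ge)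
      have hz := ih _ _ _ inferInstance _ hG (by rw [← heq, hrank])
      rw [← heq] at hz
      simp only [Prod.fst_zero, Prod.snd_zero, zero_add] at hz
      obtain ⟨w, hw, hwz⟩ := hz
      rw [← hwz]
      change Ring.inverse A (A w) ∈ _
      rwa [hAinv]
    -- The pull-back of Z stays in a fixed closed subspace for small r, so its derivative at 0, the
    -- bracket, lies there too.
    have hclosed : IsClosed (familyDirections q₀ F : Set E) := Submodule.closed_of_finiteDimensional _
    rw [hasDerivAt_iff_tendsto_slope] at hder
    refine hclosed.mem_of_tendsto hder ?_
    filter_upwards [hmem.filter_mono nhdsWithin_le_nhds] with r hr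
    exact Submodule.smul_mem _ _ (Submodule.sub_mem _ hr hmem.self_of_nhds)
  induction hZ with
  | left => exact hbase f (Or.inl rfl)
  | right => exact hbase g (Or.inr rfl)
  | bracket_left hZ ih => exact hstep f (Or.inl rfl) _ hZ ih
  | bracket_right hZ ih => exact hstep g (Or.inr rfl) _ hZ ih

/-- **Chow–Rashevskii theorem** for two control fields: if the iterated brackets span at every point, the
system is small-time locally controllable at every point. -/
theorem exists_nhds_steerable {f g : E → E} {U : Set E} (hU : IsOpen U)
    (hf : ContDiffOn ℝ (⊤ : ℕ∞) f U) (hg : ContDiffOn ℝ (⊤ : ℕ∞) g U)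
    (hspan : ∀ x ∈ U, Submodule.span ℝ {v | ∃ Z, IsIteratedBracket f g Z ∧ v = Z x} = ⊤)
    {q₀ : E} (hq : q₀ ∈ U) {ρ T : ℝ} (hρ : 0 < ρ) (hT : 0 < T) :
    ∃ V ∈ 𝓝 q₀, ∀ p ∈ V, ∀ p' ∈ V, Steerable f g U ρ T p p' := by
  classical
  have := FiniteDimensional.complete ℝ E
  -- The ranks attained by reachable families. The bound T / 4 leaves time for the four legs of the
  -- final trajectory.
  let Q : ℕ → Prop := fun k => ∃ (P : Type) (_ : NormedAddCommGroup P) (_ : NormedSpace ℝ P)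
    (_ : CompleteSpace P) (F : E × P → E),
    IsReachableFamily f g U ρ (T / 4) q₀ F ∧ Module.finrank ℝ (familyDirections q₀ F) = k
  -- The stationary family, reached in time 0, shows that some rank is attained.
  have hQ0 : ∃ k, Q k := ⟨_, ℝ, inferInstance, inferInstance, inferInstance, fun z => z.1,
    ⟨contDiffAt_fst, 0, le_rfl, by positivity, by
      filter_upwards [(continuous_fst.tendsto (q₀, (0 : ℝ))).eventually (hU.mem_nhds hq)] with z hz
      exact Steerable.refl hρ.le 0 hz⟩, rfl⟩
  obtain ⟨k₀, hk₀⟩ := hQ0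
  have hbound : ∀ k, Q k → k ≤ Module.finrank ℝ E := by
    rintro k ⟨P, _, _, _, F, -, rfl⟩
    exact Submodule.finrank_le _
  obtain ⟨P, _, _, hP, F, hF, hFm⟩ : Q (Nat.findGreatest Q (Module.finrank ℝ E)) :=
    Nat.findGreatest_spec (hbound k₀ hk₀) hk₀
  have htop : familyDirections q₀ F = ⊤ := by
    rw [eq_top_iff, ← hspan _ hF.mem, Submodule.span_le]
    rintro _ ⟨Z, hZ, rfl⟩
    refine IsReachableFamily.bracket_mem_directions hU hf hg hρ (fun P' _ _ _ F' hF' => ?_) hZ P _ _ hP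
      F hF hFm
    have hQ' : Q (Module.finrank ℝ (familyDirections q₀ F')) :=
      ⟨P', inferInstance, inferInstance, inferInstance, F', hF', rfl⟩
    exact Nat.le_findGreatest (hbound _ hQ') hQ'
  obtain ⟨hc, τ, hτ, hτT, he⟩ := hF
  have hsl : ContDiffAt ℝ 1 (fun t : P => F (q₀, t)) 0 :=
    ContDiffAt.comp (g := F) (0 : P) hc (by fun_prop)
  -- Full rank makes t ↦ F (q₀, t) a submersion at 0, hence its images of neighbourhoods of 0 are
  -- neighbourhoods of F (q₀, 0).
  have hopen := (hsl.hasStrictFDerivAt one_ne_zero).map_nhds_eq_of_surj htop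
  have hgood : ∀ᶠ t in 𝓝 (0 : P), Steerable f g U ρ τ q₀ (F (q₀, t)) :=
    ((Continuous.prodMk_right q₀).tendsto (0 : P)).eventually he
  have hN : (fun t : P => F (q₀, t)) '' {t | Steerable f g U ρ τ q₀ (F (q₀, t))} ∈ 𝓝 (F (q₀, 0)) := by
    rw [← hopen]
    exact image_mem_map hgood
  have hcont : Tendsto (fun x : E => F (x, 0)) (𝓝 q₀) (𝓝 (F (q₀, 0))) :=
    ContinuousAt.comp (g := F) (f := fun x : E => (x, (0 : P))) hc.continuousAt (by fun_prop)
  have hstart : ∀ᶠ x in 𝓝 q₀, Steerable f g U ρ τ x (F (x, 0)) :=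
    ((Continuous.prodMk_left (0 : P)).tendsto q₀).eventually he
  have hfc := hf.continuousOn
  have hgc := hg.continuousOn
  -- For x near q₀ the point F (x, 0) is one of the points F (q₀, t): go there from q₀, then run the
  -- trajectory from x to F (x, 0) backwards.
  have hreach : ∀ᶠ x in 𝓝 q₀, Steerable f g U ρ (τ + τ) q₀ x := by
    filter_upwards [hcont hN, hstart] with x hx hx'
    obtain ⟨t, ht, htx⟩ := hx
    refine Steerable.trans hfc hgc hτ hτ ?_ (hx'.symm hfc hgc hτ)
    rw [← show F (q₀, t) = F (x, 0) from htx]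
    exact ht
  refine ⟨_, inter_mem hreach (hU.mem_nhds hq), fun p hp p' hp' => ?_⟩
  have h2 : 0 ≤ τ + τ := by linarith
  -- From p back to q₀, on to p', then rest at p' with zero controls until time T.
  have := ((hp.1.symm hfc hgc h2).trans hfc hgc h2 h2 hp'.1).trans hfc hgc (by linarith)
    (by linarith : 0 ≤ T - (τ + τ + (τ + τ))) (Steerable.refl hρ.le _ hp'.2)
  rwa [add_sub_cancel] at this

end ChowTheorem

/-! ### Derivatives of the control fields at the aligned configuration. -/

set_option linter.unusedSimpArgs false
namespace Purcell
noncomputable section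
variable {A : Type*} [CommRing A] [Algebra ℝ A]

theorem ev_smul (ev : A →ₐ[ℝ] ℝ) (r : ℝ) (f : A) : ev (r • f) = r * ev f := by
  simp

/-- The Leibniz rules are stated after evaluation, so that known values are substituted at once and
no polynomial expression in the algebra is expanded. -/
theorem ev_d1_mul (ev : A →ₐ[ℝ] ℝ) (D : Derivation ℝ A A) (f g : A) :
    ev (D (f * g)) = ev f * ev (D g) + ev (D f) * ev g := by
  simp [Derivation.leibniz]; ring

theorem ev_d2_mul (ev : A →ₐ[ℝ] ℝ) (D₁ D₂ : Derivation ℝ A A) (f g : A) :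
    ev (D₁ (D₂ (f * g))) = ev f * ev (D₁ (D₂ g)) + ev (D₁ f) * ev (D₂ g) + ev (D₂ f) * ev (D₁ g) +
      ev (D₁ (D₂ f)) * ev g := by
  simp [Derivation.leibniz]; ring

theorem ev_d3_mul (ev : A →ₐ[ℝ] ℝ) (D₁ D₂ D₃ : Derivation ℝ A A) (f g : A) :
    ev (D₁ (D₂ (D₃ (f * g)))) = ev f * ev (D₁ (D₂ (D₃ g))) + ev (D₁ f) * ev (D₂ (D₃ g)) +
      ev (D₂ f) * ev (D₁ (D₃ g)) + ev (D₃ f) * ev (D₁ (D₂ g)) + ev (D₁ (D₂ f)) * ev (D₃ g) +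
      ev (D₁ (D₃ f)) * ev (D₂ g) + ev (D₂ (D₃ f)) * ev (D₁ g) + ev (D₁ (D₂ (D₃ f))) * ev g := by
  simp [Derivation.leibniz]; ring

/-- Velocity of the hinge of the outer link on the side `σ = ±1`. The outer links have length `l`
and the central link length `1 - 2 * l`. -/
def hingeX (σ l : ℝ) (s0 X Θ : A) : A := X - (σ * (1 - 2 * l) / 2) • (Θ * s0)
def hingeY (σ l : ℝ) (c0 Y Θ : A) : A := Y + (σ * (1 - 2 * l) / 2) • (Θ * c0)

/-- Component of the velocity of the hinge normal to the outer link with direction `(c, s)`. -/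
def hingeNormal (σ l : ℝ) (s0 c0 s c X Y Θ : A) : A :=
  c * hingeY σ l c0 Y Θ - s * hingeX σ l s0 X Θ

/-- Moments of the drag coefficient of an outer link, of orders zero, one and two. -/
def moment0 (σ l : ℝ) (s0 a s : A) : A :=
  (2 * l) • (1 : A) - (σ * (1 - 2 * l) * l) • (s0 * a) - (σ * l ^ 2) • (s * a)
def moment1 (σ l : ℝ) (s0 a s : A) : A :=
  (l ^ 2) • (1 : A) - (σ * (1 - 2 * l) * l ^ 2 / 2) • (s0 * a) - (2 / 3 * σ * l ^ 3) • (s * a)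
def moment2 (σ l : ℝ) (s0 a s : A) : A :=
  (2 / 3 * l ^ 3) • (1 : A) - (σ * (1 - 2 * l) * l ^ 3 / 3) • (s0 * a) - (σ * l ^ 4 / 2) • (s * a)

/-- Force and torque on an outer link that turns at the rate `ω`. -/
def linkNormalForce (σ l : ℝ) (s0 c0 a s c X Y Θ ω : A) : A :=
  (1 / 2 : ℝ) • (moment0 σ l s0 a s * hingeNormal σ l s0 c0 s c X Y Θ) +
    σ • (moment1 σ l s0 a s * ω)
def linkForceX (σ l : ℝ) (s0 c0 a s c X Y Θ ω : A) : A :=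
  (1 / 2 : ℝ) • (moment0 σ l s0 a s * hingeX σ l s0 X Θ) -
    linkNormalForce σ l s0 c0 a s c X Y Θ ω * s
def linkForceY (σ l : ℝ) (s0 c0 a s c X Y Θ ω : A) : A :=
  (1 / 2 : ℝ) • (moment0 σ l s0 a s * hingeY σ l c0 Y Θ) +
    linkNormalForce σ l s0 c0 a s c X Y Θ ω * c
def linkTorque (σ l : ℝ) (s0 c0 a s c X Y Θ ω : A) : A :=
  (σ * (1 - 2 * l) / 2) • (c0 * linkForceY σ l s0 c0 a s c X Y Θ ω -
      s0 * linkForceX σ l s0 c0 a s c X Y Θ ω) +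
    σ • (moment1 σ l s0 a s * hingeNormal σ l s0 c0 s c X Y Θ) + moment2 σ l s0 a s * ω

/-- Total force and torque on the swimmer, up to a common factor. -/
def totalForceX (l : ℝ) (s0 c0 sA cA sB cB a X Y Θ ωA ωB : A) : A :=
  linkForceX (-1) l s0 c0 a sA cA X Y Θ ωA + linkForceX 1 l s0 c0 a sB cB X Y Θ ωB +
    (1 - 2 * l) • (X - (c0 * Y - s0 * X) * s0) + ((1 - 2 * l) ^ 3 / 6) • (a * s0 * s0 * Θ)
def totalForceY (l : ℝ) (s0 c0 sA cA sB cB a X Y Θ ωA ωB : A) : A :=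
  linkForceY (-1) l s0 c0 a sA cA X Y Θ ωA + linkForceY 1 l s0 c0 a sB cB X Y Θ ωB +
    (1 - 2 * l) • (Y + (c0 * Y - s0 * X) * c0) - ((1 - 2 * l) ^ 3 / 6) • (a * s0 * c0 * Θ)
def totalTorque (l : ℝ) (s0 c0 sA cA sB cB a X Y Θ ωA ωB : A) : A :=
  linkTorque (-1) l s0 c0 a sA cA X Y Θ ωA + linkTorque 1 l s0 c0 a sB cB X Y Θ ωB +
    ((1 - 2 * l) ^ 3 / 6) • (Θ - a * s0 * (c0 * Y - s0 * X))

variable (A) in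
/-- The algebraic data of the swimmer near an aligned configuration: an algebra of functions, the
derivations `S` and `V` given by the symmetric and antisymmetric control fields, their components
`(X, Y, Θ)`, and evaluation at the aligned configuration. -/
structure SwimmerAlgebra (l : ℝ) where
  S : Derivation ℝ A A
  V : Derivation ℝ A A
  ev : A →ₐ[ℝ] ℝ
  (s0 c0 sA cA sB cB a a1 a2 X1 Y1 Θ1 X2 Y2 Θ2 : A)
  S_s0 : S s0 = c0 * Θ1
  S_c0 : S c0 = -(s0 * Θ1)
  S_sA : S sA = cA * (Θ1 + 1)
  S_cA : S cA = -(sA * (Θ1 + 1))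
  S_sB : S sB = cB * (Θ1 + 1)
  S_cB : S cB = -(sB * (Θ1 + 1))
  V_s0 : V s0 = c0 * Θ2
  V_c0 : V c0 = -(s0 * Θ2)
  V_sA : V sA = cA * (Θ2 - 1)
  V_cA : V cA = -(sA * (Θ2 - 1))
  V_sB : V sB = cB * (Θ2 + 1)
  V_cB : V cB = -(sB * (Θ2 + 1))
  S_a : S a = a1 * Y1
  S_a1 : S a1 = a2 * Y1
  V_a : V a = a1 * Y2
  V_a1 : V a1 = a2 * Y2
  ev_s0 : ev s0 = 0
  ev_c0 : ev c0 = 1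
  ev_sA : ev sA = 0
  ev_cA : ev cA = 1
  ev_sB : ev sB = 0
  ev_cB : ev cB = 1
  forceX_S : totalForceX l s0 c0 sA cA sB cB a X1 Y1 Θ1 (Θ1 + 1) (Θ1 + 1) = 0
  forceY_S : totalForceY l s0 c0 sA cA sB cB a X1 Y1 Θ1 (Θ1 + 1) (Θ1 + 1) = 0
  torque_S : totalTorque l s0 c0 sA cA sB cB a X1 Y1 Θ1 (Θ1 + 1) (Θ1 + 1) = 0
  forceX_V : totalForceX l s0 c0 sA cA sB cB a X2 Y2 Θ2 (Θ2 - 1) (Θ2 + 1) = 0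
  forceY_V : totalForceY l s0 c0 sA cA sB cB a X2 Y2 Θ2 (Θ2 - 1) (Θ2 + 1) = 0
  torque_V : totalTorque l s0 c0 sA cA sB cB a X2 Y2 Θ2 (Θ2 - 1) (Θ2 + 1) = 0

namespace SwimmerAlgebra
variable {l a a1 a2 : ℝ} (G : SwimmerAlgebra A l)

/-- The aligned swimmer is a straight rod of unit length with drag coefficients 1 along it and 2
across it. Its resistance is diagonal with entries 1, 2 and 2/12 = 1/6, hence the factors 1, 1/2 and
6 here and in every computation below. -/
theorem base_values :
    G.ev G.X1 = 0 ∧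
    G.ev G.Y1 = 0 ∧
    G.ev G.Θ1 = l ^ 2 * (-6 + 4 * l) ∧
    G.ev G.X2 = 0 ∧
    G.ev G.Y2 = -l ^ 2 ∧
    G.ev G.Θ2 = 0 := by
  have x1 := congrArg G.ev G.forceX_S
  have y1 := congrArg G.ev G.forceY_S
  have t1 := congrArg G.ev G.torque_S
  have x2 := congrArg G.ev G.forceX_V
  have y2 := congrArg G.ev G.forceY_V
  have t2 := congrArg G.ev G.torque_V
  simp only [totalForceX, totalForceY, totalTorque, linkTorque, linkForceX, linkForceY,
    linkNormalForce, moment0, moment1, moment2, hingeNormal, hingeX, hingeY, map_add, map_sub,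
    ev_smul, map_mul, map_neg, map_zero, map_one, G.ev_s0, G.ev_c0, G.ev_sA, G.ev_cA, G.ev_sB,
    G.ev_cB, mul_zero, zero_mul, add_zero, zero_add, sub_zero, zero_sub, neg_zero, mul_one,
    one_mul] at x1 y1 t1 x2 y2 t2
  refine ⟨?_, ?_, ?_, ?_, ?_, ?_⟩
  · linear_combination x1
  · linear_combination 1 / 2 * y1
  · linear_combination 6 * t1
  · linear_combination x2
  · linear_combination 1 / 2 * y2
  · linear_combination 6 * t2

/-- In the differentiated balance the highest derivatives of X, Y and Θ enter with the diagonal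
coefficients of the straight rod, and all other terms have known values. The later `values_*` lemmas
repeat this for longer words. -/
theorem values_S (ha : G.ev G.a = a) :
    G.ev (G.S G.X1) = 0 ∧
    G.ev (G.S G.Y1) = 1 / 3 * a * l ^ 3 * (2 - 9 * l + 12 * l ^ 2 - 4 * l ^ 3) ∧
    G.ev (G.S G.Θ1) = 0 ∧
    G.ev (G.S G.X2) = l ^ 2 * (2 - 2 * l - 6 * l ^ 2 + 4 * l ^ 3) ∧
    G.ev (G.S G.Y2) = 0 ∧
    G.ev (G.S G.Θ2) = a * l ^ 3 * (4 - 20 * l + 36 * l ^ 2 - 28 * l ^ 3 + 8 * l ^ 4) := by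
  obtain ⟨hX1, hY1, hΘ1, hX2, hY2, hΘ2⟩ := G.base_values
  have x1 := congrArg (fun f => G.ev (G.S f)) G.forceX_S
  have y1 := congrArg (fun f => G.ev (G.S f)) G.forceY_S
  have t1 := congrArg (fun f => G.ev (G.S f)) G.torque_S
  have x2 := congrArg (fun f => G.ev (G.S f)) G.forceX_V
  have y2 := congrArg (fun f => G.ev (G.S f)) G.forceY_V
  have t2 := congrArg (fun f => G.ev (G.S f)) G.torque_V
  simp only [totalForceX, totalForceY, totalTorque, linkTorque, linkForceX, linkForceY,
    linkNormalForce, moment0, moment1, moment2, hingeNormal, hingeX, hingeY, map_add, map_sub,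
    Derivation.map_smul, Derivation.map_one_eq_zero, ev_smul, map_mul, ev_d1_mul, map_neg,
    map_zero, map_one, G.ev_s0, G.ev_c0, G.ev_sA, G.ev_cA, G.ev_sB, G.ev_cB, G.S_s0, G.S_c0,
    G.S_sA, G.S_cA, G.S_sB, G.S_cB, G.S_a, ha, hX1, hY1, hΘ1, hX2, hY2, hΘ2, mul_zero, zero_mul,
    add_zero, zero_add, sub_zero, zero_sub, neg_zero, mul_one, one_mul] at x1 y1 t1 x2 y2 t2
  refine ⟨?_, ?_, ?_, ?_, ?_, ?_⟩
  · linear_combination x1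
  · linear_combination 1 / 2 * y1
  · linear_combination 6 * t1
  · linear_combination x2
  · linear_combination 1 / 2 * y2
  · linear_combination 6 * t2

theorem values_V (ha : G.ev G.a = a) :
    G.ev (G.V G.X1) = l ^ 2 * (2 - 6 * l + 4 * l ^ 2) ∧
    G.ev (G.V G.Y1) = 0 ∧
    G.ev (G.V G.Θ1) = a * l ^ 3 * (4 - 20 * l + 36 * l ^ 2 - 28 * l ^ 3 + 8 * l ^ 4) ∧
    G.ev (G.V G.X2) = 0 ∧
    G.ev (G.V G.Y2) = 1 / 3 * a * l ^ 3 * (2 - 3 * l) ∧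
    G.ev (G.V G.Θ2) = 0 := by
  obtain ⟨hX1, hY1, hΘ1, hX2, hY2, hΘ2⟩ := G.base_values
  have x1 := congrArg (fun f => G.ev (G.V f)) G.forceX_S
  have y1 := congrArg (fun f => G.ev (G.V f)) G.forceY_S
  have t1 := congrArg (fun f => G.ev (G.V f)) G.torque_S
  have x2 := congrArg (fun f => G.ev (G.V f)) G.forceX_V
  have y2 := congrArg (fun f => G.ev (G.V f)) G.forceY_V
  have t2 := congrArg (fun f => G.ev (G.V f)) G.torque_V
  simp only [totalForceX, totalForceY, totalTorque, linkTorque, linkForceX, linkForceY,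
    linkNormalForce, moment0, moment1, moment2, hingeNormal, hingeX, hingeY, map_add, map_sub,
    Derivation.map_smul, Derivation.map_one_eq_zero, ev_smul, map_mul, ev_d1_mul, map_neg,
    map_zero, map_one, G.ev_s0, G.ev_c0, G.ev_sA, G.ev_cA, G.ev_sB, G.ev_cB, G.V_s0, G.V_c0,
    G.V_sA, G.V_cA, G.V_sB, G.V_cB, G.V_a, ha, hX1, hY1, hΘ1, hX2, hY2, hΘ2, mul_zero, zero_mul,
    add_zero, zero_add, sub_zero, zero_sub, neg_zero, mul_one, one_mul] at x1 y1 t1 x2 y2 t2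
  refine ⟨?_, ?_, ?_, ?_, ?_, ?_⟩
  · linear_combination x1
  · linear_combination 1 / 2 * y1
  · linear_combination 6 * t1
  · linear_combination x2
  · linear_combination 1 / 2 * y2
  · linear_combination 6 * t2

set_option maxHeartbeats 1600000 in
theorem values_SS (ha : G.ev G.a = a) (ha1 : G.ev G.a1 = a1) :
    G.ev (G.S (G.S G.X1)) = 1 / 3 * a * l ^ 3 * (-8 + 62 * l - 168 * l ^ 2 + 184 * l ^ 3
      - 64 * l ^ 4) ∧
    G.ev (G.S (G.S G.Y1)) = 0 ∧
    G.ev (G.S (G.S G.Θ1)) = l ^ 2 * (6 - 48 * l + 96 * l ^ 2 - 48 * l ^ 3) ∧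
    G.ev (G.S (G.S G.X2)) = 0 ∧
    G.ev (G.S (G.S G.Y2)) = l ^ 2 * (1 + 2 * l - 28 * l ^ 2 + 40 * l ^ 3 + 20 * l ^ 4 - 48 * l ^ 5
      + 16 * l ^ 6) ∧
    G.ev (G.S (G.S G.Θ2)) = 0 := by
  obtain ⟨hX1, hY1, hΘ1, hX2, hY2, hΘ2⟩ := G.base_values
  obtain ⟨hSX1, hSY1, hSΘ1, hSX2, hSY2, hSΘ2⟩ := G.values_S ha
  have x1 := congrArg (fun f => G.ev (G.S (G.S f))) G.forceX_S
  have y1 := congrArg (fun f => G.ev (G.S (G.S f))) G.forceY_S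
  have t1 := congrArg (fun f => G.ev (G.S (G.S f))) G.torque_S
  have x2 := congrArg (fun f => G.ev (G.S (G.S f))) G.forceX_V
  have y2 := congrArg (fun f => G.ev (G.S (G.S f))) G.forceY_V
  have t2 := congrArg (fun f => G.ev (G.S (G.S f))) G.torque_V
  simp only [totalForceX, totalForceY, totalTorque, linkTorque, linkForceX, linkForceY,
    linkNormalForce, moment0, moment1, moment2, hingeNormal, hingeX, hingeY, map_add, map_sub,
    Derivation.map_smul, Derivation.map_one_eq_zero, ev_smul, map_mul, ev_d1_mul, ev_d2_mul,
    map_neg, map_zero, map_one, G.ev_s0, G.ev_c0, G.ev_sA, G.ev_cA, G.ev_sB, G.ev_cB, G.S_s0,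
    G.S_c0, G.S_sA, G.S_cA, G.S_sB, G.S_cB, G.S_a, G.S_a1, ha, ha1, hX1, hY1, hΘ1, hX2, hY2, hΘ2,
    hSX1, hSY1, hSΘ1, hSX2, hSY2, hSΘ2, mul_zero, zero_mul, add_zero, zero_add, sub_zero,
    zero_sub, neg_zero, mul_one, one_mul] at x1 y1 t1 x2 y2 t2
  refine ⟨?_, ?_, ?_, ?_, ?_, ?_⟩
  · linear_combination x1
  · linear_combination 1 / 2 * y1
  · linear_combination 6 * t1
  · linear_combination x2
  · linear_combination 1 / 2 * y2
  · linear_combination 6 * t2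

set_option maxHeartbeats 1600000 in
theorem values_SV (ha : G.ev G.a = a) (ha1 : G.ev G.a1 = a1) :
    G.ev (G.S (G.V G.X1)) = 0 ∧
    G.ev (G.S (G.V G.Y1)) = l ^ 2 * (1 - 4 * l - 8 * l ^ 2 + 44 * l ^ 3 - 48 * l ^ 4 + 16 * l ^ 5)
      + 1 / 3 * a1 * l ^ 5 * (-2 + 9 * l - 12 * l ^ 2 + 4 * l ^ 3) + 1 / 3 * a ^ 2 * l ^ 5 * (2
      - 9 * l + 12 * l ^ 2 - 4 * l ^ 3) ∧
    G.ev (G.S (G.V G.Θ1)) = 0 ∧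
    G.ev (G.S (G.V G.X2)) = 1 / 3 * a * l ^ 3 * (-8 + 46 * l - 90 * l ^ 2 + 60 * l ^ 3 +
      24 * l ^ 4 - 60 * l ^ 5 + 24 * l ^ 6) ∧
    G.ev (G.S (G.V G.Y2)) = 0 ∧
    G.ev (G.S (G.V G.Θ2)) = l ^ 2 * (6 - 12 * l) + a1 * l ^ 5 * (-4 + 20 * l - 36 * l ^ 2 +
      28 * l ^ 3 - 8 * l ^ 4) + a ^ 2 * l ^ 5 * (20 - 132 * l + 356 * l ^ 2 - 508 * l ^ 3 +
      408 * l ^ 4 - 176 * l ^ 5 + 32 * l ^ 6) := by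
  obtain ⟨hX1, hY1, hΘ1, hX2, hY2, hΘ2⟩ := G.base_values
  obtain ⟨hSX1, hSY1, hSΘ1, hSX2, hSY2, hSΘ2⟩ := G.values_S ha
  obtain ⟨hVX1, hVY1, hVΘ1, hVX2, hVY2, hVΘ2⟩ := G.values_V ha
  have x1 := congrArg (fun f => G.ev (G.S (G.V f))) G.forceX_S
  have y1 := congrArg (fun f => G.ev (G.S (G.V f))) G.forceY_S
  have t1 := congrArg (fun f => G.ev (G.S (G.V f))) G.torque_S
  have x2 := congrArg (fun f => G.ev (G.S (G.V f))) G.forceX_V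
  have y2 := congrArg (fun f => G.ev (G.S (G.V f))) G.forceY_V
  have t2 := congrArg (fun f => G.ev (G.S (G.V f))) G.torque_V
  simp only [totalForceX, totalForceY, totalTorque, linkTorque, linkForceX, linkForceY,
    linkNormalForce, moment0, moment1, moment2, hingeNormal, hingeX, hingeY, map_add, map_sub,
    Derivation.map_smul, Derivation.map_one_eq_zero, ev_smul, map_mul, ev_d1_mul, ev_d2_mul,
    map_neg, map_zero, map_one, G.ev_s0, G.ev_c0, G.ev_sA, G.ev_cA, G.ev_sB, G.ev_cB, G.S_s0,
    G.S_c0, G.S_sA, G.S_cA, G.S_sB, G.S_cB, G.S_a, G.V_s0, G.V_c0, G.V_sA, G.V_cA, G.V_sB, G.V_cB,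
    G.V_a, G.S_a1, ha, ha1, hX1, hY1, hΘ1, hX2, hY2, hΘ2, hSX1, hSY1, hSΘ1, hSX2, hSY2, hSΘ2,
    hVX1, hVY1, hVΘ1, hVX2, hVY2, hVΘ2, mul_zero, zero_mul, add_zero, zero_add, sub_zero,
    zero_sub, neg_zero, mul_one, one_mul] at x1 y1 t1 x2 y2 t2
  refine ⟨?_, ?_, ?_, ?_, ?_, ?_⟩
  · linear_combination x1
  · linear_combination 1 / 2 * y1
  · linear_combination 6 * t1
  · linear_combination x2
  · linear_combination 1 / 2 * y2
  · linear_combination 6 * t2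

-- These values coincide with those of `values_SV`: at the aligned configuration [S,V] is a
-- translation along the wall, and the model does not depend on x.
set_option maxHeartbeats 1600000 in
theorem values_VS (ha : G.ev G.a = a) (ha1 : G.ev G.a1 = a1) :
    G.ev (G.V (G.S G.X1)) = 0 ∧
    G.ev (G.V (G.S G.Y1)) = l ^ 2 * (1 - 4 * l - 8 * l ^ 2 + 44 * l ^ 3 - 48 * l ^ 4 + 16 * l ^ 5)
      + 1 / 3 * a1 * l ^ 5 * (-2 + 9 * l - 12 * l ^ 2 + 4 * l ^ 3) + 1 / 3 * a ^ 2 * l ^ 5 * (2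
      - 9 * l + 12 * l ^ 2 - 4 * l ^ 3) ∧
    G.ev (G.V (G.S G.Θ1)) = 0 ∧
    G.ev (G.V (G.S G.X2)) = 1 / 3 * a * l ^ 3 * (-8 + 46 * l - 90 * l ^ 2 + 60 * l ^ 3 +
      24 * l ^ 4 - 60 * l ^ 5 + 24 * l ^ 6) ∧
    G.ev (G.V (G.S G.Y2)) = 0 ∧
    G.ev (G.V (G.S G.Θ2)) = l ^ 2 * (6 - 12 * l) + a1 * l ^ 5 * (-4 + 20 * l - 36 * l ^ 2 +
      28 * l ^ 3 - 8 * l ^ 4) + a ^ 2 * l ^ 5 * (20 - 132 * l + 356 * l ^ 2 - 508 * l ^ 3 +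
      408 * l ^ 4 - 176 * l ^ 5 + 32 * l ^ 6) := by
  obtain ⟨hX1, hY1, hΘ1, hX2, hY2, hΘ2⟩ := G.base_values
  obtain ⟨hVX1, hVY1, hVΘ1, hVX2, hVY2, hVΘ2⟩ := G.values_V ha
  obtain ⟨hSX1, hSY1, hSΘ1, hSX2, hSY2, hSΘ2⟩ := G.values_S ha
  have x1 := congrArg (fun f => G.ev (G.V (G.S f))) G.forceX_S
  have y1 := congrArg (fun f => G.ev (G.V (G.S f))) G.forceY_S
  have t1 := congrArg (fun f => G.ev (G.V (G.S f))) G.torque_S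
  have x2 := congrArg (fun f => G.ev (G.V (G.S f))) G.forceX_V
  have y2 := congrArg (fun f => G.ev (G.V (G.S f))) G.forceY_V
  have t2 := congrArg (fun f => G.ev (G.V (G.S f))) G.torque_V
  simp only [totalForceX, totalForceY, totalTorque, linkTorque, linkForceX, linkForceY,
    linkNormalForce, moment0, moment1, moment2, hingeNormal, hingeX, hingeY, map_add, map_sub,
    Derivation.map_smul, Derivation.map_one_eq_zero, ev_smul, map_mul, ev_d1_mul, ev_d2_mul,
    map_neg, map_zero, map_one, G.ev_s0, G.ev_c0, G.ev_sA, G.ev_cA, G.ev_sB, G.ev_cB, G.S_s0,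
    G.S_c0, G.S_sA, G.S_cA, G.S_sB, G.S_cB, G.S_a, G.V_s0, G.V_c0, G.V_sA, G.V_cA, G.V_sB, G.V_cB,
    G.V_a, G.V_a1, ha, ha1, hX1, hY1, hΘ1, hX2, hY2, hΘ2, hVX1, hVY1, hVΘ1, hVX2, hVY2, hVΘ2,
    hSX1, hSY1, hSΘ1, hSX2, hSY2, hSΘ2, mul_zero, zero_mul, add_zero, zero_add, sub_zero,
    zero_sub, neg_zero, mul_one, one_mul] at x1 y1 t1 x2 y2 t2
  refine ⟨?_, ?_, ?_, ?_, ?_, ?_⟩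
  · linear_combination x1
  · linear_combination 1 / 2 * y1
  · linear_combination 6 * t1
  · linear_combination x2
  · linear_combination 1 / 2 * y2
  · linear_combination 6 * t2

set_option maxHeartbeats 1600000 in
theorem values_VV (ha : G.ev G.a = a) (ha1 : G.ev G.a1 = a1) :
    G.ev (G.V (G.V G.X1)) = 1 / 3 * a * l ^ 3 * (-8 + 54 * l - 156 * l ^ 2 + 232 * l ^ 3
      - 168 * l ^ 4 + 48 * l ^ 5) ∧
    G.ev (G.V (G.V G.Y1)) = 0 ∧
    G.ev (G.V (G.V G.Θ1)) = l ^ 2 * (6 - 24 * l + 24 * l ^ 2) + a1 * l ^ 5 * (-8 + 40 * l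
      - 72 * l ^ 2 + 56 * l ^ 3 - 16 * l ^ 4) + a ^ 2 * l ^ 5 * (24 - 152 * l + 392 * l ^ 2
      - 536 * l ^ 3 + 416 * l ^ 4 - 176 * l ^ 5 + 32 * l ^ 6) ∧
    G.ev (G.V (G.V G.X2)) = 0 ∧
    G.ev (G.V (G.V G.Y2)) = l ^ 2 * (1 - 2 * l) + 1 / 3 * a1 * l ^ 5 * (-4 + 6 * l) + 1 /
      3 * a ^ 2 * l ^ 5 * (4 - 6 * l) ∧
    G.ev (G.V (G.V G.Θ2)) = 0 := by
  obtain ⟨hX1, hY1, hΘ1, hX2, hY2, hΘ2⟩ := G.base_values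
  obtain ⟨hVX1, hVY1, hVΘ1, hVX2, hVY2, hVΘ2⟩ := G.values_V ha
  have x1 := congrArg (fun f => G.ev (G.V (G.V f))) G.forceX_S
  have y1 := congrArg (fun f => G.ev (G.V (G.V f))) G.forceY_S
  have t1 := congrArg (fun f => G.ev (G.V (G.V f))) G.torque_S
  have x2 := congrArg (fun f => G.ev (G.V (G.V f))) G.forceX_V
  have y2 := congrArg (fun f => G.ev (G.V (G.V f))) G.forceY_V
  have t2 := congrArg (fun f => G.ev (G.V (G.V f))) G.torque_V
  simp only [totalForceX, totalForceY, totalTorque, linkTorque, linkForceX, linkForceY,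
    linkNormalForce, moment0, moment1, moment2, hingeNormal, hingeX, hingeY, map_add, map_sub,
    Derivation.map_smul, Derivation.map_one_eq_zero, ev_smul, map_mul, ev_d1_mul, ev_d2_mul,
    map_neg, map_zero, map_one, G.ev_s0, G.ev_c0, G.ev_sA, G.ev_cA, G.ev_sB, G.ev_cB, G.V_s0,
    G.V_c0, G.V_sA, G.V_cA, G.V_sB, G.V_cB, G.V_a, G.V_a1, ha, ha1, hX1, hY1, hΘ1, hX2, hY2, hΘ2,
    hVX1, hVY1, hVΘ1, hVX2, hVY2, hVΘ2, mul_zero, zero_mul, add_zero, zero_add, sub_zero,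
    zero_sub, neg_zero, mul_one, one_mul] at x1 y1 t1 x2 y2 t2
  refine ⟨?_, ?_, ?_, ?_, ?_, ?_⟩
  · linear_combination x1
  · linear_combination 1 / 2 * y1
  · linear_combination 6 * t1
  · linear_combination x2
  · linear_combination 1 / 2 * y2
  · linear_combination 6 * t2

-- For words of length three, only the Y and Θ components that enter the two fourth-order brackets
-- are computed.
set_option maxHeartbeats 1600000 in
theorem values_SSS (ha : G.ev G.a = a) (ha1 : G.ev G.a1 = a1)
    (ha2 : G.ev G.a2 = a2) :
    G.ev (G.S (G.S (G.S G.Y2))) = 0 ∧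
    G.ev (G.S (G.S (G.S G.Θ2))) = a * l ^ 3 * (-16 + 152 * l - 628 * l ^ 2 + 1476 * l ^ 3
      - 2328 * l ^ 4 + 3072 * l ^ 5 - 3792 * l ^ 6 + 3696 * l ^ 7 - 2336 * l ^ 8 + 832 * l ^ 9
      - 128 * l ^ 10) + a * a1 * l ^ 6 * (8 - 76 * l + 300 * l ^ 2 - 636 * l ^ 3 + 780 * l ^ 4
      - 552 * l ^ 5 + 208 * l ^ 6 - 32 * l ^ 7) := by
  obtain ⟨hX1, hY1, hΘ1, hX2, hY2, hΘ2⟩ := G.base_values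
  obtain ⟨hSX1, hSY1, hSΘ1, hSX2, hSY2, hSΘ2⟩ := G.values_S ha
  obtain ⟨hSSX1, hSSY1, hSSΘ1, hSSX2, hSSY2, hSSΘ2⟩ := G.values_SS ha ha1
  have y2 := congrArg (fun f => G.ev (G.S (G.S (G.S f)))) G.forceY_V
  have t2 := congrArg (fun f => G.ev (G.S (G.S (G.S f)))) G.torque_V
  simp only [totalForceX, totalForceY, totalTorque, linkTorque, linkForceX, linkForceY,
    linkNormalForce, moment0, moment1, moment2, hingeNormal, hingeX, hingeY, map_add, map_sub,
    Derivation.map_smul, Derivation.map_one_eq_zero, ev_smul, map_mul, ev_d1_mul, ev_d2_mul,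
    ev_d3_mul, map_neg, map_zero, map_one, G.ev_s0, G.ev_c0, G.ev_sA, G.ev_cA, G.ev_sB, G.ev_cB,
    G.S_s0, G.S_c0, G.S_sA, G.S_cA, G.S_sB, G.S_cB, G.S_a, G.S_a1, ha, ha1, ha2, hX1, hY1, hΘ1,
    hX2, hY2, hΘ2, hSX1, hSY1, hSΘ1, hSX2, hSY2, hSΘ2, hSSX1, hSSY1, hSSΘ1, hSSX2, hSSY2, hSSΘ2,
    mul_zero, zero_mul, add_zero, zero_add, sub_zero, zero_sub, neg_zero, mul_one, one_mul]
    at y2 t2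
  refine ⟨?_, ?_⟩
  · linear_combination 1 / 2 * y2
  · linear_combination 6 * t2

set_option maxHeartbeats 1600000 in
theorem values_SSV (ha : G.ev G.a = a) (ha1 : G.ev G.a1 = a1)
    (ha2 : G.ev G.a2 = a2) :
    G.ev (G.S (G.S (G.V G.Y1))) = 0 ∧
    G.ev (G.S (G.S (G.V G.Θ1))) = a * l ^ 3 * (-16 + 164 * l - 632 * l ^ 2 + 1176 * l ^ 3
      - 1232 * l ^ 4 + 1312 * l ^ 5 - 2256 * l ^ 6 + 2992 * l ^ 7 - 2208 * l ^ 8 + 832 * l ^ 9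
      - 128 * l ^ 10) + 1 / 3 * a * a1 * l ^ 6 * (8 - 76 * l + 300 * l ^ 2 - 636 * l ^ 3 +
      780 * l ^ 4 - 552 * l ^ 5 + 208 * l ^ 6 - 32 * l ^ 7) + 1 / 3 * a ^ 3 * l ^ 6 * (16
      - 152 * l + 600 * l ^ 2 - 1272 * l ^ 3 + 1560 * l ^ 4 - 1104 * l ^ 5 + 416 * l ^ 6
      - 64 * l ^ 7) ∧
    G.ev (G.S (G.S (G.V G.Y2))) = 1 / 3 * a * l ^ 3 * (-8 + 33 * l + 104 * l ^ 2 - 888 * l ^ 3 +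
      2112 * l ^ 4 - 2208 * l ^ 5 + 624 * l ^ 6 + 816 * l ^ 7 - 768 * l ^ 8 + 192 * l ^ 9) + 1 /
      9 * a * a1 * l ^ 6 * (4 - 24 * l + 51 * l ^ 2 - 44 * l ^ 3 + 12 * l ^ 4) + 1 /
      3 * a ^ 3 * l ^ 6 * (8 - 80 * l + 344 * l ^ 2 - 832 * l ^ 3 + 1240 * l ^ 4 - 1168 * l ^ 5 +
      680 * l ^ 6 - 224 * l ^ 7 + 32 * l ^ 8) := by
  obtain ⟨hX1, hY1, hΘ1, hX2, hY2, hΘ2⟩ := G.base_values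
  obtain ⟨hSX1, hSY1, hSΘ1, hSX2, hSY2, hSΘ2⟩ := G.values_S ha
  obtain ⟨hVX1, hVY1, hVΘ1, hVX2, hVY2, hVΘ2⟩ := G.values_V ha
  obtain ⟨hSSX1, hSSY1, hSSΘ1, hSSX2, hSSY2, hSSΘ2⟩ := G.values_SS ha ha1
  obtain ⟨hSVX1, hSVY1, hSVΘ1, hSVX2, hSVY2, hSVΘ2⟩ := G.values_SV ha ha1
  have y1 := congrArg (fun f => G.ev (G.S (G.S (G.V f)))) G.forceY_S
  have t1 := congrArg (fun f => G.ev (G.S (G.S (G.V f)))) G.torque_S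
  have y2 := congrArg (fun f => G.ev (G.S (G.S (G.V f)))) G.forceY_V
  simp only [totalForceX, totalForceY, totalTorque, linkTorque, linkForceX, linkForceY,
    linkNormalForce, moment0, moment1, moment2, hingeNormal, hingeX, hingeY, map_add, map_sub,
    Derivation.map_smul, Derivation.map_one_eq_zero, ev_smul, map_mul, ev_d1_mul, ev_d2_mul,
    ev_d3_mul, map_neg, map_zero, map_one, G.ev_s0, G.ev_c0, G.ev_sA, G.ev_cA, G.ev_sB, G.ev_cB,
    G.S_s0, G.S_c0, G.S_sA, G.S_cA, G.S_sB, G.S_cB, G.S_a, G.V_s0, G.V_c0, G.V_sA, G.V_cA, G.V_sB,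
    G.V_cB, G.V_a, G.S_a1, ha, ha1, ha2, hX1, hY1, hΘ1, hX2, hY2, hΘ2, hSX1, hSY1, hSΘ1, hSX2,
    hSY2, hSΘ2, hVX1, hVY1, hVΘ1, hVX2, hVY2, hVΘ2, hSSX1, hSSY1, hSSΘ1, hSSX2, hSSY2, hSSΘ2,
    hSVX1, hSVY1, hSVΘ1, hSVX2, hSVY2, hSVΘ2, mul_zero, zero_mul, add_zero, zero_add, sub_zero,
    zero_sub, neg_zero, mul_one, one_mul] at y1 t1 y2
  refine ⟨?_, ?_, ?_⟩
  · linear_combination 1 / 2 * y1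
  · linear_combination 6 * t1
  · linear_combination 1 / 2 * y2

set_option maxHeartbeats 1600000 in
theorem values_SVS (ha : G.ev G.a = a) (ha1 : G.ev G.a1 = a1)
    (ha2 : G.ev G.a2 = a2) :
    G.ev (G.S (G.V (G.S G.Y1))) = 0 ∧
    G.ev (G.S (G.V (G.S G.Θ1))) = a * l ^ 3 * (-16 + 164 * l - 632 * l ^ 2 + 1176 * l ^ 3
      - 1232 * l ^ 4 + 1312 * l ^ 5 - 2256 * l ^ 6 + 2992 * l ^ 7 - 2208 * l ^ 8 + 832 * l ^ 9
      - 128 * l ^ 10) + 1 / 3 * a * a1 * l ^ 6 * (8 - 76 * l + 300 * l ^ 2 - 636 * l ^ 3 +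
      780 * l ^ 4 - 552 * l ^ 5 + 208 * l ^ 6 - 32 * l ^ 7) + 1 / 3 * a ^ 3 * l ^ 6 * (16
      - 152 * l + 600 * l ^ 2 - 1272 * l ^ 3 + 1560 * l ^ 4 - 1104 * l ^ 5 + 416 * l ^ 6
      - 64 * l ^ 7) ∧
    G.ev (G.S (G.V (G.S G.Y2))) = 1 / 3 * a * l ^ 3 * (-8 + 33 * l + 104 * l ^ 2 - 888 * l ^ 3 +
      2112 * l ^ 4 - 2208 * l ^ 5 + 624 * l ^ 6 + 816 * l ^ 7 - 768 * l ^ 8 + 192 * l ^ 9) + 1 /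
      9 * a * a1 * l ^ 6 * (4 - 24 * l + 51 * l ^ 2 - 44 * l ^ 3 + 12 * l ^ 4) + 1 /
      3 * a ^ 3 * l ^ 6 * (8 - 80 * l + 344 * l ^ 2 - 832 * l ^ 3 + 1240 * l ^ 4 - 1168 * l ^ 5 +
      680 * l ^ 6 - 224 * l ^ 7 + 32 * l ^ 8) := by
  obtain ⟨hX1, hY1, hΘ1, hX2, hY2, hΘ2⟩ := G.base_values
  obtain ⟨hSX1, hSY1, hSΘ1, hSX2, hSY2, hSΘ2⟩ := G.values_S ha
  obtain ⟨hVX1, hVY1, hVΘ1, hVX2, hVY2, hVΘ2⟩ := G.values_V ha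
  obtain ⟨hSVX1, hSVY1, hSVΘ1, hSVX2, hSVY2, hSVΘ2⟩ := G.values_SV ha ha1
  obtain ⟨hSSX1, hSSY1, hSSΘ1, hSSX2, hSSY2, hSSΘ2⟩ := G.values_SS ha ha1
  obtain ⟨hVSX1, hVSY1, hVSΘ1, hVSX2, hVSY2, hVSΘ2⟩ := G.values_VS ha ha1
  have y1 := congrArg (fun f => G.ev (G.S (G.V (G.S f)))) G.forceY_S
  have t1 := congrArg (fun f => G.ev (G.S (G.V (G.S f)))) G.torque_S
  have y2 := congrArg (fun f => G.ev (G.S (G.V (G.S f)))) G.forceY_V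
  simp only [totalForceX, totalForceY, totalTorque, linkTorque, linkForceX, linkForceY,
    linkNormalForce, moment0, moment1, moment2, hingeNormal, hingeX, hingeY, map_add, map_sub,
    Derivation.map_smul, Derivation.map_one_eq_zero, ev_smul, map_mul, ev_d1_mul, ev_d2_mul,
    ev_d3_mul, map_neg, map_zero, map_one, G.ev_s0, G.ev_c0, G.ev_sA, G.ev_cA, G.ev_sB, G.ev_cB,
    G.S_s0, G.S_c0, G.S_sA, G.S_cA, G.S_sB, G.S_cB, G.S_a, G.V_s0, G.V_c0, G.V_sA, G.V_cA, G.V_sB,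
    G.V_cB, G.V_a, G.S_a1, G.V_a1, ha, ha1, ha2, hX1, hY1, hΘ1, hX2, hY2, hΘ2, hSX1, hSY1, hSΘ1,
    hSX2, hSY2, hSΘ2, hVX1, hVY1, hVΘ1, hVX2, hVY2, hVΘ2, hSVX1, hSVY1, hSVΘ1, hSVX2, hSVY2,
    hSVΘ2, hSSX1, hSSY1, hSSΘ1, hSSX2, hSSY2, hSSΘ2, hVSX1, hVSY1, hVSΘ1, hVSX2, hVSY2, hVSΘ2,
    mul_zero, zero_mul, add_zero, zero_add, sub_zero, zero_sub, neg_zero, mul_one, one_mul]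
    at y1 t1 y2
  refine ⟨?_, ?_, ?_⟩
  · linear_combination 1 / 2 * y1
  · linear_combination 6 * t1
  · linear_combination 1 / 2 * y2

set_option maxHeartbeats 1600000 in
theorem values_VSS (ha : G.ev G.a = a) (ha1 : G.ev G.a1 = a1)
    (ha2 : G.ev G.a2 = a2) :
    G.ev (G.V (G.S (G.S G.Y1))) = 0 ∧
    G.ev (G.V (G.S (G.S G.Θ1))) = a * l ^ 3 * (-16 + 164 * l - 632 * l ^ 2 + 1176 * l ^ 3
      - 1232 * l ^ 4 + 1312 * l ^ 5 - 2256 * l ^ 6 + 2992 * l ^ 7 - 2208 * l ^ 8 + 832 * l ^ 9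
      - 128 * l ^ 10) + 1 / 3 * a * a1 * l ^ 6 * (8 - 76 * l + 300 * l ^ 2 - 636 * l ^ 3 +
      780 * l ^ 4 - 552 * l ^ 5 + 208 * l ^ 6 - 32 * l ^ 7) + 1 / 3 * a ^ 3 * l ^ 6 * (16
      - 152 * l + 600 * l ^ 2 - 1272 * l ^ 3 + 1560 * l ^ 4 - 1104 * l ^ 5 + 416 * l ^ 6
      - 64 * l ^ 7) := by
  obtain ⟨hX1, hY1, hΘ1, hX2, hY2, hΘ2⟩ := G.base_values
  obtain ⟨hVX1, hVY1, hVΘ1, hVX2, hVY2, hVΘ2⟩ := G.values_V ha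
  obtain ⟨hSX1, hSY1, hSΘ1, hSX2, hSY2, hSΘ2⟩ := G.values_S ha
  obtain ⟨hVSX1, hVSY1, hVSΘ1, hVSX2, hVSY2, hVSΘ2⟩ := G.values_VS ha ha1
  obtain ⟨hSSX1, hSSY1, hSSΘ1, hSSX2, hSSY2, hSSΘ2⟩ := G.values_SS ha ha1
  have y1 := congrArg (fun f => G.ev (G.V (G.S (G.S f)))) G.forceY_S
  have t1 := congrArg (fun f => G.ev (G.V (G.S (G.S f)))) G.torque_S
  simp only [totalForceX, totalForceY, totalTorque, linkTorque, linkForceX, linkForceY,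
    linkNormalForce, moment0, moment1, moment2, hingeNormal, hingeX, hingeY, map_add, map_sub,
    Derivation.map_smul, Derivation.map_one_eq_zero, ev_smul, map_mul, ev_d1_mul, ev_d2_mul,
    ev_d3_mul, map_neg, map_zero, map_one, G.ev_s0, G.ev_c0, G.ev_sA, G.ev_cA, G.ev_sB, G.ev_cB,
    G.S_s0, G.S_c0, G.S_sA, G.S_cA, G.S_sB, G.S_cB, G.S_a, G.V_s0, G.V_c0, G.V_sA, G.V_cA, G.V_sB,
    G.V_cB, G.V_a, G.S_a1, G.V_a1, ha, ha1, ha2, hX1, hY1, hΘ1, hX2, hY2, hΘ2, hVX1, hVY1, hVΘ1,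
    hVX2, hVY2, hVΘ2, hSX1, hSY1, hSΘ1, hSX2, hSY2, hSΘ2, hVSX1, hVSY1, hVSΘ1, hVSX2, hVSY2,
    hVSΘ2, hSSX1, hSSY1, hSSΘ1, hSSX2, hSSY2, hSSΘ2, mul_zero, zero_mul, add_zero, zero_add,
    sub_zero, zero_sub, neg_zero, mul_one, one_mul] at y1 t1
  refine ⟨?_, ?_⟩
  · linear_combination 1 / 2 * y1
  · linear_combination 6 * t1

set_option maxHeartbeats 1600000 in
theorem values_VSV (ha : G.ev G.a = a) (ha1 : G.ev G.a1 = a1)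
    (ha2 : G.ev G.a2 = a2) :
    G.ev (G.V (G.S (G.V G.Y1))) = 1 / 3 * a2 * l ^ 7 * (2 - 9 * l + 12 * l ^ 2 - 4 * l ^ 3) + 1 /
      3 * a * l ^ 3 * (-8 + 59 * l - 66 * l ^ 2 - 566 * l ^ 3 + 2384 * l ^ 4 - 4200 * l ^ 5 +
      3936 * l ^ 6 - 1920 * l ^ 7 + 384 * l ^ 8) + 1 / 9 * a * a1 * l ^ 6 * (4 - 48 * l +
      159 * l ^ 2 - 188 * l ^ 3 + 60 * l ^ 4) + 1 / 3 * a ^ 3 * l ^ 6 * (8 - 76 * l + 326 * l ^ 2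
      - 808 * l ^ 3 + 1232 * l ^ 4 - 1168 * l ^ 5 + 680 * l ^ 6 - 224 * l ^ 7 + 32 * l ^ 8) := by
  obtain ⟨hX1, hY1, hΘ1, hX2, hY2, hΘ2⟩ := G.base_values
  obtain ⟨hVX1, hVY1, hVΘ1, hVX2, hVY2, hVΘ2⟩ := G.values_V ha
  obtain ⟨hSX1, hSY1, hSΘ1, hSX2, hSY2, hSΘ2⟩ := G.values_S ha
  obtain ⟨hVSX1, hVSY1, hVSΘ1, hVSX2, hVSY2, hVSΘ2⟩ := G.values_VS ha ha1
  obtain ⟨hVVX1, hVVY1, hVVΘ1, hVVX2, hVVY2, hVVΘ2⟩ := G.values_VV ha ha1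
  obtain ⟨hSVX1, hSVY1, hSVΘ1, hSVX2, hSVY2, hSVΘ2⟩ := G.values_SV ha ha1
  have y1 := congrArg (fun f => G.ev (G.V (G.S (G.V f)))) G.forceY_S
  simp only [totalForceX, totalForceY, totalTorque, linkTorque, linkForceX, linkForceY,
    linkNormalForce, moment0, moment1, moment2, hingeNormal, hingeX, hingeY, map_add, map_sub,
    Derivation.map_smul, Derivation.map_one_eq_zero, ev_smul, map_mul, ev_d1_mul, ev_d2_mul,
    ev_d3_mul, map_neg, map_zero, map_one, G.ev_s0, G.ev_c0, G.ev_sA, G.ev_cA, G.ev_sB, G.ev_cB,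
    G.S_s0, G.S_c0, G.S_sA, G.S_cA, G.S_sB, G.S_cB, G.S_a, G.V_s0, G.V_c0, G.V_sA, G.V_cA, G.V_sB,
    G.V_cB, G.V_a, G.S_a1, G.V_a1, ha, ha1, ha2, hX1, hY1, hΘ1, hX2, hY2, hΘ2, hVX1, hVY1, hVΘ1,
    hVX2, hVY2, hVΘ2, hSX1, hSY1, hSΘ1, hSX2, hSY2, hSΘ2, hVSX1, hVSY1, hVSΘ1, hVSX2, hVSY2,
    hVSΘ2, hVVX1, hVVY1, hVVΘ1, hVVX2, hVVY2, hVVΘ2, hSVX1, hSVY1, hSVΘ1, hSVX2, hSVY2, hSVΘ2,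
    mul_zero, zero_mul, add_zero, zero_add, sub_zero, zero_sub, neg_zero, mul_one, one_mul] at y1
  linear_combination 1 / 2 * y1

set_option maxHeartbeats 1600000 in
theorem values_VVS (ha : G.ev G.a = a) (ha1 : G.ev G.a1 = a1)
    (ha2 : G.ev G.a2 = a2) :
    G.ev (G.V (G.V (G.S G.Y1))) = 1 / 3 * a2 * l ^ 7 * (2 - 9 * l + 12 * l ^ 2 - 4 * l ^ 3) + 1 /
      3 * a * l ^ 3 * (-8 + 59 * l - 66 * l ^ 2 - 566 * l ^ 3 + 2384 * l ^ 4 - 4200 * l ^ 5 +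
      3936 * l ^ 6 - 1920 * l ^ 7 + 384 * l ^ 8) + 1 / 9 * a * a1 * l ^ 6 * (4 - 48 * l +
      159 * l ^ 2 - 188 * l ^ 3 + 60 * l ^ 4) + 1 / 3 * a ^ 3 * l ^ 6 * (8 - 76 * l + 326 * l ^ 2
      - 808 * l ^ 3 + 1232 * l ^ 4 - 1168 * l ^ 5 + 680 * l ^ 6 - 224 * l ^ 7 + 32 * l ^ 8) := by
  obtain ⟨hX1, hY1, hΘ1, hX2, hY2, hΘ2⟩ := G.base_values
  obtain ⟨hVX1, hVY1, hVΘ1, hVX2, hVY2, hVΘ2⟩ := G.values_V ha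
  obtain ⟨hSX1, hSY1, hSΘ1, hSX2, hSY2, hSΘ2⟩ := G.values_S ha
  obtain ⟨hVVX1, hVVY1, hVVΘ1, hVVX2, hVVY2, hVVΘ2⟩ := G.values_VV ha ha1
  obtain ⟨hVSX1, hVSY1, hVSΘ1, hVSX2, hVSY2, hVSΘ2⟩ := G.values_VS ha ha1
  have y1 := congrArg (fun f => G.ev (G.V (G.V (G.S f)))) G.forceY_S
  simp only [totalForceX, totalForceY, totalTorque, linkTorque, linkForceX, linkForceY,
    linkNormalForce, moment0, moment1, moment2, hingeNormal, hingeX, hingeY, map_add, map_sub,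
    Derivation.map_smul, Derivation.map_one_eq_zero, ev_smul, map_mul, ev_d1_mul, ev_d2_mul,
    ev_d3_mul, map_neg, map_zero, map_one, G.ev_s0, G.ev_c0, G.ev_sA, G.ev_cA, G.ev_sB, G.ev_cB,
    G.S_s0, G.S_c0, G.S_sA, G.S_cA, G.S_sB, G.S_cB, G.S_a, G.V_s0, G.V_c0, G.V_sA, G.V_cA, G.V_sB,
    G.V_cB, G.V_a, G.V_a1, ha, ha1, ha2, hX1, hY1, hΘ1, hX2, hY2, hΘ2, hVX1, hVY1, hVΘ1, hVX2,
    hVY2, hVΘ2, hSX1, hSY1, hSΘ1, hSX2, hSY2, hSΘ2, hVVX1, hVVY1, hVVΘ1, hVVX2, hVVY2, hVVΘ2,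
    hVSX1, hVSY1, hVSΘ1, hVSX2, hVSY2, hVSΘ2, mul_zero, zero_mul, add_zero, zero_add, sub_zero,
    zero_sub, neg_zero, mul_one, one_mul] at y1
  linear_combination 1 / 2 * y1
end SwimmerAlgebra
end
end Purcell

/-! ### Signs of the three brackets. -/

namespace Purcell
noncomputable section
variable {A : Type*} [CommRing A] [Algebra ℝ A]
namespace SwimmerAlgebra
variable {l : ℝ} (G : SwimmerAlgebra A l)

/-- The value at the aligned configuration of the bracket `[S, V]`: a translation along the wall. -/
theorem ev_bracket_SV (hl : 0 < l) (hl' : l < 1 / 2) :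
    0 < G.ev (G.S G.X2) - G.ev (G.V G.X1) ∧ G.ev (G.S G.Y2) - G.ev (G.V G.Y1) = 0 ∧
      G.ev (G.S G.Θ2) - G.ev (G.V G.Θ1) = 0 := by
  obtain ⟨-, -, -, hSX2, hSY2, hSΘ2⟩ := G.values_S rfl
  obtain ⟨hVX1, hVY1, hVΘ1, -⟩ := G.values_V rfl
  rw [hSX2, hSY2, hSΘ2, hVX1, hVY1, hVΘ1]
  refine ⟨?_, by ring, by ring⟩
  have h : 0 < 2 * l ^ 3 * ((2 - l) * (1 - 2 * l)) :=
    mul_pos (by positivity) (mul_pos (by linarith) (by linarith))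
  linear_combination h

/-- The value at the aligned configuration of `[S, [S, [S, V]]]`: up to a translation along the wall, a
rotation. -/
theorem ev_bracket_SSSV (hl : 0 < l) (hl' : l < 1 / 2) (ha : 0 < G.ev G.a) (ha1 : G.ev G.a1 < 0) :
    G.ev (G.S (G.S (G.S G.Y2))) - 3 * G.ev (G.S (G.S (G.V G.Y1))) +
        3 * G.ev (G.S (G.V (G.S G.Y1))) - G.ev (G.V (G.S (G.S G.Y1))) = 0 ∧
      G.ev (G.S (G.S (G.S G.Θ2))) - 3 * G.ev (G.S (G.S (G.V G.Θ1))) +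
        3 * G.ev (G.S (G.V (G.S G.Θ1))) - G.ev (G.V (G.S (G.S G.Θ1))) < 0 := by
  obtain ⟨h1, h1'⟩ := G.values_SSS rfl rfl rfl
  obtain ⟨h2, h2', -⟩ := G.values_SSV rfl rfl rfl
  obtain ⟨h3, h3', -⟩ := G.values_SVS rfl rfl rfl
  obtain ⟨h4, h4'⟩ := G.values_VSS rfl rfl rfl
  rw [h1, h1', h2, h2', h3, h3', h4, h4']
  refine ⟨by ring, ?_⟩
  generalize G.ev G.a = a at ha ⊢
  generalize G.ev G.a1 = a1 at ha1 ⊢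
  obtain ⟨w, hw⟩ : ∃ w, w = 1 - 2 * l := ⟨_, rfl⟩
  have hw0 : 0 < w := by linarith
  obtain ⟨b, rfl⟩ : ∃ b, a1 = -b := ⟨-a1, by ring⟩
  have hb : 0 < b := by linarith
  -- Minus the angular component, written in b = -a1 and w = 1 - 2l, the relative length of the
  -- central link. Homogenizing the polynomials in l by 1 = w + 2l leaves only positive
  -- coefficients, so positivity is visible.
  have h : 0 < a * l ^ 4 * (384 * w ^ 2 * l ^ 5 + 1088 * w ^ 3 * l ^ 4 + 1216 * w ^ 4 * l ^ 3 +
      660 * w ^ 5 * l ^ 2 + 164 * w ^ 6 * l + 12 * w ^ 7) + a * (b + a ^ 2) * l ^ 6 *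
      (8 * w ^ 3 * l ^ 4 + 88 / 3 * w ^ 4 * l ^ 3 + 40 * w ^ 5 * l ^ 2 + 24 * w ^ 6 * l +
        16 / 3 * w ^ 7) := by positivity
  rw [hw] at h
  linear_combination h

/-- The value at the aligned configuration of `[V, [S, [S, V]]]`: it has a component normal to the
wall. -/
theorem ev_bracket_VSSV (hl : 0 < l) (hl' : l < 1 / 2) (ha : 0 < G.ev G.a) (ha1 : G.ev G.a1 < 0)
    (ha2 : 0 < G.ev G.a2) :
    -2 * G.ev (G.V (G.S (G.V G.Y1))) + G.ev (G.V (G.V (G.S G.Y1))) - G.ev (G.S (G.S (G.V G.Y2))) +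
        2 * G.ev (G.S (G.V (G.S G.Y2))) < 0 := by
  obtain ⟨-, -, h3⟩ := G.values_SSV rfl rfl rfl
  obtain ⟨-, -, h4⟩ := G.values_SVS rfl rfl rfl
  rw [G.values_VSV rfl rfl rfl, G.values_VVS rfl rfl rfl, h3, h4]
  generalize G.ev G.a = a at ha ⊢
  generalize G.ev G.a1 = a1 at ha1 ⊢
  generalize G.ev G.a2 = a2 at ha2 ⊢
  obtain ⟨w, hw⟩ : ∃ w, w = 1 - 2 * l := ⟨_, rfl⟩
  have hw0 : 0 < w := by linarith
  obtain ⟨b, rfl⟩ : ∃ b, a1 = -b := ⟨-a1, by ring⟩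
  have hb : 0 < b := by linarith
  -- The same homogenization; the second derivative a2 of the wall ratio enters too, with the sign
  -- that convexity gives.
  have h : 0 < a * l ^ 4 * (256 / 3 * w * l ^ 7 + 240 * w ^ 2 * l ^ 6 + 1168 / 3 * w ^ 3 * l ^ 5 +
      1568 / 3 * w ^ 4 * l ^ 4 + 1504 / 3 * w ^ 5 * l ^ 3 + 854 / 3 * w ^ 6 * l ^ 2 +
      82 * w ^ 7 * l + 26 / 3 * w ^ 8) +
      (a2 + 4 * a * b + 2 * a ^ 3) * l ^ 7 * (w ^ 2 * l + 2 / 3 * w ^ 3) := by positivity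
  rw [hw] at h
  linear_combination h
end SwimmerAlgebra
end
end Purcell

/-! ### Smooth functions as an algebra, vector fields as derivations. -/

noncomputable section

section SmoothFunctions
section
variable {E : Type*}

/-- Extension by zero of a function on a subset. -/
def extendZero (Ω : Set E) (f : Ω → ℝ) : E → ℝ := Function.extend Subtype.val f 0

theorem extendZero_apply {Ω : Set E} (f : Ω → ℝ) (x : Ω) : extendZero Ω f x = f x :=
  Subtype.val_injective.extend_apply _ _ _

theorem extendZero_restrict_eqOn (Ω : Set E) (g : E → ℝ) :
    EqOn (extendZero Ω fun x => g x) g Ω := fun x hx => extendZero_apply (fun x : Ω => g x) ⟨x, hx⟩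

/-- Derivatives at points of an open set depend only on germs, so the extension by zero may be
replaced by any other extension. -/
theorem extendZero_eventuallyEq [TopologicalSpace E] {Ω : Set E} (hΩ : IsOpen Ω) {f : Ω → ℝ} {g : E → ℝ} (h : ∀ x : Ω, f x = g x)
    (x : Ω) : extendZero Ω f =ᶠ[𝓝 (x : E)] g := by
  filter_upwards [hΩ.mem_nhds x.2] with y hy
  rw [extendZero_apply f ⟨y, hy⟩, h]

end

variable {E : Type*} [NormedAddCommGroup E] [NormedSpace ℝ E]

/-- The algebra of smooth functions on a subset of a normed space. -/
def smoothFunctions (Ω : Set E) : Subalgebra ℝ (Ω → ℝ) where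
  carrier := {f | ContDiffOn ℝ (⊤ : ℕ∞) (extendZero Ω f) Ω}
  mul_mem' {f g} hf hg := (hf.mul hg).congr fun x hx => by
    simp [extendZero_apply (Ω := Ω) _ ⟨x, hx⟩]
  add_mem' {f g} hf hg := (hf.add hg).congr fun x hx => by
    simp [extendZero_apply (Ω := Ω) _ ⟨x, hx⟩]
  algebraMap_mem' r := (contDiffOn_const (c := r)).congr fun x hx => by
    simp [extendZero_apply (Ω := Ω) _ ⟨x, hx⟩]

/-- The restriction of a function that is smooth on `Ω`. -/
def smoothRestrict {Ω : Set E} (g : E → ℝ) (hg : ContDiffOn ℝ (⊤ : ℕ∞) g Ω) : smoothFunctions Ω :=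
  ⟨fun x => g x, hg.congr (extendZero_restrict_eqOn Ω g)⟩

@[simp] theorem smoothRestrict_apply {Ω : Set E} (g : E → ℝ) (hg : ContDiffOn ℝ (⊤ : ℕ∞) g Ω)
    (x : Ω) : (smoothRestrict g hg : Ω → ℝ) x = g x := rfl

/-- Evaluation of smooth functions at a point. -/
def smoothEval {Ω : Set E} (x : Ω) : smoothFunctions Ω →ₐ[ℝ] ℝ :=
  (Pi.evalAlgHom ℝ (fun _ : Ω => ℝ) x).comp (smoothFunctions Ω).val

@[simp] theorem smoothEval_apply {Ω : Set E} (x : Ω) (f : smoothFunctions Ω) :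
    smoothEval x f = (f : Ω → ℝ) x := rfl

variable {Ω : Set E}

theorem contDiffOn_fderiv_apply {F : Type*} [NormedAddCommGroup F] [NormedSpace ℝ F]
    (hΩ : IsOpen Ω) {f : E → F} (hf : ContDiffOn ℝ (⊤ : ℕ∞) f Ω)
    {W : E → E} (hW : ContDiffOn ℝ (⊤ : ℕ∞) W Ω) :
    ContDiffOn ℝ (⊤ : ℕ∞) (fun x => fderiv ℝ f x (W x)) Ω :=
  (hf.fderiv_of_isOpen hΩ (by simp)).clm_apply hW

theorem differentiableAt_extendZero (hΩ : IsOpen Ω) (f : smoothFunctions Ω) (x : Ω) :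
    DifferentiableAt ℝ (extendZero Ω f) x :=
  (f.2.contDiffAt (hΩ.mem_nhds x.2)).differentiableAt (by simp)

/-- A smooth vector field as a derivation of the algebra of smooth functions. -/
def smoothDerivation (hΩ : IsOpen Ω) (W : E → E) (hW : ContDiffOn ℝ (⊤ : ℕ∞) W Ω) :
    Derivation ℝ (smoothFunctions Ω) (smoothFunctions Ω) :=
  Derivation.mk'
    { toFun := fun f => smoothRestrict (fun x => fderiv ℝ (extendZero Ω f) x (W x))
        (contDiffOn_fderiv_apply hΩ f.2 hW)
      map_add' := fun f g => by
        ext x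
        have h : extendZero Ω (f + g : Ω → ℝ) =ᶠ[𝓝 (x : E)]
            extendZero Ω f + extendZero Ω g :=
          extendZero_eventuallyEq hΩ (fun x => by simp [extendZero_apply]) x
        simp [h.fderiv_eq, fderiv_add (differentiableAt_extendZero hΩ f x)
          (differentiableAt_extendZero hΩ g x)]
      map_smul' := fun r f => by
        ext x
        have h : extendZero Ω (r • f : Ω → ℝ) =ᶠ[𝓝 (x : E)] r • extendZero Ω f :=
          extendZero_eventuallyEq hΩ (fun x => by simp [extendZero_apply]) x
        simp [h.fderiv_eq, fderiv_const_smul (differentiableAt_extendZero hΩ f x)] }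
    fun f g => by
      ext x
      have h : extendZero Ω (f * g : Ω → ℝ) =ᶠ[𝓝 (x : E)]
          extendZero Ω f * extendZero Ω g :=
        extendZero_eventuallyEq hΩ (fun x => by simp [extendZero_apply]) x
      simp [h.fderiv_eq, fderiv_mul (differentiableAt_extendZero hΩ f x)
          (differentiableAt_extendZero hΩ g x), extendZero_apply]

theorem smoothDerivation_apply (hΩ : IsOpen Ω) {W : E → E} (hW : ContDiffOn ℝ (⊤ : ℕ∞) W Ω)
    (f : smoothFunctions Ω) (x : Ω) :
    (smoothDerivation hΩ W hW f : Ω → ℝ) x = fderiv ℝ (extendZero Ω f) x (W x) := rfl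

theorem smoothDerivation_restrict_apply (hΩ : IsOpen Ω) {W : E → E}
    (hW : ContDiffOn ℝ (⊤ : ℕ∞) W Ω) {g : E → ℝ} (hg : ContDiffOn ℝ (⊤ : ℕ∞) g Ω) (x : Ω) :
    (smoothDerivation hΩ W hW (smoothRestrict g hg) : Ω → ℝ) x = fderiv ℝ g x (W x) := by
  have h : extendZero Ω (smoothRestrict g hg) =ᶠ[𝓝 (x : E)] g :=
    extendZero_eventuallyEq hΩ (smoothRestrict_apply g hg) x
  rw [smoothDerivation_apply, h.fderiv_eq]

/-- The Lie bracket of two vector fields acts on functions as the commutator. -/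
theorem smoothDerivation_lieBracket (hΩ : IsOpen Ω) {Z W : E → E}
    (hZ : ContDiffOn ℝ (⊤ : ℕ∞) Z Ω) (hW : ContDiffOn ℝ (⊤ : ℕ∞) W Ω)
    (hZW : ContDiffOn ℝ (⊤ : ℕ∞) (VectorField.lieBracket ℝ Z W) Ω) (f : smoothFunctions Ω) :
    smoothDerivation hΩ _ hZW f =
      smoothDerivation hΩ Z hZ (smoothDerivation hΩ W hW f) -
        smoothDerivation hΩ W hW (smoothDerivation hΩ Z hZ f) := by
  ext x
  have hf := f.2.contDiffAt (hΩ.mem_nhds x.2)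
  have hdf : DifferentiableAt ℝ (fderiv ℝ (extendZero Ω f)) x :=
    (hf.fderiv_right (m := 1) (by norm_cast)).differentiableAt (by simp)
  -- In the commutator the second-order terms cancel by symmetry of the second derivative.
  have hsymm := hf.isSymmSndFDerivAt (by simp; norm_cast)
  have key : ∀ {W : E → E} (hW : ContDiffOn ℝ (⊤ : ℕ∞) W Ω) (v : E),
      fderiv ℝ (extendZero Ω (smoothDerivation hΩ W hW f)) x v =
        fderiv ℝ (fderiv ℝ (extendZero Ω f)) x v (W x) +
          fderiv ℝ (extendZero Ω f) x (fderiv ℝ W x v) := fun {W} hW v => by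
    have hW' : DifferentiableAt ℝ W x :=
      (hW.contDiffAt (hΩ.mem_nhds x.2)).differentiableAt (by simp)
    have h : extendZero Ω (smoothDerivation hΩ W hW f) =ᶠ[𝓝 (x : E)]
        fun y => fderiv ℝ (extendZero Ω f) y (W y) :=
      extendZero_eventuallyEq hΩ (fun y => smoothDerivation_apply hΩ hW f y) x
    rw [h.fderiv_eq, fderiv_clm_apply hdf hW']
    simp [add_comm]
  simp only [smoothDerivation_apply, AddSubgroupClass.coe_sub, Pi.sub_apply, key,
    VectorField.lieBracket, map_sub]
  rw [hsymm.eq (Z x) (W x)]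
  ring
end SmoothFunctions
end

/-! ### The force and torque balance in dimensionless form. -/

noncomputable section
namespace Purcell

/-- Since e ⊗ e + n ⊗ n = I, the matrix is (I + n ⊗ n) / 2. In terms of the normals, the force
balance becomes a polynomial identity that needs no further trigonometric relation. -/
theorem dragMatrix_eq (q : Config) (i : ℤ) :
    dragMatrix q i = !![1 / 2 + 1 / 2 * normal q i 0 ^ 2, 1 / 2 * (normal q i 0 * normal q i 1);
      1 / 2 * (normal q i 0 * normal q i 1), 1 / 2 + 1 / 2 * normal q i 1 ^ 2] := by
  have h := Real.sin_sq_add_cos_sq (q 2 + relAngle q i)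
  ext j k
  fin_cases j <;> fin_cases k <;>
    simp [dragMatrix, tangent, normal] <;> first | ring1 | linear_combination -1 / 2 * h

theorem sigmaPlus_values : sigmaPlus (-1) = -1 ∧ sigmaPlus 0 = 1 ∧ sigmaPlus 1 = 1 := by
  refine ⟨?_, ?_, ?_⟩ <;> simp [sigmaPlus, -mul_one]

theorem sigmaMinus_values : sigmaMinus (-1) = -1 ∧ sigmaMinus 0 = -1 ∧ sigmaMinus 1 = 1 := by
  refine ⟨?_, ?_, ?_⟩ <;> simp [sigmaMinus, -mul_neg, -mul_one]

theorem normal_dotProduct_self (q : Config) (i : ℤ) : normal q i ⬝ᵥ normal q i = 1 := by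
  simp [normal, dotProduct, Fin.sum_univ_two, ← sq]

theorem dragMatrix_mulVec_normal (q : Config) (i : ℤ) :
    dragMatrix q i *ᵥ normal q i = normal q i := by
  have h := normal_dotProduct_self q i
  simp only [dotProduct, Fin.sum_univ_two] at h
  rw [dragMatrix_eq]
  ext j
  fin_cases j <;> simp [Matrix.mulVec, dotProduct, Fin.sum_univ_two]
  · linear_combination normal q i 0 / 2 * h
  · linear_combination normal q i 1 / 2 * h

/-- Link lengths in terms of the total length `N` and the fraction `l` taken by an outer link. -/
theorem linkLengths_eq {L lam l N : ℝ} (h : L = l * N) (h' : lam * L = (1 - 2 * l) * N) :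
    linkLengths L lam = fun i => if i = 0 then (1 - 2 * l) * N else l * N := by
  funext i
  rw [linkLengths, h', h]

/-- The force and torque balance in dimensionless form. -/
theorem grandResistance_mulVec_add (μ r : ℝ) (q : Config) {l N : ℝ} {len : ℤ → ℝ}
    (hlen : len = fun i => if i = 0 then (1 - 2 * l) * N else l * N) (X Y Θ u v : ℝ) :
    grandResistance μ r len q *ᵥ ![N * X, N * Y, Θ] + u • shapeLoad μ r len q (-1) +
        v • shapeLoad μ r len q 1 =
      (2 * Real.pi * μ / logDist r q) •
        ![N ^ 2 * totalForceX l (Real.sin (q 2)) (Real.cos (q 2)) (Real.sin (q 2 + q 3))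
            (Real.cos (q 2 + q 3)) (Real.sin (q 2 + q 4)) (Real.cos (q 2 + q 4))
            (N / (q 1 * logDist r q)) X Y Θ (Θ + u) (Θ + v),
          N ^ 2 * totalForceY l (Real.sin (q 2)) (Real.cos (q 2)) (Real.sin (q 2 + q 3))
            (Real.cos (q 2 + q 3)) (Real.sin (q 2 + q 4)) (Real.cos (q 2 + q 4))
            (N / (q 1 * logDist r q)) X Y Θ (Θ + u) (Θ + v),
          N ^ 3 * totalTorque l (Real.sin (q 2)) (Real.cos (q 2)) (Real.sin (q 2 + q 3))
            (Real.cos (q 2 + q 3)) (Real.sin (q 2 + q 4)) (Real.cos (q 2 + q 4))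
            (N / (q 1 * logDist r q)) X Y Θ (Θ + u) (Θ + v)] := by
  have sum3 : ∀ {M : Type} [AddCommMonoid M] (f : ℤ → M),
      ∑ i ∈ ({-1, 0, 1} : Finset ℤ), f i = f (-1) + (f 0 + f 1) := fun f => by
    rw [Finset.sum_insert (by decide), Finset.sum_insert (by decide), Finset.sum_singleton]
  have sP := sigmaPlus_values
  have sM := sigmaMinus_values
  have m1 : ∀ k, dragMoment μ r len q k (-1) = 2 * Real.pi * μ / logDist r q *
      ((2 + (1 - 2 * l) * (N / (q 1 * logDist r q)) * Real.sin (q 2)) * ((l * N) ^ (k + 1) / (k + 1)) +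
        2 * (N / (q 1 * logDist r q)) * Real.sin (q 2 + q 3) * l * ((l * N) ^ (k + 1) / (k + 2))) := by
    intro k
    simp [dragMoment, dragG, dragK, hlen, sP, sM, relAngle]
    ring
  have m2 : ∀ k, dragMoment μ r len q k 1 = 2 * Real.pi * μ / logDist r q *
      ((2 - (1 - 2 * l) * (N / (q 1 * logDist r q)) * Real.sin (q 2)) * ((l * N) ^ (k + 1) / (k + 1)) -
        2 * (N / (q 1 * logDist r q)) * Real.sin (q 2 + q 4) * l * ((l * N) ^ (k + 1) / (k + 2))) := by
    intro k
    simp [dragMoment, dragG, dragK, hlen, sP, sM, relAngle]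
    ring
  have m0 : ∀ k, dragMoment μ r len q k 0 = 2 * Real.pi * μ / logDist r q *
      ((2 + (1 - 2 * l) * (N / (q 1 * logDist r q)) * Real.sin (q 2)) *
          (((1 - 2 * l) * N) ^ (k + 1) / (k + 1)) -
        2 * (N / (q 1 * logDist r q)) * Real.sin (q 2) * (1 - 2 * l) *
          (((1 - 2 * l) * N) ^ (k + 1) / (k + 2))) := by
    intro k
    simp [dragMoment, dragG, dragK, hlen, sP, sM, relAngle]
    ring
  have n0 : normal q 0 = ![-Real.sin (q 2), Real.cos (q 2)] := by simp [normal, relAngle]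
  have nA : normal q (-1) = ![-Real.sin (q 2 + q 3), Real.cos (q 2 + q 3)] := by
    simp [normal, relAngle]
  have nB : normal q 1 = ![-Real.sin (q 2 + q 4), Real.cos (q 2 + q 4)] := by
    simp [normal, relAngle]
  have hA : grandResistance μ r len q *ᵥ ![N * X, N * Y, Θ] = ![
      resistA μ r len q 0 0 * (N * X) + resistA μ r len q 0 1 * (N * Y) + resistGamma μ r len q 0 * Θ,
      resistA μ r len q 1 0 * (N * X) + resistA μ r len q 1 1 * (N * Y) + resistGamma μ r len q 1 * Θ,
      resistGamma μ r len q 0 * (N * X) + resistGamma μ r len q 1 * (N * Y) +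
        resistDelta μ r len q * Θ] := by
    ext j
    fin_cases j <;> simp [grandResistance, Matrix.mulVec, dotProduct, Fin.sum_univ_three]
  have e0 : len 0 = (1 - 2 * l) * N := by simp [hlen]
  rw [hA]
  simp only [shapeLoad, shapeForce, shapeTorque, resistA, resistGamma, resistDelta, sum3,
    dragMatrix_mulVec_normal, normal_dotProduct_self, m0, m1, m2, sP, sM, e0]
  simp only [dragMatrix_eq, n0, nA, nB]
  -- What remains is polynomial in the sines and cosines, which can be treated as independent
  -- variables.
  generalize 2 * Real.pi * μ / logDist r q = κ
  generalize N / (q 1 * logDist r q) = a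
  generalize Real.sin (q 2) = s0
  generalize Real.cos (q 2) = c0
  generalize Real.sin (q 2 + q 3) = sA
  generalize Real.cos (q 2 + q 3) = cA
  generalize Real.sin (q 2 + q 4) = sB
  generalize Real.cos (q 2 + q 4) = cB
  ext j
  fin_cases j <;>
    simp only [Fin.zero_eta, Fin.mk_one, Fin.reduceFinMk, Fin.isValue, Pi.add_apply, Pi.smul_apply,
      Matrix.add_apply, Matrix.smul_apply, Matrix.of_apply, Matrix.cons_val, Matrix.cons_val_zero,
      Matrix.cons_val_one, smul_eq_mul, totalForceX, totalForceY, totalTorque, linkTorque,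
      linkForceX, linkForceY, linkNormalForce, moment0, moment1, moment2, hingeNormal, hingeX,
      hingeY, dotProduct, Fin.sum_univ_two, Matrix.mulVec]
  all_goals push_cast; ring
end Purcell
end

/-! ### Smoothness of the control fields and openness of the admissible set. -/

noncomputable section
namespace Purcell

section Smoothness
variable {r : ℝ}

theorem logDist_pos (hr : 0 < r) {q : Config} (hq : r < 2 * q 1) : 0 < logDist r q :=
  Real.log_pos (by rwa [one_lt_div hr])

theorem isOpen_lt_height (r : ℝ) : IsOpen {q : Config | r < 2 * q 1} :=
  isOpen_lt continuous_const (by fun_prop)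

theorem contDiff_relAngle (i : ℤ) : ContDiff ℝ (⊤ : ℕ∞) fun q : Config => relAngle q i := by
  unfold relAngle
  split_ifs <;> fun_prop

theorem contDiff_sin_angle (i : ℤ) :
    ContDiff ℝ (⊤ : ℕ∞) fun q : Config => Real.sin (q 2 + relAngle q i) :=
  ((contDiff_apply ℝ ℝ (2 : Fin 5)).add (contDiff_relAngle i)).sin

theorem contDiff_cos_angle (i : ℤ) :
    ContDiff ℝ (⊤ : ℕ∞) fun q : Config => Real.cos (q 2 + relAngle q i) :=
  ((contDiff_apply ℝ ℝ (2 : Fin 5)).add (contDiff_relAngle i)).cos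

theorem contDiff_normal (i : ℤ) (j : Fin 2) :
    ContDiff ℝ (⊤ : ℕ∞) fun q : Config => normal q i j := by
  fin_cases j
  · exact (contDiff_sin_angle i).neg
  · exact contDiff_cos_angle i

theorem contDiff_dragMatrix (i : ℤ) (j k : Fin 2) :
    ContDiff ℝ (⊤ : ℕ∞) fun q : Config => dragMatrix q i j k := by
  have h := contDiff_normal i
  have h0 := h 0
  have h1 := h 1
  simp only [dragMatrix_eq]
  fin_cases j <;> fin_cases k <;> simp <;> fun_prop

theorem contDiffOn_logDist (hr : 0 < r) :
    ContDiffOn ℝ (⊤ : ℕ∞) (logDist r) {q | r < 2 * q 1} := by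
  refine ContDiffOn.log (by fun_prop) fun q hq => ?_
  have : 0 < 2 * q 1 := hr.trans hq
  positivity

theorem contDiffOn_inv_logDist (hr : 0 < r) :
    ContDiffOn ℝ (⊤ : ℕ∞) (fun q => (logDist r q)⁻¹) {q | r < 2 * q 1} :=
  (contDiffOn_logDist hr).inv fun _ hq => (logDist_pos hr hq).ne'

theorem contDiffOn_inv_height (hr : 0 < r) :
    ContDiffOn ℝ (⊤ : ℕ∞) (fun q : Config => (q 1)⁻¹) {q | r < 2 * q 1} :=
  ContDiffOn.inv (by fun_prop) fun q hq => by
    have : 0 < 2 * q 1 := hr.trans hq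
    exact ne_of_gt (by linarith)

variable (μ : ℝ) (len : ℤ → ℝ)

theorem contDiffOn_dragMoment (hr : 0 < r) (k : ℕ) (i : ℤ) :
    ContDiffOn ℝ (⊤ : ℕ∞) (fun q => dragMoment μ r len q k i) {q | r < 2 * q 1} := by
  have h1 := contDiffOn_inv_logDist hr
  have h2 := contDiffOn_inv_height hr
  have h3 := (contDiff_sin_angle i).contDiffOn (s := {q : Config | r < 2 * q 1})
  have h4 : ContDiffOn ℝ (⊤ : ℕ∞) (fun q : Config => Real.sin (q 2)) {q | r < 2 * q 1} := by fun_prop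
  simp only [dragMoment, dragG, dragK, div_eq_mul_inv, mul_inv, ← inv_pow]
  fun_prop

theorem contDiffOn_grandResistance (hr : 0 < r) (j k : Fin 3) :
    ContDiffOn ℝ (⊤ : ℕ∞) (fun q => grandResistance μ r len q j k) {q | r < 2 * q 1} := by
  have hm := contDiffOn_dragMoment μ len hr
  have hn := fun i j => (contDiff_normal i j).contDiffOn (s := {q : Config | r < 2 * q 1})
  have hd := fun i j k => (contDiff_dragMatrix i j k).contDiffOn (s := {q : Config | r < 2 * q 1})
  have hA : ∀ j k, ContDiffOn ℝ (⊤ : ℕ∞) (fun q => resistA μ r len q j k) {q | r < 2 * q 1} := by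
    intro j k
    simp only [resistA, Matrix.sum_apply, Matrix.smul_apply, smul_eq_mul]
    exact ContDiffOn.sum fun i _ => (hm 0 i).mul (hd i j k)
  have hG : ∀ j, ContDiffOn ℝ (⊤ : ℕ∞) (fun q => resistGamma μ r len q j) {q | r < 2 * q 1} := by
    intro j
    simp only [resistGamma, Finset.sum_apply, Pi.add_apply, Pi.smul_apply, smul_eq_mul,
      Matrix.mulVec, dotProduct, Fin.sum_univ_two]
    exact ContDiffOn.sum fun i _ => (((hm 1 i).mul contDiffOn_const).mul (hn i j)).add
      ((contDiffOn_const.mul (hm 0 i)).mul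
        (((hd i j 0).mul (hn 0 0)).add ((hd i j 1).mul (hn 0 1))))
  have hD : ContDiffOn ℝ (⊤ : ℕ∞) (fun q => resistDelta μ r len q) {q | r < 2 * q 1} := by
    simp only [resistDelta, Matrix.mulVec, dotProduct, Fin.sum_univ_two]
    exact ContDiffOn.sum fun i _ => (((contDiffOn_const.mul (hm 0 i)).mul
      (((hn 0 0).mul (((hd i 0 0).mul (hn 0 0)).add ((hd i 0 1).mul (hn 0 1)))).add
        ((hn 0 1).mul (((hd i 1 0).mul (hn 0 0)).add ((hd i 1 1).mul (hn 0 1)))))).add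
      ((contDiffOn_const.mul (hm 1 i)).mul (contDiffOn_const.mul
        (((hn 0 0).mul (hn i 0)).add ((hn 0 1).mul (hn i 1)))))).add (hm 2 i)
  fin_cases j <;> fin_cases k
  exacts [hA 0 0, hA 0 1, hG 0, hA 1 0, hA 1 1, hG 1, hG 0, hG 1, hD]

theorem contDiffOn_shapeLoad (hr : 0 < r) (i : ℤ) (j : Fin 3) :
    ContDiffOn ℝ (⊤ : ℕ∞) (fun q => shapeLoad μ r len q i j) {q | r < 2 * q 1} := by
  have hm := contDiffOn_dragMoment μ len hr
  have hn := fun i j => (contDiff_normal i j).contDiffOn (s := {q : Config | r < 2 * q 1})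
  have hF : ∀ j, ContDiffOn ℝ (⊤ : ℕ∞) (fun q => shapeForce μ r len q i j) {q | r < 2 * q 1} :=
    fun j => (contDiffOn_const.mul (hm 1 i)).mul (hn i j)
  have hT : ContDiffOn ℝ (⊤ : ℕ∞) (fun q => shapeTorque μ r len q i) {q | r < 2 * q 1} := by
    simp only [shapeTorque, dotProduct, Fin.sum_univ_two]
    exact ((contDiffOn_const.mul (hm 1 i)).mul
      (((hn 0 0).mul (hn i 0)).add ((hn 0 1).mul (hn i 1)))).add (hm 2 i)
  fin_cases j
  exacts [hF 0, hF 1, hT]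

theorem contDiffOn_det_grandResistance (hr : 0 < r) :
    ContDiffOn ℝ (⊤ : ℕ∞) (fun q => (grandResistance μ r len q).det) {q | r < 2 * q 1} := by
  have hM := contDiffOn_grandResistance μ len hr
  simp only [Matrix.det_fin_three]
  fun_prop

theorem isOpen_isAdmissible (hr : 0 < r) : IsOpen {q | IsAdmissible μ r len q} :=
  (contDiffOn_det_grandResistance μ len hr).continuousOn.isOpen_inter_preimage
    (isOpen_lt_height r) isOpen_compl_singleton

theorem contDiffOn_bodyVelocity (hr : 0 < r) (i : ℤ) (j : Fin 3) :
    ContDiffOn ℝ (⊤ : ℕ∞) (fun q => bodyVelocity μ r len q i j) {q | IsAdmissible μ r len q} := by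
  have hsub : {q | IsAdmissible μ r len q} ⊆ {q | r < 2 * q 1} := fun q hq => hq.1
  have hM := fun j k => (contDiffOn_grandResistance μ len hr j k).mono hsub
  have hg := fun j => (contDiffOn_shapeLoad μ len hr i j).mono hsub
  have hd := ((contDiffOn_det_grandResistance μ len hr).mono hsub).inv fun q hq => hq.2
  have hadj : ∀ j k, ContDiffOn ℝ (⊤ : ℕ∞) (fun q => (grandResistance μ r len q).adjugate j k)
      {q | IsAdmissible μ r len q} := by
    intro j k
    simp only [Matrix.adjugate_fin_three]
    fin_cases j <;> fin_cases k <;> simp <;> fun_prop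
  simp only [bodyVelocity, Matrix.inv_def, Ring.inverse_eq_inv', Matrix.mulVec, dotProduct,
    Matrix.smul_apply, smul_eq_mul, Pi.neg_apply]
  exact (ContDiffOn.sum fun k _ => (hd.mul (hadj j k)).mul (hg k)).neg

theorem contDiffOn_fieldLeft (hr : 0 < r) :
    ContDiffOn ℝ (⊤ : ℕ∞) (fieldLeft μ r len) {q | IsAdmissible μ r len q} := by
  have h := contDiffOn_bodyVelocity μ len hr (-1)
  refine contDiffOn_pi.2 fun j => ?_
  fin_cases j
  exacts [h 0, h 1, h 2, contDiffOn_const, contDiffOn_const]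

theorem contDiffOn_fieldRight (hr : 0 < r) :
    ContDiffOn ℝ (⊤ : ℕ∞) (fieldRight μ r len) {q | IsAdmissible μ r len q} := by
  have h := contDiffOn_bodyVelocity μ len hr 1
  refine contDiffOn_pi.2 fun j => ?_
  fin_cases j
  exacts [h 0, h 1, h 2, contDiffOn_const, contDiffOn_const]

end Smoothness
end Purcell
end

/-! ### Force balance along the control fields; admissibility of aligned configurations. -/

noncomputable section
namespace Purcell

section Naturality
variable {A B : Type*} [CommRing A] [Algebra ℝ A] [CommRing B] [Algebra ℝ B] (φ : A →ₐ[ℝ] B)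
  (l : ℝ) (s0 c0 sA cA sB cB a X Y Θ ωA ωB : A)

/-- Forces and torques are polynomial expressions, so they commute with algebra homomorphisms. With
evaluation at a point as the homomorphism, the pointwise balance becomes an identity of functions.
-/
theorem map_linkForceX (σ : ℝ) : φ (linkForceX σ l s0 c0 a sA cA X Y Θ ωA) =
    linkForceX σ l (φ s0) (φ c0) (φ a) (φ sA) (φ cA) (φ X) (φ Y) (φ Θ) (φ ωA) := by
  simp [linkForceX, linkNormalForce, moment0, moment1, hingeNormal, hingeX, hingeY]

theorem map_linkForceY (σ : ℝ) : φ (linkForceY σ l s0 c0 a sA cA X Y Θ ωA) =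
    linkForceY σ l (φ s0) (φ c0) (φ a) (φ sA) (φ cA) (φ X) (φ Y) (φ Θ) (φ ωA) := by
  simp [linkForceY, linkNormalForce, moment0, moment1, hingeNormal, hingeX, hingeY]

theorem map_totalForceX : φ (totalForceX l s0 c0 sA cA sB cB a X Y Θ ωA ωB) =
    totalForceX l (φ s0) (φ c0) (φ sA) (φ cA) (φ sB) (φ cB) (φ a) (φ X) (φ Y) (φ Θ) (φ ωA)
      (φ ωB) := by
  simp [totalForceX, map_linkForceX]

theorem map_totalForceY : φ (totalForceY l s0 c0 sA cA sB cB a X Y Θ ωA ωB) =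
    totalForceY l (φ s0) (φ c0) (φ sA) (φ cA) (φ sB) (φ cB) (φ a) (φ X) (φ Y) (φ Θ) (φ ωA)
      (φ ωB) := by
  simp [totalForceY, map_linkForceY]

theorem map_totalTorque : φ (totalTorque l s0 c0 sA cA sB cB a X Y Θ ωA ωB) =
    totalTorque l (φ s0) (φ c0) (φ sA) (φ cA) (φ sB) (φ cB) (φ a) (φ X) (φ Y) (φ Θ) (φ ωA)
      (φ ωB) := by
  simp [totalTorque, linkTorque, map_linkForceX, map_linkForceY, moment1, moment2, hingeNormal,
    hingeX, hingeY]
end Naturality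

/-- The velocity of the configuration for the control values `u` and `v`. -/
def controlField (μ r : ℝ) (len : ℤ → ℝ) (u v : ℝ) (q : Config) : Config :=
  u • fieldLeft μ r len q + v • fieldRight μ r len q

theorem controlField_apply_three (μ r : ℝ) (len : ℤ → ℝ) (u v : ℝ) (q : Config) :
    controlField μ r len u v q 3 = u := by
  simp [controlField, fieldLeft, fieldRight]

theorem controlField_apply_four (μ r : ℝ) (len : ℤ → ℝ) (u v : ℝ) (q : Config) :
    controlField μ r len u v q 4 = v := by
  simp [controlField, fieldLeft, fieldRight]

theorem contDiffOn_controlField (μ : ℝ) {r : ℝ} (hr : 0 < r) (len : ℤ → ℝ) (u v : ℝ) :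
    ContDiffOn ℝ (⊤ : ℕ∞) (controlField μ r len u v) {q | IsAdmissible μ r len q} :=
  ((contDiffOn_fieldLeft μ len hr).const_smul u).add ((contDiffOn_fieldRight μ len hr).const_smul v)

theorem grandResistance_mulVec_bodyVelocity {μ r : ℝ} {len : ℤ → ℝ} {q : Config}
    (hq : IsAdmissible μ r len q) (i : ℤ) :
    grandResistance μ r len q *ᵥ bodyVelocity μ r len q i = -shapeLoad μ r len q i := by
  rw [bodyVelocity, Matrix.mulVec_neg, Matrix.mulVec_mulVec,
    Matrix.mul_nonsing_inv _ (isUnit_iff_ne_zero.2 hq.2), Matrix.one_mulVec]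

/-- The total force and torque vanish along the control fields. -/
theorem force_balance {μ r : ℝ} (hμ : 0 < μ) (hr : 0 < r) {l N : ℝ} (hN : 0 < N) {len : ℤ → ℝ}
    (hlen : len = fun i => if i = 0 then (1 - 2 * l) * N else l * N) {q : Config}
    (hq : IsAdmissible μ r len q) (u v : ℝ) :
    totalForceX l (Real.sin (q 2)) (Real.cos (q 2)) (Real.sin (q 2 + q 3)) (Real.cos (q 2 + q 3))
      (Real.sin (q 2 + q 4)) (Real.cos (q 2 + q 4)) (N / (q 1 * logDist r q))
      (controlField μ r len u v q 0 / N) (controlField μ r len u v q 1 / N)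
      (controlField μ r len u v q 2) (controlField μ r len u v q 2 + u)
      (controlField μ r len u v q 2 + v) = 0 ∧
    totalForceY l (Real.sin (q 2)) (Real.cos (q 2)) (Real.sin (q 2 + q 3)) (Real.cos (q 2 + q 3))
      (Real.sin (q 2 + q 4)) (Real.cos (q 2 + q 4)) (N / (q 1 * logDist r q))
      (controlField μ r len u v q 0 / N) (controlField μ r len u v q 1 / N)
      (controlField μ r len u v q 2) (controlField μ r len u v q 2 + u)
      (controlField μ r len u v q 2 + v) = 0 ∧
    totalTorque l (Real.sin (q 2)) (Real.cos (q 2)) (Real.sin (q 2 + q 3)) (Real.cos (q 2 + q 3))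
      (Real.sin (q 2 + q 4)) (Real.cos (q 2 + q 4)) (N / (q 1 * logDist r q))
      (controlField μ r len u v q 0 / N) (controlField μ r len u v q 1 / N)
      (controlField μ r len u v q 2) (controlField μ r len u v q 2 + u)
      (controlField μ r len u v q 2 + v) = 0 := by
  have hκ : 2 * Real.pi * μ / logDist r q ≠ 0 := by
    have := logDist_pos hr hq.1
    positivity
  have h := grandResistance_mulVec_add μ r q hlen (controlField μ r len u v q 0 / N)
    (controlField μ r len u v q 1 / N) (controlField μ r len u v q 2) u v
  have hb : ![N * (controlField μ r len u v q 0 / N), N * (controlField μ r len u v q 1 / N),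
      controlField μ r len u v q 2] =
      u • bodyVelocity μ r len q (-1) + v • bodyVelocity μ r len q 1 := by
    ext j
    fin_cases j <;> simp [controlField, fieldLeft, fieldRight] <;> field_simp
  rw [hb, Matrix.mulVec_add, Matrix.mulVec_smul, Matrix.mulVec_smul,
    grandResistance_mulVec_bodyVelocity hq, grandResistance_mulVec_bodyVelocity hq] at h
  have h' := smul_eq_zero.1 (h.symm.trans (by module))
  have h'' := h'.resolve_left hκ
  refine ⟨?_, ?_, ?_⟩
  · exact (mul_eq_zero.1 (congrFun h'' 0)).resolve_left (by positivity)
  · exact (mul_eq_zero.1 (congrFun h'' 1)).resolve_left (by positivity)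
  · exact (mul_eq_zero.1 (congrFun h'' 2)).resolve_left (by positivity)

/-- Aligned configurations parallel to the wall are admissible. -/
theorem isAdmissible_aligned {μ r : ℝ} (hμ : 0 < μ) (hr : 0 < r) {l N : ℝ} (hN : 0 < N)
    {len : ℤ → ℝ} (hlen : len = fun i => if i = 0 then (1 - 2 * l) * N else l * N) (x : ℝ) {y : ℝ}
    (hy : r < 2 * y) : IsAdmissible μ r len ![x, y, 0, 0, 0] := by
  have hy' : r < 2 * (![x, y, 0, 0, 0] : Config) 1 := by simpa using hy
  refine ⟨hy', fun hdet => ?_⟩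
  obtain ⟨b, hb, hMb⟩ := Matrix.exists_mulVec_eq_zero_iff.2 hdet
  have hκ : 2 * Real.pi * μ / logDist r ![x, y, 0, 0, 0] ≠ 0 := by
    have := logDist_pos hr hy'
    positivity
  have h := grandResistance_mulVec_add μ r ![x, y, 0, 0, 0] hlen (b 0 / N) (b 1 / N) (b 2) 0 0
  have hb' : ![N * (b 0 / N), N * (b 1 / N), b 2] = b := by
    ext j
    fin_cases j <;> simp <;> field_simp
  rw [hb', hMb, zero_smul, zero_smul, add_zero, add_zero] at h
  have h' := (smul_eq_zero.1 h.symm).resolve_left hκ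
  have hN' : ∀ k, N ^ k ≠ 0 := fun k => by positivity
  have h0 := (mul_eq_zero.1 (congrFun h' 0)).resolve_left (hN' _)
  have h1 := (mul_eq_zero.1 (congrFun h' 1)).resolve_left (hN' _)
  have h2 := (mul_eq_zero.1 (congrFun h' 2)).resolve_left (hN' _)
  simp [totalForceX, totalForceY, totalTorque, linkTorque, linkForceX, linkForceY,
    linkNormalForce, moment0, moment1, moment2, hingeNormal, hingeX, hingeY,
    -mul_eq_zero] at h0 h1 h2
  -- The diagonal resistance of the straight rod again, with entries 1, 2 and 1/6: its kernel is
  -- trivial.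
  have e0 : b 0 / N = 0 := by linear_combination h0
  have e1 : b 1 / N = 0 := by linear_combination h1 / 2
  have e2 : b 2 = 0 := by linear_combination 6 * h2
  refine hb (funext fun j => ?_)
  fin_cases j
  · simpa [hN.ne'] using e0
  · simpa [hN.ne'] using e1
  · exact e2
end Purcell
end

/-! ### The wall ratio and the algebra of the concrete swimmer. -/

noncomputable section
namespace Purcell

theorem fderiv_comp_clm_apply {E : Type*} [NormedAddCommGroup E] [NormedSpace ℝ E] (φ : E →L[ℝ] ℝ)
    {h : ℝ → ℝ} {h' : ℝ} {q : E} (hh : HasDerivAt h h' (φ q)) (w : E) :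
    fderiv ℝ (fun p => h (φ p)) q w = h' * φ w := by
  have h : HasFDerivAt (fun p => h (φ p)) (h' • φ) q := hh.comp_hasFDerivAt q φ.hasFDerivAt
  rw [h.fderiv]
  rfl

/-- The ratio of the length of the swimmer to `y log (2 y / r)`, and the functions that generate its
derivatives. -/
def wallRatio (r N y : ℝ) : ℝ := N / (y * Real.log (2 * y / r))
def wallRatio₁ (r N y : ℝ) : ℝ := -(wallRatio r N y ^ 2 * (Real.log (2 * y / r) + 1))
def wallRatio₂ (r N y : ℝ) : ℝ :=
  wallRatio r N y ^ 3 * (2 * Real.log (2 * y / r) ^ 2 + 3 * Real.log (2 * y / r) + 2)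

section
variable {r N y : ℝ}

theorem hasDerivAt_log_height (hr : 0 < r) (hy : r < 2 * y) :
    HasDerivAt (fun y => Real.log (2 * y / r)) y⁻¹ y := by
  have hy0 : 0 < y := by linarith
  have h := (((hasDerivAt_id' y).const_mul 2).div_const r).log (by positivity)
  exact h.congr_deriv (by field_simp)

theorem log_height_pos (hr : 0 < r) (hy : r < 2 * y) : 0 < Real.log (2 * y / r) :=
  Real.log_pos (by rwa [one_lt_div hr])

/-- The division by N compensates for measuring the vertical velocity in units of N: along a field,
the derivative of a is then a1 * Y. -/
theorem hasDerivAt_wallRatio (hr : 0 < r) (hy : r < 2 * y) :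
    HasDerivAt (wallRatio r N) (wallRatio₁ r N y / N) y := by
  have hy0 : 0 < y := by linarith
  have hl := log_height_pos hr hy
  have h := (hasDerivAt_const y N).fun_div
    ((hasDerivAt_id' y).fun_mul (hasDerivAt_log_height hr hy)) (by positivity)
  refine h.congr_deriv ?_
  simp only [wallRatio₁, wallRatio]
  field_simp
  ring

theorem hasDerivAt_wallRatio₁ (hr : 0 < r) (hN : 0 < N) (hy : r < 2 * y) :
    HasDerivAt (wallRatio₁ r N) (wallRatio₂ r N y / N) y := by
  have hy0 : 0 < y := by linarith
  have hl := log_height_pos hr hy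
  have h := (((hasDerivAt_wallRatio (N := N) hr hy).fun_pow 2).fun_mul
    ((hasDerivAt_log_height hr hy).add_const 1)).fun_neg
  refine h.congr_deriv ?_
  simp only [wallRatio₂, wallRatio₁, wallRatio, Nat.reduceSub, pow_one, Nat.cast_ofNat]
  generalize Real.log (2 * y / r) = t at hl ⊢
  field_simp
  ring

/-- This and the next two signs are all that the positivity of the bracket components needs to know
about the wall. -/
theorem wallRatio_pos (hr : 0 < r) (hN : 0 < N) (hy : r < 2 * y) : 0 < wallRatio r N y := by
  have hy0 : 0 < y := by linarith
  have hl := log_height_pos hr hy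
  unfold wallRatio
  positivity

theorem wallRatio₁_neg (hr : 0 < r) (hN : 0 < N) (hy : r < 2 * y) : wallRatio₁ r N y < 0 := by
  have hl := log_height_pos hr hy
  have ha := wallRatio_pos hr hN hy
  unfold wallRatio₁
  have : 0 < wallRatio r N y ^ 2 * (Real.log (2 * y / r) + 1) := by positivity
  linarith

theorem wallRatio₂_pos (hr : 0 < r) (hN : 0 < N) (hy : r < 2 * y) : 0 < wallRatio₂ r N y := by
  have hl := log_height_pos hr hy
  have ha := wallRatio_pos hr hN hy
  unfold wallRatio₂
  positivity
end

section
variable (μ : ℝ) {r : ℝ} (len : ℤ → ℝ)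

theorem contDiffOn_wallRatio (N : ℝ) (hr : 0 < r) :
    ContDiffOn ℝ (⊤ : ℕ∞) (fun q : Config => wallRatio r N (q 1)) {q | IsAdmissible μ r len q} := by
  have hsub : {q | IsAdmissible μ r len q} ⊆ {q | r < 2 * q 1} := fun q hq => hq.1
  have h1 := (contDiffOn_inv_logDist hr).mono hsub
  have h2 := (contDiffOn_inv_height hr).mono hsub
  simp only [logDist] at h1
  simp only [wallRatio, div_eq_mul_inv N, mul_inv]
  fun_prop

theorem contDiffOn_wallRatio₁ (N : ℝ) (hr : 0 < r) :
    ContDiffOn ℝ (⊤ : ℕ∞) (fun q : Config => wallRatio₁ r N (q 1)) {q | IsAdmissible μ r len q} := by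
  have h : ContDiffOn ℝ (⊤ : ℕ∞) (fun q : Config => Real.log (2 * q 1 / r))
      {q | IsAdmissible μ r len q} := (contDiffOn_logDist hr).mono fun q hq => hq.1
  have h' := contDiffOn_wallRatio μ len N hr
  simp only [wallRatio₁]
  exact ((h'.pow 2).mul (h.add contDiffOn_const)).neg

theorem contDiffOn_wallRatio₂ (N : ℝ) (hr : 0 < r) :
    ContDiffOn ℝ (⊤ : ℕ∞) (fun q : Config => wallRatio₂ r N (q 1)) {q | IsAdmissible μ r len q} := by
  have h : ContDiffOn ℝ (⊤ : ℕ∞) (fun q : Config => Real.log (2 * q 1 / r))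
      {q | IsAdmissible μ r len q} := (contDiffOn_logDist hr).mono fun q hq => hq.1
  have h' := contDiffOn_wallRatio μ len N hr
  simp only [wallRatio₂]
  fun_prop

/-- The derivation given by a control field. -/
def controlDerivation (hr : 0 < r) (u v : ℝ) :
    Derivation ℝ (smoothFunctions {q | IsAdmissible μ r len q})
      (smoothFunctions {q | IsAdmissible μ r len q}) :=
  smoothDerivation (isOpen_isAdmissible μ len hr) (controlField μ r len u v)
    (contDiffOn_controlField μ hr len u v)

/-- The components of a control field. -/
def fieldComponent (hr : 0 < r) (u v : ℝ) (j : Fin 5) :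
    smoothFunctions {q | IsAdmissible μ r len q} :=
  smoothRestrict (fun q => controlField μ r len u v q j)
    (contDiffOn_pi.1 (contDiffOn_controlField μ hr len u v) j)

variable {μ len}

/-- A smooth function of a linear coordinate. -/
def coordFunction {Ω : Set Config} (φ : Config →L[ℝ] ℝ) (h : ℝ → ℝ)
    (hh : ContDiffOn ℝ (⊤ : ℕ∞) (fun q => h (φ q)) Ω) : smoothFunctions Ω :=
  smoothRestrict (fun q => h (φ q)) hh

theorem controlDerivation_coordFunction (hr : 0 < r) (u v : ℝ) (φ : Config →L[ℝ] ℝ) {h h' : ℝ → ℝ}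
    (hh : ContDiffOn ℝ (⊤ : ℕ∞) (fun q => h (φ q)) {q | IsAdmissible μ r len q})
    (hd : ∀ q, IsAdmissible μ r len q → HasDerivAt h (h' (φ q)) (φ q))
    (x : {q | IsAdmissible μ r len q}) :
    (controlDerivation μ len hr u v (coordFunction φ h hh) : _ → ℝ) x =
      h' (φ x) * φ (controlField μ r len u v x) := by
  rw [coordFunction, controlDerivation, smoothDerivation_restrict_apply]
  exact fderiv_comp_clm_apply φ (hd x x.2) _

/-- The angle of link `j` as a linear function, for the outer links `3` and `4`. -/
def outerAngle (j : Fin 5) : Config →L[ℝ] ℝ :=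
  ContinuousLinearMap.proj (R := ℝ) (φ := fun _ => ℝ) 2 + ContinuousLinearMap.proj j

variable (μ len) in
/-- The algebraic data of the swimmer. -/
def swimmerAlgebra (hμ : 0 < μ) (hr : 0 < r) {l N : ℝ} (hN : 0 < N)
    (hlen : len = fun i => if i = 0 then (1 - 2 * l) * N else l * N) (x : ℝ) {y : ℝ}
    (hy : r < 2 * y) : SwimmerAlgebra (smoothFunctions {q | IsAdmissible μ r len q}) l where
  S := controlDerivation μ len hr 1 1
  V := controlDerivation μ len hr (-1) 1
  ev := smoothEval ⟨![x, y, 0, 0, 0], isAdmissible_aligned hμ hr hN hlen x hy⟩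
  s0 := coordFunction (ContinuousLinearMap.proj 2) Real.sin (by fun_prop)
  c0 := coordFunction (ContinuousLinearMap.proj 2) Real.cos (by fun_prop)
  sA := coordFunction (outerAngle 3) Real.sin (by fun_prop)
  cA := coordFunction (outerAngle 3) Real.cos (by fun_prop)
  sB := coordFunction (outerAngle 4) Real.sin (by fun_prop)
  cB := coordFunction (outerAngle 4) Real.cos (by fun_prop)
  a := coordFunction (ContinuousLinearMap.proj 1) (wallRatio r N) (contDiffOn_wallRatio μ len N hr)
  a1 := coordFunction (ContinuousLinearMap.proj 1) (wallRatio₁ r N)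
    (contDiffOn_wallRatio₁ μ len N hr)
  a2 := coordFunction (ContinuousLinearMap.proj 1) (wallRatio₂ r N)
    (contDiffOn_wallRatio₂ μ len N hr)
  -- Translation velocities are divided by the total length, so that the balance involves only l and
  -- the wall ratio.
  X1 := N⁻¹ • fieldComponent μ len hr 1 1 0
  Y1 := N⁻¹ • fieldComponent μ len hr 1 1 1
  Θ1 := fieldComponent μ len hr 1 1 2
  X2 := N⁻¹ • fieldComponent μ len hr (-1) 1 0
  Y2 := N⁻¹ • fieldComponent μ len hr (-1) 1 1
  Θ2 := fieldComponent μ len hr (-1) 1 2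
  S_s0 := by
    ext q
    exact controlDerivation_coordFunction hr _ _ _ _
      (fun q _ => Real.hasDerivAt_sin _) q
  S_c0 := by
    ext q
    refine (controlDerivation_coordFunction hr _ _ _ (h' := fun t => -Real.sin t) _
      (fun q _ => Real.hasDerivAt_cos _) q).trans ?_
    exact neg_mul _ _
  S_sA := by
    ext q
    refine (controlDerivation_coordFunction hr _ _ _ _
      (fun q _ => Real.hasDerivAt_sin _) q).trans ?_
    simp [outerAngle, coordFunction, fieldComponent, controlField_apply_three]
  S_cA := by
    ext q
    refine (controlDerivation_coordFunction hr _ _ _ (h' := fun t => -Real.sin t) _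
      (fun q _ => Real.hasDerivAt_cos _) q).trans ?_
    simp [outerAngle, coordFunction, fieldComponent, controlField_apply_three]
  S_sB := by
    ext q
    refine (controlDerivation_coordFunction hr _ _ _ _
      (fun q _ => Real.hasDerivAt_sin _) q).trans ?_
    simp [outerAngle, coordFunction, fieldComponent, controlField_apply_four]
  S_cB := by
    ext q
    refine (controlDerivation_coordFunction hr _ _ _ (h' := fun t => -Real.sin t) _
      (fun q _ => Real.hasDerivAt_cos _) q).trans ?_
    simp [outerAngle, coordFunction, fieldComponent, controlField_apply_four]
  V_s0 := by
    ext q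
    exact controlDerivation_coordFunction hr _ _ _ _
      (fun q _ => Real.hasDerivAt_sin _) q
  V_c0 := by
    ext q
    refine (controlDerivation_coordFunction hr _ _ _ (h' := fun t => -Real.sin t) _
      (fun q _ => Real.hasDerivAt_cos _) q).trans ?_
    exact neg_mul _ _
  V_sA := by
    ext q
    refine (controlDerivation_coordFunction hr _ _ _ _
      (fun q _ => Real.hasDerivAt_sin _) q).trans ?_
    simp [outerAngle, coordFunction, fieldComponent, controlField_apply_three, sub_eq_add_neg]
  V_cA := by
    ext q
    refine (controlDerivation_coordFunction hr _ _ _ (h' := fun t => -Real.sin t) _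
      (fun q _ => Real.hasDerivAt_cos _) q).trans ?_
    simp [outerAngle, coordFunction, fieldComponent, controlField_apply_three, sub_eq_add_neg]
  V_sB := by
    ext q
    refine (controlDerivation_coordFunction hr _ _ _ _
      (fun q _ => Real.hasDerivAt_sin _) q).trans ?_
    simp [outerAngle, coordFunction, fieldComponent, controlField_apply_four]
  V_cB := by
    ext q
    refine (controlDerivation_coordFunction hr _ _ _ (h' := fun t => -Real.sin t) _
      (fun q _ => Real.hasDerivAt_cos _) q).trans ?_
    simp [outerAngle, coordFunction, fieldComponent, controlField_apply_four]
  S_a := by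
    ext q
    refine (controlDerivation_coordFunction hr _ _ _ (h' := fun y => wallRatio₁ r N y / N) _
      (fun q hq => hasDerivAt_wallRatio hr hq.1) q).trans ?_
    simp [coordFunction, fieldComponent]
    ring
  S_a1 := by
    ext q
    refine (controlDerivation_coordFunction hr _ _ _ (h' := fun y => wallRatio₂ r N y / N) _
      (fun q hq => hasDerivAt_wallRatio₁ hr hN hq.1) q).trans ?_
    simp [coordFunction, fieldComponent]
    ring
  V_a := by
    ext q
    refine (controlDerivation_coordFunction hr _ _ _ (h' := fun y => wallRatio₁ r N y / N) _
      (fun q hq => hasDerivAt_wallRatio hr hq.1) q).trans ?_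
    simp [coordFunction, fieldComponent]
    ring
  V_a1 := by
    ext q
    refine (controlDerivation_coordFunction hr _ _ _ (h' := fun y => wallRatio₂ r N y / N) _
      (fun q hq => hasDerivAt_wallRatio₁ hr hN hq.1) q).trans ?_
    simp [coordFunction, fieldComponent]
    ring
  ev_s0 := by simp [coordFunction]
  ev_c0 := by simp [coordFunction]
  ev_sA := by simp [coordFunction, outerAngle]
  ev_cA := by simp [coordFunction, outerAngle]
  ev_sB := by simp [coordFunction, outerAngle]
  ev_cB := by simp [coordFunction, outerAngle]
  forceX_S := by
    ext q
    refine (map_totalForceX (smoothEval q) l ..).trans ?_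
    have h := (force_balance hμ hr hN hlen q.2 1 1).1
    simpa [coordFunction, outerAngle, fieldComponent, wallRatio, logDist, div_eq_inv_mul] using h
  forceY_S := by
    ext q
    refine (map_totalForceY (smoothEval q) l ..).trans ?_
    have h := (force_balance hμ hr hN hlen q.2 1 1).2.1
    simpa [coordFunction, outerAngle, fieldComponent, wallRatio, logDist, div_eq_inv_mul] using h
  torque_S := by
    ext q
    refine (map_totalTorque (smoothEval q) l ..).trans ?_
    have h := (force_balance hμ hr hN hlen q.2 1 1).2.2
    simpa [coordFunction, outerAngle, fieldComponent, wallRatio, logDist, div_eq_inv_mul] using h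
  forceX_V := by
    ext q
    refine (map_totalForceX (smoothEval q) l ..).trans ?_
    have h := (force_balance hμ hr hN hlen q.2 (-1) 1).1
    simpa [coordFunction, outerAngle, fieldComponent, wallRatio, logDist, div_eq_inv_mul,
      sub_eq_add_neg] using h
  forceY_V := by
    ext q
    refine (map_totalForceY (smoothEval q) l ..).trans ?_
    have h := (force_balance hμ hr hN hlen q.2 (-1) 1).2.1
    simpa [coordFunction, outerAngle, fieldComponent, wallRatio, logDist, div_eq_inv_mul,
      sub_eq_add_neg] using h
  torque_V := by
    ext q
    refine (map_totalTorque (smoothEval q) l ..).trans ?_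
    have h := (force_balance hμ hr hN hlen q.2 (-1) 1).2.2
    simpa [coordFunction, outerAngle, fieldComponent, wallRatio, logDist, div_eq_inv_mul,
      sub_eq_add_neg] using h
end
end Purcell
end

/-! ### Brackets as commutators, and the spanning criterion. -/

noncomputable section

section Brackets
variable {E : Type*} [NormedAddCommGroup E] [NormedSpace ℝ E] {Ω : Set E} (hΩ : IsOpen Ω)
  {S V : E → E} (hS : ContDiffOn ℝ (⊤ : ℕ∞) S Ω) (hV : ContDiffOn ℝ (⊤ : ℕ∞) V Ω)
  (f : smoothFunctions Ω)

open VectorField (lieBracket)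

/-- Iterated Lie brackets act on functions as iterated commutators. -/
theorem smoothDerivation_iterated_lieBracket
    (h₁ : ContDiffOn ℝ (⊤ : ℕ∞) (lieBracket ℝ S V) Ω)
    (h₂ : ContDiffOn ℝ (⊤ : ℕ∞) (lieBracket ℝ S (lieBracket ℝ S V)) Ω)
    (h₃ : ContDiffOn ℝ (⊤ : ℕ∞) (lieBracket ℝ S (lieBracket ℝ S (lieBracket ℝ S V))) Ω)
    (h₄ : ContDiffOn ℝ (⊤ : ℕ∞) (lieBracket ℝ V (lieBracket ℝ S (lieBracket ℝ S V))) Ω) :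
    let s := smoothDerivation hΩ S hS
    let v := smoothDerivation hΩ V hV
    smoothDerivation hΩ _ h₃ f =
      s (s (s (v f))) - (3 : ℝ) • s (s (v (s f))) + (3 : ℝ) • s (v (s (s f))) - v (s (s (s f))) ∧
    smoothDerivation hΩ _ h₄ f =
      (-2 : ℝ) • v (s (v (s f))) + v (v (s (s f))) - s (s (v (v f))) + (2 : ℝ) • s (v (s (v f))) := by
  intro s v
  have e₁ := smoothDerivation_lieBracket hΩ hS hV h₁
  have e₂ := smoothDerivation_lieBracket hΩ hS h₁ h₂
  constructor
  · rw [smoothDerivation_lieBracket hΩ hS h₂ h₃, e₂, e₂, e₁, e₁, e₁]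
    simp only [map_sub, s, v]
    module
  -- The two words V S S V cancel, so that derivative is never needed.
  · rw [smoothDerivation_lieBracket hΩ hV h₂ h₄, e₂, e₂, e₁, e₁, e₁, e₁]
    simp only [map_sub, s, v]
    module
end Brackets

/-- Vectors that span together with two of the coordinates. -/
theorem det_ne_zero_of_triangular {s v z c a : Fin 5 → ℝ} (hs3 : s 3 = 1) (hs4 : s 4 = 1)
    (hv3 : v 3 = -1) (hv4 : v 4 = 1) (hz0 : z 0 ≠ 0) (hz1 : z 1 = 0)
    (hz2 : z 2 = 0) (hz3 : z 3 = 0) (hz4 : z 4 = 0) (hc1 : c 1 = 0)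
    (hc2 : c 2 ≠ 0) (hc3 : c 3 = 0) (hc4 : c 4 = 0) (ha1 : a 1 ≠ 0) (ha3 : a 3 = 0)
    (ha4 : a 4 = 0) : (Matrix.of ![s, v, z, c, a]).det ≠ 0 := by
  intro hdet
  obtain ⟨w, hw, hMw⟩ := Matrix.exists_mulVec_eq_zero_iff.2 hdet
  have h0 := congrFun hMw 0
  have h1 := congrFun hMw 1
  have h2 := congrFun hMw 2
  have h3 := congrFun hMw 3
  have h4 := congrFun hMw 4
  simp [Matrix.mulVec, dotProduct, Fin.sum_univ_five, hs3, hs4, hv3, hv4, hz1, hz2, hz3, hz4,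
    hc1, hc3, hc4, ha3, ha4, hz0] at h0 h1 h2 h3 h4
  -- Elimination in triangular order: row z gives w 0, then c gives w 2, then a gives w 1, and s, v
  -- leave w 3 ± w 4 = 0.
  have w0 : w 0 = 0 := h2
  have w2 : w 2 = 0 := by simpa [w0, hc2] using h3
  have w1 : w 1 = 0 := by simpa [w0, w2, ha1] using h4
  rw [w0, w1, w2] at h0 h1
  refine hw (funext fun j => ?_)
  fin_cases j
  exacts [w0, w1, w2, by simp; linarith, by simp; linarith]

/-- The span of vector fields that are a basis at one point of an open set is everything near that
point. -/
theorem eventually_span_eq_top {Ω : Set (Fin 5 → ℝ)} (hΩ : IsOpen Ω)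
    {X : Fin 5 → (Fin 5 → ℝ) → (Fin 5 → ℝ)} (hX : ∀ i, ContinuousOn (X i) Ω) {q₀ : Fin 5 → ℝ}
    (hq₀ : q₀ ∈ Ω) (hdet : (Matrix.of fun i => X i q₀).det ≠ 0) :
    ∀ᶠ q in 𝓝 q₀, Submodule.span ℝ (range fun i => X i q) = ⊤ := by
  obtain ⟨D, hD⟩ : ∃ D : (Fin 5 → Fin 5 → ℝ) → ℝ, ∀ M, D M = (Matrix.of M).det := ⟨_, fun _ => rfl⟩
  have hd : Continuous D := by
    simp only [funext hD, Matrix.det_apply]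
    fun_prop
  have hX' : ContinuousAt (fun q i => X i q) q₀ :=
    continuousAt_pi.2 fun i => (hX i).continuousAt (hΩ.mem_nhds hq₀)
  have hc : ContinuousAt (fun q => D fun i => X i q) q₀ := hd.continuousAt.comp hX'
  rw [← hD] at hdet
  filter_upwards [hc.eventually_ne hdet] with q hq
  rw [hD] at hq
  exact (Matrix.linearIndependent_rows_of_det_ne_zero hq).span_eq_top_of_card_eq_finrank' (by simp)

namespace Purcell
section
variable {μ r : ℝ} {len : ℤ → ℝ}

/-- Controllability in terms of the control fields with control values `(1, 1)` and `(-1, 1)`. -/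
theorem locallyControllableAt_of_span (hr : 0 < r) {Ω : Set Config} (hΩ : IsOpen Ω)
    (hadm : ∀ q ∈ Ω, IsAdmissible μ r len q)
    (hspan : ∀ q ∈ Ω, Submodule.span ℝ {w | ∃ Z, IsIteratedBracket (controlField μ r len 1 1)
      (controlField μ r len (-1) 1) Z ∧ w = Z q} = ⊤) {q₀ : Config} (hq₀ : q₀ ∈ Ω) :
    LocallyControllableAt μ r len q₀ := by
  intro U hU T hT ρ hρ
  have hsub : Ω ∩ interior U ⊆ {q | IsAdmissible μ r len q} := fun q hq => hadm q hq.1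
  obtain ⟨W, hW, hst⟩ := exists_nhds_steerable (hΩ.inter isOpen_interior)
    ((contDiffOn_controlField μ hr len 1 1).mono hsub)
    ((contDiffOn_controlField μ hr len (-1) 1).mono hsub) (fun q hq => hspan q hq.1)
    ⟨hq₀, mem_interior_iff_mem_nhds.2 hU⟩ (half_pos hρ) hT
  refine ⟨W, hW, fun p hp p' hp' => ?_⟩
  obtain ⟨u, v, q, hu, hv, hb, hq, hm, hqU, h0, h1⟩ := hst p hp p' hp'
  -- u S + v V equals (u - v) times the left field plus (u + v) times the right one. The bound ρ / 2
  -- on u and v keeps these controls within ρ.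
  refine ⟨fun t => u t - v t, fun t => u t + v t, q, hu.sub hv, hu.add hv, fun t => ⟨?_, ?_⟩,
    ⟨hq, fun t ht => hsub (hqU t ht), fun t ht => ?_⟩, fun t ht => interior_subset (hqU t ht).2,
    h0, h1⟩
  · exact (abs_sub _ _).trans (by linarith [(hb t).1, (hb t).2])
  · exact (abs_add_le _ _).trans (by linarith [(hb t).1, (hb t).2])
  · rw [hm t ht]
    congr 1
    refine intervalIntegral.integral_congr fun s _ => ?_
    simp only [controlField]
    module
end
end Purcell
end

/-! ### Independence of the five fields at the aligned configuration. -/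

noncomputable section
namespace Purcell
open VectorField (lieBracket)
section
variable {μ r : ℝ} {len : ℤ → ℝ}

theorem smoothDerivation_coord {Ω : Set Config} (hΩ : IsOpen Ω) {W : Config → Config}
    (hW : ContDiffOn ℝ (⊤ : ℕ∞) W Ω) (j : Fin 5)
    (hj : ContDiffOn ℝ (⊤ : ℕ∞) (fun q : Config => q j) Ω) (x : Ω) :
    (smoothDerivation hΩ W hW (smoothRestrict (fun q => q j) hj) : Ω → ℝ) x = W x j := by
  rw [smoothDerivation_restrict_apply]
  exact congrFun (congrArg DFunLike.coe
    (ContinuousLinearMap.proj (R := ℝ) (φ := fun _ : Fin 5 => ℝ) j).fderiv) (W x)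

theorem controlDerivation_coord (hr : 0 < r) (u v : ℝ) (j : Fin 5)
    (hj : ContDiffOn ℝ (⊤ : ℕ∞) (fun q : Config => q j) {q | IsAdmissible μ r len q}) :
    controlDerivation μ len hr u v (smoothRestrict (fun q => q j) hj) =
      fieldComponent μ len hr u v j := by
  ext x
  exact smoothDerivation_coord _ _ j hj x

theorem fieldComponent_three (hr : 0 < r) (u v : ℝ) :
    fieldComponent μ len hr u v 3 = algebraMap ℝ _ u := by
  ext x
  exact controlField_apply_three μ r len u v x

theorem fieldComponent_four (hr : 0 < r) (u v : ℝ) :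
    fieldComponent μ len hr u v 4 = algebraMap ℝ _ v := by
  ext x
  exact controlField_apply_four μ r len u v x

set_option maxHeartbeats 400000 in
/-- At an aligned configuration parallel to the wall, the control fields and three of their iterated
brackets are linearly independent. -/
theorem det_brackets_ne_zero (hμ : 0 < μ) (hr : 0 < r) {l N : ℝ} (hN : 0 < N) (hl : 0 < l)
    (hl' : l < 1 / 2) (hlen : len = fun i => if i = 0 then (1 - 2 * l) * N else l * N) (x : ℝ) {y : ℝ}
    (hy : r < 2 * y) {S V : Config → Config} (hS : S = controlField μ r len 1 1)
    (hV : V = controlField μ r len (-1) 1) {q₀ : Config} (hq₀ : q₀ = ![x, y, 0, 0, 0]) :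
    (Matrix.of ![S q₀, V q₀, lieBracket ℝ S V q₀, lieBracket ℝ S (lieBracket ℝ S (lieBracket ℝ S V)) q₀,
      lieBracket ℝ V (lieBracket ℝ S (lieBracket ℝ S V)) q₀]).det ≠ 0 := by
  have hΩ := isOpen_isAdmissible μ len hr
  have hq : q₀ ∈ {q | IsAdmissible μ r len q} :=
    hq₀ ▸ isAdmissible_aligned hμ hr hN hlen x hy
  have hSc : ContDiffOn ℝ (⊤ : ℕ∞) S {q | IsAdmissible μ r len q} :=
    hS ▸ contDiffOn_controlField μ hr len 1 1
  have hVc : ContDiffOn ℝ (⊤ : ℕ∞) V {q | IsAdmissible μ r len q} :=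
    hV ▸ contDiffOn_controlField μ hr len (-1) 1
  have h₁ := hSc.lieBracket_of_isOpen hΩ hVc
  have h₂ := hSc.lieBracket_of_isOpen hΩ h₁
  have h₃ := hSc.lieBracket_of_isOpen hΩ h₂
  have h₄ := hVc.lieBracket_of_isOpen hΩ h₂
  have hc : ∀ j, ContDiffOn ℝ (⊤ : ℕ∞) (fun q : Config => q j) {q | IsAdmissible μ r len q} :=
    fun j => by fun_prop
  let s := smoothDerivation hΩ S hSc
  let v := smoothDerivation hΩ V hVc
  let ev := smoothEval ⟨q₀, hq⟩
  let X₁ := fieldComponent μ len hr 1 1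
  let X₂ := fieldComponent μ len hr (-1) 1
  have e₁ : ∀ j, s (smoothRestrict (fun q => q j) (hc j)) = X₁ j := fun j => by
    subst hS
    exact controlDerivation_coord hr 1 1 j (hc j)
  have e₂ : ∀ j, v (smoothRestrict (fun q => q j) (hc j)) = X₂ j := fun j => by
    subst hV
    exact controlDerivation_coord hr (-1) 1 j (hc j)
  have b₁ : ∀ j, lieBracket ℝ S V q₀ j = ev (s (X₂ j)) - ev (v (X₁ j)) := fun j => by
    rw [← smoothDerivation_coord hΩ h₁ j (hc j) ⟨q₀, hq⟩, smoothDerivation_lieBracket hΩ hSc hVc h₁,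
      e₁, e₂]
    rfl
  have hbr := fun f => smoothDerivation_iterated_lieBracket hΩ hSc hVc f h₁ h₂ h₃ h₄
  have b₂ : ∀ j, lieBracket ℝ S (lieBracket ℝ S (lieBracket ℝ S V)) q₀ j =
      ev (s (s (s (X₂ j)))) - 3 * ev (s (s (v (X₁ j)))) + 3 * ev (s (v (s (X₁ j)))) -
        ev (v (s (s (X₁ j)))) := fun j => by
    rw [← smoothDerivation_coord hΩ h₃ j (hc j) ⟨q₀, hq⟩, (hbr _).1, e₁, e₂]
    rfl
  have b₃ : ∀ j, lieBracket ℝ V (lieBracket ℝ S (lieBracket ℝ S V)) q₀ j =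
      -2 * ev (v (s (v (X₁ j)))) + ev (v (v (s (X₁ j)))) - ev (s (s (v (X₂ j)))) +
        2 * ev (s (v (s (X₂ j)))) := fun j => by
    rw [← smoothDerivation_coord hΩ h₄ j (hc j) ⟨q₀, hq⟩, (hbr _).2, e₁, e₂]
    rfl
  subst hS hV
  subst hq₀
  let G := swimmerAlgebra μ len hμ hr hN hlen x hy
  have hGa : G.ev G.a = wallRatio r N y := rfl
  have hGa1 : G.ev G.a1 = wallRatio₁ r N y := rfl
  have hGa2 : G.ev G.a2 = wallRatio₂ r N y := rfl
  have ha := hGa ▸ wallRatio_pos hr hN hy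
  have ha1 := hGa1 ▸ wallRatio₁_neg hr hN hy
  have ha2 := hGa2 ▸ wallRatio₂_pos hr hN hy
  have hGS : G.S = s := rfl
  have hGV : G.V = v := rfl
  have hGev : G.ev = ev := rfl
  have hΘ1 : G.Θ1 = X₁ 2 := rfl
  have hΘ2 : G.Θ2 = X₂ 2 := rfl
  have hX1 : G.X1 = N⁻¹ • X₁ 0 := rfl
  have hX2 : G.X2 = N⁻¹ • X₂ 0 := rfl
  have hY1 : G.Y1 = N⁻¹ • X₁ 1 := rfl
  have hY2 : G.Y2 = N⁻¹ • X₂ 1 := rfl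
  obtain ⟨z0, z1, z2⟩ := G.ev_bracket_SV hl hl'
  obtain ⟨c1, c2⟩ := G.ev_bracket_SSSV hl hl' ha ha1
  have a1 := G.ev_bracket_VSSV hl hl' ha ha1 ha2
  simp only [hGS, hGV, hGev, hΘ1, hΘ2, hX1, hX2, hY1, hY2, Derivation.map_smul, ev_smul]
    at z0 z1 z2 c1 c2 a1
  -- The shape components of the control fields are constants, which every derivation kills, so no
  -- bracket moves the shape.
  have hs3 : ∀ D : Derivation ℝ (smoothFunctions {q | IsAdmissible μ r len q})
      (smoothFunctions {q | IsAdmissible μ r len q}), D (X₁ 3) = 0 ∧ D (X₁ 4) = 0 ∧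
        D (X₂ 3) = 0 ∧ D (X₂ 4) = 0 := fun D => by
    simp only [X₁, X₂, fieldComponent_three, fieldComponent_four, Derivation.map_algebraMap,
      and_self]
  refine det_ne_zero_of_triangular ?_ ?_ ?_ ?_ ?_ ?_ ?_ ?_ ?_
    ?_ ?_ ?_ ?_ ?_ ?_ ?_
  · rw [controlField_apply_three]
  · rw [controlField_apply_four]
  · rw [controlField_apply_three]
  · rw [controlField_apply_four]
  · rw [b₁]
    intro h
    refine z0.ne' ?_
    linear_combination N⁻¹ * h
  · rw [b₁]
    have := hN.ne'
    refine mul_left_cancel₀ (inv_ne_zero this) ?_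
    linear_combination z1
  · rw [b₁]
    exact z2
  · simp [b₁, hs3]
  · simp [b₁, hs3]
  · rw [b₂]
    refine mul_left_cancel₀ (inv_ne_zero hN.ne') ?_
    linear_combination c1
  · rw [b₂]
    exact c2.ne
  · simp [b₂, hs3]
  · simp [b₂, hs3]
  · rw [b₃]
    intro h
    refine a1.ne ?_
    linear_combination N⁻¹ * h
  · simp [b₃, hs3]
  · simp [b₃, hs3]
end
end Purcell
end

/-! ### Local controllability near the aligned configuration. -/

theorem theorem1 (μ r L lam : ℝ) (hμ : 0 < μ) (hr : 0 < r) (hL : 0 < L) (hlam : 0 < lam)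
    (x y : ℝ) (hy : r < 2 * y) :
    ∀ᶠ q in 𝓝 (![x, y, 0, 0, 0] : Purcell.Config),
      Purcell.LocallyControllableAt μ r (Purcell.linkLengths L lam) q := by
  open Purcell in
  have hl : 0 < 1 / (2 + lam) := by positivity
  -- The total length is N = (2 + λ) L and l = 1 / (2 + λ) is the fraction of an outer link; l < 1/2
  -- says that the central link has positive length.
  have hl' : 1 / (2 + lam) < 1 / 2 := one_div_lt_one_div_of_lt (by norm_num) (by linarith)
  have hN : 0 < (2 + lam) * L := by positivity
  have hlen := linkLengths_eq (L := L) (lam := lam) (l := 1 / (2 + lam)) (N := (2 + lam) * L)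
    (by field_simp) (by field_simp; ring)
  set len := linkLengths L lam
  have hΩ := isOpen_isAdmissible μ len hr
  have hq₀ := isAdmissible_aligned hμ hr hN hlen x hy
  have hdet := det_brackets_ne_zero hμ hr hN hl hl' hlen x hy rfl rfl rfl
  set S := controlField μ r len 1 1
  set V := controlField μ r len (-1) 1
  have hS : ContDiffOn ℝ (⊤ : ℕ∞) S {q | IsAdmissible μ r len q} :=
    contDiffOn_controlField μ hr len 1 1
  have hV : ContDiffOn ℝ (⊤ : ℕ∞) V {q | IsAdmissible μ r len q} :=
    contDiffOn_controlField μ hr len (-1) 1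
  let X : Fin 5 → Config → Config := ![S, V, VectorField.lieBracket ℝ S V,
    VectorField.lieBracket ℝ S (VectorField.lieBracket ℝ S (VectorField.lieBracket ℝ S V)),
    VectorField.lieBracket ℝ V (VectorField.lieBracket ℝ S (VectorField.lieBracket ℝ S V))]
  have hX : ∀ i, IsIteratedBracket S V (X i) := fun i => by
    fin_cases i
    exacts [.left, .right, .bracket_left .right, .bracket_left (.bracket_left (.bracket_left .right)),
      .bracket_right (.bracket_left (.bracket_left .right))]
  have hdet' : (Matrix.of fun i => X i ![x, y, 0, 0, 0]).det ≠ 0 := by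
    convert hdet using 3
    ext i
    fin_cases i <;> rfl
  have hspan := eventually_span_eq_top hΩ (fun i => ((hX i).contDiffOn hΩ hS hV).continuousOn) hq₀
    hdet'
  -- The five fields still span on a whole open set W of admissible configurations, so the criterion
  -- applies at each of its points.
  obtain ⟨W, hW, hWo, hqW⟩ := eventually_nhds_iff.1 (hspan.and (hΩ.mem_nhds hq₀))
  filter_upwards [hWo.mem_nhds hqW] with q hq
  refine locallyControllableAt_of_span hr hWo (fun p hp => (hW p hp).2) (fun p hp => ?_) hq
  refine top_unique ((hW p hp).1.symm.le.trans (Submodule.span_mono ?_))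
  rintro _ ⟨i, rfl⟩
  exact ⟨X i, hX i, rfl⟩
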